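/- **Setting.** Let $n\ge 1$ agents be given, together with directed graphs $\mathcal G_R,\mathcal G_C$ on $\{1,\dots,n\}$ and matrices $R,C\in\mathbb R^{n\times n}$ with the following properties. $R$ is row-stochastic and $C$ is column-stochastic; $R_{ij}>0$ iff $(j,i)\in\mathcal E_R$ or $i=j$, and $C_{ij}>0$ iff $(j,i)\in\mathcal E_C$ or $i=j$ (in particular the diagonals are positive); and $\mathcal G_R$ and $\mathcal G_{C^\top}$ (the graph $\mathcal G_C$ with all edges reversed) have spanning trees with a common root. Let $\pi_R,\pi_C$ be the unique probability vectors with $\pi_R^\top R=\pi_R^\top$ and $C\pi_C=\pi_C$, and put $\Pi_R=\mathbf 1\pi_R^\top$, $\Pi_C=\pi_C\mathbf 1^\top$, $c_\pi=n\,\pi_R^\top\pi_C$, $c_\Pi=\|I-\Pi_C\|_2^2$. Fix weighted norms $\|X\|_R=\|S_RX\|_F$, $\|X\|_C=\|S_CX\|_F$ on $n$-row matrices, with $S_R,S_C$ invertible, and constants $\rho_R,\rho_C\in(0,1)$, $\delta_R,\delta_C\ge1$ such that $\|X\|_F\le\|X\|_\nu\le\delta_\nu\|X\|_F$ for $\nu\in\{R,C\}$,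 $\|RX-\Pi_RX\|_R\le\rho_R\|X-\Pi_RX\|_R$ and $\|CX-\Pi_CX\|_C\le\rho_C\|X-\Pi_CX\|_C$ for all $X$ (such norms exist). Let $f_1,\dots,f_n:\mathbb R^d\to\mathbb R$ be differentiable and bounded below, with $L$-Lipschitz gradients; let $F=\frac1n\sum_if_i$ and $F^*=\inf F$. Let $g_i(x;\xi)$ be square-integrable stochastic gradients with $\mathbb E_{\xi\sim\mathcal D_i}g_i(x;\xi)=\nabla f_i(x)$ and $\mathbb E_{\xi\sim\mathcal D_i}\|g_i(x;\xi)-\nabla f_i(x)\|^2\le\sigma^2$ for all $x$, and let $\xi_{i,k}\sim\mathcal D_i$ be independent over all $i$ and $k$. For $\lambda\in(0,1)$, $\eta>0$ and $x_0\in\mathbb R^d$, SMTPP is the iteration on $n\times d$ matrices (one row per agent) with $X_0=\mathbf 1x_0^\top$, $V_0=M_0=0$ and $$X_{k+1}=R(X_k-\eta V_k),\qquad M_{k+1}=(1-\lambda)M_k+\lambda G_{k+1},\qquad V_{k+1}=CV_k+M_{k+1}-M_k,$$ where row $i$ of $G_{k+1}$ is $g_i(x_{i,k+1};\xi_{i,k+1})$.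 Put $\bar x_k=\pi_R^\top X_k$, $\bar m_k=\frac1n\mathbf 1^\top M_k$, $\bar m_{-1}=0$, $\tilde z_k=\bar x_k-\frac{\eta c_\pi(1-\lambda)}{\lambda}\bar m_{k-1}$, let $\nabla\mathbf F(X)$ be the matrix with rows $\nabla f_i(x_i)$, and for $p\in(0,\infty)^4$ let $$\mathcal V_k=\mathbb E[F(\tilde z_k)-F^*]+p_1\mathbb E\|X_k-\Pi_RX_k\|_R^2+p_2\mathbb E\|V_k-\Pi_CV_k\|_C^2+p_3\mathbb E\|M_k-\nabla\mathbf F(X_k)\|_F^2+p_4\mathbb E\|\bar m_{k-1}\|^2 .$$ **Theorem (non-convex convergence rate).** The vectors $\pi_R,\pi_C$ exist and are unique, $c_\pi>0$, and weighted norms as above exist. There is a constant $K$ depending only on $L,\rho_R,\rho_C,\delta_R,\delta_C,c_\pi,c_\Pi$, and there are constants $c_0>0$ and $B$ depending only on the network (including the chosen norms) and on $L$, such that for all $\lambda\in(0,1)$ and $0<\eta\le c_0\lambda$ there are weights $p=(p_1,p_2,p_3,p_4)$ with positive entries, depending only on the network, $L$, $\lambda$ and $\eta$, with $p_1=1$,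 $p_2\le B\eta$, $p_3\le B\eta$, $p_4\le B(\eta^2/\lambda+\eta^3/\lambda^3)$, for which the following holds for all $d$, $f_i$, $g_i$, $\sigma$ and $x_0$ as above. All the expectations here and in $\mathcal V_k$ are finite, and for every number $T\ge2$ of iterations $$\frac1T\sum_{k=0}^{T-1}\mathbb E\|\nabla F(\bar x_k)\|^2\le\frac{16(\mathcal V_0-\mathcal V_T)}{\eta c_\pi T}+K\Big(\frac{\eta\sigma^2}{n}+\lambda^2\sigma^2n\Big).$$ -/

import Mathlib

open MeasureTheory ProbabilityTheory
open scoped Matrix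

noncomputable section

namespace SMTPP

/-! ### Network -/

/-- The digraph with all edges reversed. If `G` is the graph of a matrix `C`, this is the graph
of `Cᵀ`. -/
def reverse {V : Type*} (G : Digraph V) : Digraph V where
  Adj u v := G.Adj v u

/-- `T` is a spanning tree of the digraph `G` with root `r`: a subgraph of `G` on all the vertices,
in which the root has no parent, every other vertex has exactly one parent, and every vertex can be
reached from the root. -/
structure IsSpanningTree {V : Type*} (G T : Digraph V) (r : V) : Prop where
  le : T ≤ G
  root : ∀ u, ¬ T.Adj u r
  parent : ∀ v, v ≠ r → ∃! u, T.Adj u v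
  reach : ∀ v, Relation.ReflTransGen T.Adj r v

/-- The assumption on the communication network. `G.Adj j i` says that `(j, i)` is an edge, i.e.
that agent `i` receives information from agent `j`. -/
structure IsPushPullNetwork {n : ℕ} (GR GC : Digraph (Fin n))
    (R C : Matrix (Fin n) (Fin n) ℝ) : Prop where
  common_root : ∃ (r : Fin n) (TR TC : Digraph (Fin n)),
    IsSpanningTree GR TR r ∧ IsSpanningTree (reverse GC) TC r
  row_stochastic : R ∈ Matrix.rowStochastic ℝ (Fin n)
  col_stochastic : C ∈ Matrix.colStochastic ℝ (Fin n)
  R_pos_iff : ∀ i j, 0 < R i j ↔ GR.Adj j i ∨ i = j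
  C_pos_iff : ∀ i j, 0 < C i j ↔ GC.Adj j i ∨ i = j
  R_diag_pos : ∀ i, 0 < R i i
  C_diag_pos : ∀ i, 0 < C i i

/-- `π` is a probability vector with `A π = π`. The stationary vector of the column-stochastic `C`
is meant with `A = C`, that of the row-stochastic `R` (`πᵀ R = πᵀ`) with `A = Rᵀ`. -/
structure IsStationary {n : ℕ} (A : Matrix (Fin n) (Fin n) ℝ) (π : Fin n → ℝ) : Prop where
  nonneg : ∀ i, 0 ≤ π i
  sum_eq_one : ∑ i, π i = 1
  fixed : A *ᵥ π = π

/-- `Π_R = 1 π_Rᵀ`. -/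
def projR {n : ℕ} (πR : Fin n → ℝ) : Matrix (Fin n) (Fin n) ℝ := Matrix.vecMulVec 1 πR

/-- `Π_C = π_C 1ᵀ`. -/
def projC {n : ℕ} (πC : Fin n → ℝ) : Matrix (Fin n) (Fin n) ℝ := Matrix.vecMulVec πC 1

/-- `c_π = n π_Rᵀ π_C`. -/
def cPi {n : ℕ} (πR πC : Fin n → ℝ) : ℝ := n * (πR ⬝ᵥ πC)

/-- `c_Π = ‖I - Π_C‖₂²`, with the spectral norm. -/
def cProj {n : ℕ} (πC : Fin n → ℝ) : ℝ :=
  ‖Matrix.toEuclideanCLM (n := Fin n) (𝕜 := ℝ) (1 - projC πC)‖ ^ 2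

/-! ### Matrices with `n` rows in `ℝ^d` and weighted norms -/

/-- The `n × d` matrices, given by their rows. -/
abbrev Rows (n d : ℕ) : Type := Fin n → EuclideanSpace ℝ (Fin d)

/-- The product `A X` of an `n × n` matrix with an `n × d` matrix. -/
def act {n d : ℕ} (A : Matrix (Fin n) (Fin n) ℝ) (X : Rows n d) : Rows n d :=
  fun i => ∑ j, A i j • X j

/-- The Frobenius norm. -/
def frobNorm {n d : ℕ} (X : Rows n d) : ℝ := √(∑ i, ‖X i‖ ^ 2)

/-- The weighted norm `‖X‖_S = ‖S X‖_F`, i.e. the square root of the sum of `‖S x‖₂²` over the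
columns `x` of `X`. -/
def weightedNorm {n d : ℕ} (S : Matrix (Fin n) (Fin n) ℝ) (X : Rows n d) : ℝ :=
  frobNorm (act S X)

/-- The invertible matrix `S` defines a weighted norm that lies between the Frobenius norm and `δ`
times the Frobenius norm, and in which `A` contracts towards the projection `Q` with factor `ρ`. -/
structure IsMixingNorm {n : ℕ} (A Q S : Matrix (Fin n) (Fin n) ℝ) (ρ δ : ℝ) : Prop where
  invertible : IsUnit S
  rho_pos : 0 < ρ
  rho_lt_one : ρ < 1
  one_le_delta : 1 ≤ δ
  frob_le : ∀ (d : ℕ) (X : Rows n d), frobNorm X ≤ weightedNorm S X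
  le_frob : ∀ (d : ℕ) (X : Rows n d), weightedNorm S X ≤ δ * frobNorm X
  contract : ∀ (d : ℕ) (X : Rows n d),
    weightedNorm S (act A X - act Q X) ≤ ρ * weightedNorm S (X - act Q X)

/-! ### Losses and stochastic gradients -/

/-- Differentiable, bounded below, with `L`-Lipschitz gradient. -/
structure IsSmoothLoss {d : ℕ} (L : ℝ) (f : EuclideanSpace ℝ (Fin d) → ℝ) : Prop where
  differentiable : Differentiable ℝ f
  bddBelow : BddBelow (Set.range f)
  lipschitz_gradient : ∀ x y, ‖gradient f x - gradient f y‖ ≤ L * ‖x - y‖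

/-- The global objective `F = (1/n) ∑ f_i`. -/
def globalLoss {n d : ℕ} (f : Fin n → EuclideanSpace ℝ (Fin d) → ℝ)
    (x : EuclideanSpace ℝ (Fin d)) : ℝ := (1 / (n : ℝ)) * ∑ i, f i x

/-- `g x ξ` with `ξ ∼ D` is an unbiased estimate of `∇ f x` of variance at most `σ²`. -/
structure IsGradientOracle {d : ℕ} {Ξ : Type*} [MeasurableSpace Ξ] (D : Measure Ξ) (σ : ℝ)
    (f : EuclideanSpace ℝ (Fin d) → ℝ)
    (g : EuclideanSpace ℝ (Fin d) → Ξ → EuclideanSpace ℝ (Fin d)) : Prop where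
  measurable : Measurable (Function.uncurry g)
  memLp : ∀ x, MemLp (g x) 2 D
  unbiased : ∀ x, ∫ s, g x s ∂D = gradient f x
  variance_le : ∀ x, ∫ s, ‖g x s - gradient f x‖ ^ 2 ∂D ≤ σ ^ 2

/-- The samples `ξ i k` of all agents `i` and iterations `k` are independent, and those of agent `i`
have law `D i`. -/
structure IsSampling {n : ℕ} {Ω : Type*} [MeasurableSpace Ω] (P : Measure Ω)
    {Ξ : Fin n → Type*} [∀ i, MeasurableSpace (Ξ i)] (D : ∀ i, Measure (Ξ i))
    (ξ : ∀ i, ℕ → Ω → Ξ i) : Prop where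
  measurable : ∀ i k, Measurable (ξ i k)
  law : ∀ i k, P.map (ξ i k) = D i
  indep : iIndepFun (β := fun q : Fin n × ℕ => Ξ q.1) (fun q : Fin n × ℕ => ξ q.1 q.2) P

/-! ### The algorithm -/

/-- Models `X`, trackers `V` and momenta `M` of all agents. -/
structure State (n d : ℕ) where
  X : Rows n d
  V : Rows n d
  M : Rows n d

/-- The state after `k` iterations along the sample path `s` (`s i k` is the sample of agent `i` at
iteration `k`). -/
def iter {n d : ℕ} {Ξ : Fin n → Type*} (R C : Matrix (Fin n) (Fin n) ℝ) (η lam : ℝ)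
    (g : ∀ i, EuclideanSpace ℝ (Fin d) → Ξ i → EuclideanSpace ℝ (Fin d))
    (x₀ : EuclideanSpace ℝ (Fin d)) (s : ∀ i, ℕ → Ξ i) : ℕ → State n d
  | 0 => { X := fun _ => x₀, V := 0, M := 0 }
  | k + 1 =>
    let S := iter R C η lam g x₀ s k
    let X' : Rows n d := act R (S.X - η • S.V)
    let M' : Rows n d := fun i => (1 - lam) • S.M i + lam • g i (X' i) (s i (k + 1))
    { X := X', V := act C S.V + (M' - S.M), M := M' }

/-! ### Averages, errors and the Lyapunov function of a random run `Y` -/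

section Run

variable {n d : ℕ} {Ω : Type*}

/-- `x̄_k = π_Rᵀ X_k`. -/
def xbar (πR : Fin n → ℝ) (Y : ℕ → Ω → State n d) (k : ℕ) (ω : Ω) :
    EuclideanSpace ℝ (Fin d) := ∑ i, πR i • (Y k ω).X i

/-- `m̄_{k-1} = (1/n) 1ᵀ M_{k-1}`, with `m̄_{-1} = 0`. -/
def mbarPrev (Y : ℕ → Ω → State n d) : ℕ → Ω → EuclideanSpace ℝ (Fin d)
  | 0, _ => 0
  | k + 1, ω => (1 / (n : ℝ)) • ∑ i, (Y k ω).M i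

/-- The virtual sequence `z̃_k = x̄_k - (η c_π (1 - λ) / λ) m̄_{k-1}`. -/
def ztilde (πR πC : Fin n → ℝ) (η lam : ℝ) (Y : ℕ → Ω → State n d) (k : ℕ) (ω : Ω) :
    EuclideanSpace ℝ (Fin d) :=
  xbar πR Y k ω - (η * cPi πR πC * (1 - lam) / lam) • mbarPrev Y k ω

/-- `‖X_k - Π_R X_k‖_R²`. -/
def consensusSq (πR : Fin n → ℝ) (SR : Matrix (Fin n) (Fin n) ℝ) (Y : ℕ → Ω → State n d)
    (k : ℕ) (ω : Ω) : ℝ :=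
  weightedNorm SR ((Y k ω).X - act (projR πR) (Y k ω).X) ^ 2

/-- `‖V_k - Π_C V_k‖_C²`. -/
def trackingSq (πC : Fin n → ℝ) (SC : Matrix (Fin n) (Fin n) ℝ) (Y : ℕ → Ω → State n d)
    (k : ℕ) (ω : Ω) : ℝ :=
  weightedNorm SC ((Y k ω).V - act (projC πC) (Y k ω).V) ^ 2

/-- `‖M_k - ∇F(X_k)‖_F²`, where row `i` of `∇F(X)` is `∇f_i(x_i)`. -/
def momentumSq (f : Fin n → EuclideanSpace ℝ (Fin d) → ℝ) (Y : ℕ → Ω → State n d)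
    (k : ℕ) (ω : Ω) : ℝ :=
  frobNorm (fun i => (Y k ω).M i - gradient (f i) ((Y k ω).X i)) ^ 2

/-- The Lyapunov function
`𝒱_k = E[F(z̃_k) - F*] + p₁ ℰ_{x,k} + p₂ ℰ_{v,k} + p₃ ℰ_{m,k} + p₄ ℰ_{M,k}`, where
`F* = inf F` and the errors are the expectations of the quantities above and of `‖m̄_{k-1}‖²`. -/
def lyapunov [MeasurableSpace Ω] (P : Measure Ω) (πR πC : Fin n → ℝ)
    (SR SC : Matrix (Fin n) (Fin n) ℝ) (η lam : ℝ) (p : Fin 4 → ℝ)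
    (f : Fin n → EuclideanSpace ℝ (Fin d) → ℝ) (Y : ℕ → Ω → State n d) (k : ℕ) : ℝ :=
  (∫ ω, (globalLoss f (ztilde πR πC η lam Y k ω) - ⨅ x, globalLoss f x) ∂P)
    + p 0 * (∫ ω, consensusSq πR SR Y k ω ∂P)
    + p 1 * (∫ ω, trackingSq πC SC Y k ω ∂P)
    + p 2 * (∫ ω, momentumSq f Y k ω ∂P)
    + p 3 * (∫ ω, ‖mbarPrev Y k ω‖ ^ 2 ∂P)

end Run

end SMTPP

end

/-! The virtual sequence turns momentum push-pull into a perturbed SGD. Since π_Rᵀ R = π_Rᵀ and 1ᵀ C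
= 1ᵀ, the average x̄ moves by -η c_π m̄_k up to the bias π_Rᵀ(V_k - Π_C V_k). The correction in z̃
is the one for which the exponential averaging cancels: for k ≥ 1, z̃_{k+1} - z̃_k is -η c_π times
the average fresh stochastic gradient, minus η times that bias (`ztilde_succ`). The noise in this
step is orthogonal in L² to ∇F(z̃_k), so the descent lemma sees it only through its variance σ²/n.
What remains are the distance of z̃ from x̄, of order (η/λ)‖m̄‖, the consensus error and the
tracking error (`integral_globalLoss_succ_le`).

The consensus, tracking, momentum and mean-momentum errors contract with factors ρ_R, ρ_C, 1 - λ, 1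
- λ, driven by each other and by noise of order λ²σ²n. The weights let the slack of each contraction
pay for what its error costs elsewhere. The remaining couplings are small in t = η/λ, so a threshold
on t suffices, and one real inequality closes the recursion (`lyapunov_step`). Telescoping gives the
rate. The first iteration leaves the models in place because V_0 = 0, so it yields no descent; its
gradient term equals the next one and is paid by the surplus in the coefficient 3/16 ≥ 2/16. This is
where 16 and T ≥ 2 come from.

On the network side, the common root r gives powers of R and Cᵀ with positive column r. Such a power
contracts zero-sum vectors in ℓ¹ (`sum_abs_vecMul_le`), whence uniqueness of the stationary vectors
and convergence of powers. Both vectors charge r, so c_π > 0. Summing (B^k)ᵀ B^k for B = A - Q over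
finitely many k gives the contracting norm (`exists_isMixingNorm`). -/

noncomputable section

namespace SMTPP

/-! ### Stochastic matrices with a positive column in some power -/

section Stochastic

variable {n : ℕ} {A B : Matrix (Fin n) (Fin n) ℝ} {r : Fin n}

/-- The self-loop at i lets every walk be prolonged, so walks of different lengths can be brought to
a common length. -/
lemma pow_apply_pos_of_le (hA : A ∈ Matrix.rowStochastic ℝ (Fin n)) (hd : ∀ i, 0 < A i i)
    {i : Fin n} {m N : ℕ} (hmN : m ≤ N) (h : 0 < (A ^ m) i r) : 0 < (A ^ N) i r := by
  induction N, hmN using Nat.le_induction with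
  | base => exact h
  | succ N _ ih =>
    rw [pow_succ', Matrix.mul_apply]
    refine Finset.sum_pos' (fun j _ => mul_nonneg (Matrix.nonneg_of_mem_rowStochastic hA)
      (Matrix.nonneg_of_mem_rowStochastic (pow_mem hA N))) ⟨i, Finset.mem_univ _, mul_pos (hd i) ih⟩

/-- If every vertex can be reached from `r` in the graph of `A`, then some power of `A` has a
positive column `r`. -/
lemma exists_pow_column_pos (hA : A ∈ Matrix.rowStochastic ℝ (Fin n)) (hd : ∀ i, 0 < A i i)
    {T : Fin n → Fin n → Prop} (hT : ∀ u v, T u v → 0 < A v u)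
    (hr : ∀ v, Relation.ReflTransGen T r v) : ∃ N, 0 < N ∧ ∀ i, 0 < (A ^ N) i r := by
  have key : ∀ v, ∃ m, 0 < (A ^ m) v r := by
    intro v
    induction hr v with
    | refl => exact ⟨0, by simp⟩
    | @tail u v _ huv ih =>
      obtain ⟨m, hm⟩ := ih
      refine ⟨m + 1, ?_⟩
      rw [pow_succ', Matrix.mul_apply]
      exact Finset.sum_pos' (fun j _ => mul_nonneg (Matrix.nonneg_of_mem_rowStochastic hA)
        (Matrix.nonneg_of_mem_rowStochastic (pow_mem hA m)))
        ⟨u, Finset.mem_univ _, mul_pos (hT u v huv) hm⟩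
  choose m hm using key
  -- The maximum serves as common exponent; the extra 1 makes it positive.
  exact ⟨Finset.univ.sup m + 1, Nat.succ_pos _, fun i =>
    pow_apply_pos_of_le hA hd (Nat.le_succ_of_le (Finset.le_sup (Finset.mem_univ i))) (hm i)⟩

/-- A stochastic matrix whose column `r` is bounded below by `ε` contracts row vectors of zero sum
in the `ℓ¹` norm. -/
lemma sum_abs_vecMul_le (hB : B ∈ Matrix.rowStochastic ℝ (Fin n)) {ε : ℝ} (hε : ∀ i, ε ≤ B i r)
    {v : Fin n → ℝ} (hv : ∑ i, v i = 0) :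
    ∑ j, |(v ᵥ* B) j| ≤ (1 - ε) * ∑ i, |v i| := by
  -- Doeblin's argument: removing ε from column r leaves a nonnegative matrix with row sums 1 - ε,
  -- and its product with v is unchanged because v has zero sum.
  have hnn : ∀ i j, 0 ≤ B i j - if j = r then ε else 0 := by
    intro i j
    split_ifs with h
    · subst h; linarith [hε i]
    · simpa using Matrix.nonneg_of_mem_rowStochastic hB
  have hrw : ∀ j, (v ᵥ* B) j = ∑ i, v i * (B i j - if j = r then ε else 0) := by
    intro j
    simp only [mul_sub, Finset.sum_sub_distrib, ← Finset.sum_mul, hv, zero_mul, sub_zero]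
    rfl
  calc ∑ j, |(v ᵥ* B) j|
      ≤ ∑ j, ∑ i, |v i| * (B i j - if j = r then ε else 0) := by
        refine Finset.sum_le_sum fun j _ => ?_
        rw [hrw]
        refine (Finset.abs_sum_le_sum_abs _ _).trans (Finset.sum_le_sum fun i _ => ?_)
        rw [abs_mul, abs_of_nonneg (hnn i j)]
    _ = (1 - ε) * ∑ i, |v i| := by
        rw [Finset.sum_comm, Finset.mul_sum]
        refine Finset.sum_congr rfl fun i _ => ?_
        rw [← Finset.mul_sum, Finset.sum_sub_distrib, Matrix.sum_row_of_mem_rowStochastic hB]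
        simp [mul_comm]

lemma sum_vecMul_of_mem_rowStochastic (hB : B ∈ Matrix.rowStochastic ℝ (Fin n)) (v : Fin n → ℝ) :
    ∑ j, (v ᵥ* B) j = ∑ i, v i := by
  simp only [Matrix.vecMul, dotProduct]
  rw [Finset.sum_comm]
  simp [← Finset.mul_sum, Matrix.sum_row_of_mem_rowStochastic hB]

lemma sum_abs_vecMul_pow_le (hB : B ∈ Matrix.rowStochastic ℝ (Fin n)) {ε : ℝ} (hε1 : ε ≤ 1)
    (hε : ∀ i, ε ≤ B i r) {v : Fin n → ℝ} (hv : ∑ i, v i = 0) (k : ℕ) :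
    ∑ j, |(v ᵥ* B ^ k) j| ≤ (1 - ε) ^ k * ∑ i, |v i| := by
  induction k with
  | zero => simp
  | succ k ih =>
    rw [pow_succ, ← Matrix.vecMul_vecMul, pow_succ', mul_assoc]
    refine (sum_abs_vecMul_le hB hε ?_).trans (mul_le_mul_of_nonneg_left ih (by linarith))
    rw [sum_vecMul_of_mem_rowStochastic (pow_mem hB k), hv]

lemma IsStationary.vecMul {π : Fin n → ℝ} (h : IsStationary Aᵀ π) : π ᵥ* A = π := by
  rw [← Matrix.mulVec_transpose]; exact h.fixed

lemma IsStationary.vecMul_pow {π : Fin n → ℝ} (h : IsStationary Aᵀ π) (k : ℕ) :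
    π ᵥ* A ^ k = π := by
  induction k with
  | zero => simp
  | succ k ih => rw [pow_succ, ← Matrix.vecMul_vecMul, ih, h.vecMul]

lemma exists_column_lower_bound (hB : B ∈ Matrix.rowStochastic ℝ (Fin n))
    (h : ∀ i, 0 < B i r) : ∃ ε, 0 < ε ∧ ε ≤ 1 ∧ ∀ i, ε ≤ B i r := by
  have : Nonempty (Fin n) := ⟨r⟩
  obtain ⟨i₀, _, hi₀⟩ := Finset.exists_min_image Finset.univ (fun i => B i r) Finset.univ_nonempty
  exact ⟨B i₀ r, h i₀, Matrix.le_one_of_mem_rowStochastic hB, fun i => hi₀ i (Finset.mem_univ i)⟩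

/-- A - 1 kills the all-ones vector, so it also has a left null vector v. Then |v| ≤ |v| A
entrywise, and both sides have the same sum, so equality holds and |v| can be normalized. -/
lemma exists_isStationary [Nonempty (Fin n)] (hA : A ∈ Matrix.rowStochastic ℝ (Fin n)) :
    ∃ π, IsStationary Aᵀ π := by
  have hdet : (A - 1).det = 0 := by
    rw [← Matrix.exists_mulVec_eq_zero_iff]
    exact ⟨1, one_ne_zero, by
      rw [Matrix.sub_mulVec, Matrix.one_vecMul_of_mem_rowStochastic hA, Matrix.one_mulVec,
        sub_self]⟩
  obtain ⟨v, hv0, hv⟩ := Matrix.exists_vecMul_eq_zero_iff.2 hdet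
  rw [Matrix.vecMul_sub, Matrix.vecMul_one, sub_eq_zero] at hv
  set w : Fin n → ℝ := fun i => |v i| with hw
  have hle : ∀ j, w j ≤ (w ᵥ* A) j := by
    intro j
    have : v j = ∑ i, v i * A i j := (congrFun hv j).symm
    calc w j = |∑ i, v i * A i j| := by rw [hw, ← this]
      _ ≤ ∑ i, |v i * A i j| := Finset.abs_sum_le_sum_abs _ _
      _ = (w ᵥ* A) j := Finset.sum_congr rfl fun i _ => by
        rw [abs_mul, abs_of_nonneg (Matrix.nonneg_of_mem_rowStochastic hA)]
  have heq : ∀ j, w j = (w ᵥ* A) j := by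
    have := (Finset.sum_eq_sum_iff_of_le (s := Finset.univ) fun j _ => hle j).1
      (sum_vecMul_of_mem_rowStochastic hA w).symm
    exact fun j => this j (Finset.mem_univ j)
  have hpos : 0 < ∑ i, w i := by
    obtain ⟨i, hi⟩ := Function.ne_iff.1 hv0
    exact Finset.sum_pos' (fun i _ => abs_nonneg _) ⟨i, Finset.mem_univ _, abs_pos.2 hi⟩
  refine ⟨(∑ i, w i)⁻¹ • w, ?_, ?_, ?_⟩
  · intro i; exact mul_nonneg (inv_nonneg.2 hpos.le) (abs_nonneg _)
  · simp only [Pi.smul_apply, smul_eq_mul, ← Finset.mul_sum]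
    exact inv_mul_cancel₀ hpos.ne'
  · rw [Matrix.mulVec_transpose, Matrix.smul_vecMul, ← funext heq]

/-- The difference has zero sum; A^N fixes it and yet shrinks its ℓ¹ norm by the factor 1 - ε. -/
lemma IsStationary.unique {N : ℕ} (hA : A ∈ Matrix.rowStochastic ℝ (Fin n))
    (hN : ∀ i, 0 < (A ^ N) i r) {π π' : Fin n → ℝ}
    (h : IsStationary Aᵀ π) (h' : IsStationary Aᵀ π') : π = π' := by
  obtain ⟨ε, hε0, -, hε⟩ := exists_column_lower_bound (pow_mem hA N) hN
  have hsum : ∑ i, (π - π') i = 0 := by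
    simp [Finset.sum_sub_distrib, h.sum_eq_one, h'.sum_eq_one]
  have := sum_abs_vecMul_le (pow_mem hA N) hε hsum
  rw [Matrix.sub_vecMul, h.vecMul_pow, h'.vecMul_pow] at this
  have hnn : 0 ≤ ∑ i, |(π - π') i| := Finset.sum_nonneg fun i _ => abs_nonneg _
  have hz : ∑ i, |(π - π') i| = 0 :=
    le_antisymm (by nlinarith) hnn
  funext i
  have := (Finset.sum_eq_zero_iff_of_nonneg fun i _ => abs_nonneg _).1 hz i (Finset.mem_univ i)
  exact sub_eq_zero.1 (abs_eq_zero.1 this)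

lemma IsStationary.apply_root_pos {N : ℕ} (hA : A ∈ Matrix.rowStochastic ℝ (Fin n))
    (hN : ∀ i, 0 < (A ^ N) i r) {π : Fin n → ℝ} (h : IsStationary Aᵀ π) : 0 < π r := by
  obtain ⟨ε, hε0, -, hε⟩ := exists_column_lower_bound (pow_mem hA N) hN
  calc 0 < ε := hε0
    _ = ∑ i, π i * ε := by rw [← Finset.sum_mul, h.sum_eq_one, one_mul]
    _ ≤ ∑ i, π i * (A ^ N) i r :=
        Finset.sum_le_sum fun i _ => mul_le_mul_of_nonneg_left (hε i) (h.nonneg i)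
    _ = π r := congrFun (h.vecMul_pow N) r

/-- Geometric ergodicity: powers of `A` come arbitrarily close to `1 πᵀ`. -/
lemma exists_pow_sub_projR_le {N : ℕ} (hN0 : 0 < N) (hA : A ∈ Matrix.rowStochastic ℝ (Fin n))
    (hN : ∀ i, 0 < (A ^ N) i r) {π : Fin n → ℝ} (h : IsStationary Aᵀ π) {τ : ℝ} (hτ : 0 < τ) :
    ∃ m, ∀ i j, |(A ^ (m + 1) - projR π) i j| ≤ τ := by
  obtain ⟨ε, hε0, hε1, hε⟩ := exists_column_lower_bound (pow_mem hA N) hN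
  obtain ⟨k, hk⟩ := exists_pow_lt_of_lt_one (show 0 < τ / 2 by positivity)
    (show 1 - ε < 1 by linarith)
  refine ⟨N * (k + 1) - 1, fun i j => ?_⟩
  rw [Nat.sub_add_cancel (Nat.mul_pos hN0 k.succ_pos)]
  -- Since π is fixed by powers of A, row i of A^m - 1πᵀ is the zero-sum vector e_i - π multiplied
  -- by A^m.
  set v : Fin n → ℝ := Pi.single i 1 - π with hv
  have hv0 : ∑ l, v l = 0 := by simp [hv, Finset.sum_sub_distrib, h.sum_eq_one]
  have hv2 : ∑ l, |v l| ≤ 2 := by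
    calc ∑ l, |v l| ≤ ∑ l, (|(Pi.single i 1 : Fin n → ℝ) l| + |π l|) :=
          Finset.sum_le_sum fun l _ => abs_sub _ _
      _ = 2 := by
        rw [Finset.sum_add_distrib, Finset.sum_congr rfl fun l _ => abs_of_nonneg (h.nonneg l),
          h.sum_eq_one, Finset.sum_eq_single i (by simp +contextual) (by simp)]
        simp; norm_num
  have hrow : (A ^ (N * (k + 1)) - projR π) i j = (v ᵥ* (A ^ N) ^ (k + 1)) j := by
    rw [hv, Matrix.sub_vecMul, ← pow_mul, h.vecMul_pow, Matrix.single_one_vecMul]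
    simp [projR]
  rw [hrow]
  calc |(v ᵥ* (A ^ N) ^ (k + 1)) j| ≤ ∑ j, |(v ᵥ* (A ^ N) ^ (k + 1)) j| :=
        Finset.single_le_sum (f := fun j => |(v ᵥ* (A ^ N) ^ (k + 1)) j|) (fun j _ => abs_nonneg _)
          (Finset.mem_univ j)
    _ ≤ (1 - ε) ^ (k + 1) * ∑ l, |v l| :=
        sum_abs_vecMul_pow_le (pow_mem hA N) hε1 hε hv0 (k + 1)
    _ ≤ (1 - ε) ^ k * 2 := mul_le_mul
        (pow_le_pow_of_le_one (by linarith) (by linarith) k.le_succ) hv2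
        (Finset.sum_nonneg fun _ _ => abs_nonneg _) (pow_nonneg (by linarith) k)
    _ ≤ τ := by linarith

end Stochastic

/-! ### Products with `n × d` matrices and the Frobenius norm -/

section Rows

variable {n d : ℕ} (A B : Matrix (Fin n) (Fin n) ℝ) (X Z : Rows n d)

lemma act_apply (i : Fin n) : act A X i = ∑ j, A i j • X j := rfl

lemma act_add : act A (X + Z) = act A X + act A Z := by
  funext i; simp [act, smul_add, Finset.sum_add_distrib]

lemma act_sub : act A (X - Z) = act A X - act A Z := by
  funext i; simp [act, smul_sub, Finset.sum_sub_distrib]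

lemma act_smul (c : ℝ) : act A (c • X) = c • act A X := by
  funext i; simp [act, Finset.smul_sum, smul_comm c]

lemma sub_act : act (A - B) X = act A X - act B X := by
  funext i; simp [act, sub_smul, Finset.sum_sub_distrib]

lemma mul_act : act (A * B) X = act A (act B X) := by
  funext i
  simp only [act, Matrix.mul_apply, Finset.sum_smul, Finset.smul_sum, mul_smul]
  exact Finset.sum_comm

@[simp] lemma one_act : act 1 X = X := by
  funext i; simp [act, Matrix.one_apply]

lemma frobNorm_nonneg : 0 ≤ frobNorm X := Real.sqrt_nonneg _

lemma frobNorm_sq : frobNorm X ^ 2 = ∑ i, ‖X i‖ ^ 2 :=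
  Real.sq_sqrt (Finset.sum_nonneg fun _ _ => sq_nonneg _)

lemma frobNorm_eq_norm :
    frobNorm X = ‖(WithLp.toLp 2 X : PiLp 2 fun _ => EuclideanSpace ℝ (Fin d))‖ := by
  rw [PiLp.norm_eq_of_L2]; rfl

lemma frobNorm_add_le : frobNorm (X + Z) ≤ frobNorm X + frobNorm Z := by
  simp only [frobNorm_eq_norm, WithLp.toLp_add]
  exact norm_add_le _ _

lemma frobNorm_smul (c : ℝ) : frobNorm (c • X) = |c| * frobNorm X := by
  simp only [frobNorm_eq_norm, WithLp.toLp_smul, norm_smul, Real.norm_eq_abs]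

lemma weightedNorm_nonneg : 0 ≤ weightedNorm A X := frobNorm_nonneg _

lemma weightedNorm_add_le : weightedNorm A (X + Z) ≤ weightedNorm A X + weightedNorm A Z := by
  simp only [weightedNorm, act_add]
  exact frobNorm_add_le _ _

lemma weightedNorm_smul (c : ℝ) : weightedNorm A (c • X) = |c| * weightedNorm A X := by
  simp only [weightedNorm, act_smul, frobNorm_smul]

lemma norm_sum_smul_sq_le {ι E : Type*} [NormedAddCommGroup E] [NormedSpace ℝ E] (s : Finset ι)
    (a : ι → ℝ) (x : ι → E) :
    ‖∑ j ∈ s, a j • x j‖ ^ 2 ≤ (∑ j ∈ s, a j ^ 2) * ∑ j ∈ s, ‖x j‖ ^ 2 := by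
  calc ‖∑ j ∈ s, a j • x j‖ ^ 2 ≤ (∑ j ∈ s, |a j| * ‖x j‖) ^ 2 := by
        gcongr
        refine (norm_sum_le _ _).trans_eq (Finset.sum_congr rfl fun j _ => ?_)
        rw [norm_smul, Real.norm_eq_abs]
    _ ≤ (∑ j ∈ s, |a j| ^ 2) * ∑ j ∈ s, ‖x j‖ ^ 2 := Finset.sum_mul_sq_le_sq_mul_sq _ _ _
    _ = _ := by simp only [sq_abs]

/-- The squared Frobenius norm of a square matrix. -/
def sumSq : ℝ := ∑ i, ∑ j, A i j ^ 2

lemma sumSq_nonneg : 0 ≤ sumSq A :=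
  Finset.sum_nonneg fun _ _ => Finset.sum_nonneg fun _ _ => sq_nonneg _

lemma frobNorm_act_sq_le : frobNorm (act A X) ^ 2 ≤ sumSq A * frobNorm X ^ 2 := by
  rw [frobNorm_sq, frobNorm_sq, sumSq, Finset.sum_mul]
  exact Finset.sum_le_sum fun i _ => norm_sum_smul_sq_le _ _ _

/-- The norm depends on A only through AᵀA. This lets a weighted norm be prescribed by the positive
definite matrix SᵀS. -/
lemma frobNorm_act_sq_eq :
    frobNorm (act A X) ^ 2 = ∑ j, ∑ l, (Aᵀ * A) j l * inner ℝ (X j) (X l) := by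
  simp only [frobNorm_sq, act_apply, ← real_inner_self_eq_norm_sq, sum_inner, inner_sum,
    real_inner_smul_left, real_inner_smul_right, Matrix.mul_apply, Matrix.transpose_apply,
    Finset.sum_mul]
  rw [Finset.sum_comm]
  refine Finset.sum_congr rfl fun j _ => ?_
  rw [Finset.sum_comm]
  exact Finset.sum_congr rfl fun l _ => Finset.sum_congr rfl fun i _ => by
    rw [real_inner_comm]; ring

/-- The spectral norm bounds the action on the Frobenius norm. -/
lemma frobNorm_act_sq_le_opNorm :
    frobNorm (act A X) ^ 2
      ≤ ‖Matrix.toEuclideanCLM (n := Fin n) (𝕜 := ℝ) A‖ ^ 2 * frobNorm X ^ 2 := by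
  set T := Matrix.toEuclideanCLM (n := Fin n) (𝕜 := ℝ) A with hT
  -- The squared Frobenius norm splits over columns, and A acts on each column separately.
  have hcol : ∀ Z : Rows n d, frobNorm Z ^ 2
      = ∑ c, ‖(WithLp.toLp 2 fun i => Z i c : EuclideanSpace ℝ (Fin n))‖ ^ 2 := by
    intro Z
    simp only [frobNorm_sq, EuclideanSpace.norm_sq_eq]
    exact Finset.sum_comm
  rw [hcol, hcol, Finset.mul_sum]
  refine Finset.sum_le_sum fun c _ => ?_
  have : (WithLp.toLp 2 fun i => act A X i c : EuclideanSpace ℝ (Fin n))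
      = T (WithLp.toLp 2 fun i => X i c) := by
    ext i
    simp [hT, act, Matrix.mulVec, dotProduct]
  rw [this, ← mul_pow]
  gcongr
  exact T.le_opNorm _

lemma frobNorm_sub_projC_sq_le (πC : Fin n → ℝ) :
    frobNorm (X - act (projC πC) X) ^ 2 ≤ cProj πC * frobNorm X ^ 2 := by
  have := frobNorm_act_sq_le_opNorm (1 - projC πC) X
  rwa [sub_act, one_act] at this

end Rows

/-! ### Existence of mixing norms -/

section Mixing

variable {n : ℕ} {A Q : Matrix (Fin n) (Fin n) ℝ}

lemma sub_pow_succ_of_absorbing (hAQ : A * Q = Q) (hQA : Q * A = Q) (hQ : Q * Q = Q) (k : ℕ) :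
    (A - Q) ^ (k + 1) = A ^ (k + 1) - Q := by
  induction k with
  | zero => simp
  | succ k ih =>
    have hk : ∀ m : ℕ, A ^ m * Q = Q := by
      intro m
      induction m with
      | zero => simp
      | succ m ih => rw [pow_succ, mul_assoc, hAQ, ih]
    rw [pow_succ, ih, sub_mul, mul_sub, mul_sub, hk, hQA, hQ, ← pow_succ]
    simp

-- The term k = 0 is the identity, so the sum is positive definite and factors through an invertible
-- S.
open scoped MatrixOrder in
lemma exists_transpose_mul_self_eq_sum (B : Matrix (Fin n) (Fin n) ℝ) (m : ℕ) :
    ∃ S : Matrix (Fin n) (Fin n) ℝ, IsUnit S ∧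
      Sᵀ * S = ∑ k ∈ Finset.range (m + 1), (B ^ k)ᵀ * B ^ k := by
  have hpd : (∑ k ∈ Finset.range (m + 1), (B ^ k)ᵀ * B ^ k).PosDef := by
    rw [Finset.sum_range_succ']
    refine Matrix.PosDef.posSemidef_add ?_ (by simpa using Matrix.PosDef.one)
    refine Matrix.posSemidef_sum _ fun k _ => ?_
    simpa using Matrix.posSemidef_conjTranspose_mul_self (B ^ (k + 1))
  obtain ⟨S, hS⟩ := CStarAlgebra.nonneg_iff_eq_star_mul_self.1 hpd.posSemidef.nonneg
  rw [Matrix.star_eq_conjTranspose, Matrix.conjTranspose_eq_transpose_of_trivial] at hS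
  refine ⟨S, ?_, hS.symm⟩
  have hu := hpd.isUnit
  rw [hS] at hu
  exact isUnit_of_mul_isUnit_right hu

/-- With B = A - Q and SᵀS = ∑_{k≤m} (B^k)ᵀ B^k, the squared norm is ∑_{k≤m} ‖B^k X‖². Applying B
shifts this sum: it loses ‖X‖² and gains ‖B^{m+1} X‖² ≤ ‖X‖²/4. The net loss of ¾‖X‖² is a fixed
fraction of the norm because the norm is equivalent to the Frobenius norm. One S serves all d. -/
lemma exists_isMixingNorm (hAQ : A * Q = Q) (hQA : Q * A = Q) (hQ : Q * Q = Q)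
    (hlim : ∀ τ : ℝ, 0 < τ → ∃ m, ∀ i j, |(A ^ (m + 1) - Q) i j| ≤ τ) :
    ∃ S ρ δ, IsMixingNorm A Q S ρ δ := by
  set B := A - Q with hB
  have hBQ : B * Q = 0 := by rw [hB, sub_mul, hAQ, hQ, sub_self]
  have hQQ : ∀ {d : ℕ} (X : Rows n d), act B (X - act Q X) = act A X - act Q X := by
    intro d X
    rw [act_sub, ← mul_act, hBQ, hB, sub_act]
    funext i; simp [act]
  -- Entries of size at most 1/(2(n+1)) give a squared Frobenius norm at most n²/(4(n+1)²) ≤ 1/4.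
  obtain ⟨m, hm⟩ : ∃ m, sumSq (B ^ (m + 1)) ≤ 1 / 4 := by
    obtain ⟨m, hm⟩ := hlim (1 / (2 * (n + 1))) (by positivity)
    refine ⟨m, ?_⟩
    rw [sub_pow_succ_of_absorbing hAQ hQA hQ]
    calc sumSq (A ^ (m + 1) - Q) ≤ ∑ _i : Fin n, ∑ _j : Fin n, (1 / (2 * (n + 1) : ℝ)) ^ 2 :=
          Finset.sum_le_sum fun i _ => Finset.sum_le_sum fun j _ =>
            sq_le_sq.2 ((hm i j).trans (le_abs_self _))
      _ = (n / (n + 1) : ℝ) ^ 2 / 4 := by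
          simp only [Finset.sum_const, Finset.card_univ, Fintype.card_fin, nsmul_eq_mul]
          field_simp; norm_num
      _ ≤ 1 / 4 := by
          have : (n / (n + 1) : ℝ) ≤ 1 := by rw [div_le_one (by positivity)]; linarith
          have : (n / (n + 1) : ℝ) ^ 2 ≤ 1 := pow_le_one₀ (by positivity) this
          linarith
  obtain ⟨S, hSu, hS⟩ := exists_transpose_mul_self_eq_sum B m
  have hnorm : ∀ {d : ℕ} (X : Rows n d), weightedNorm S X ^ 2
      = ∑ k ∈ Finset.range (m + 1), frobNorm (act (B ^ k) X) ^ 2 := by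
    intro d X
    simp only [weightedNorm, frobNorm_act_sq_eq, hS, Matrix.sum_apply, Finset.sum_mul]
    symm
    rw [Finset.sum_comm]
    exact Finset.sum_congr rfl fun l _ => Finset.sum_comm
  set δ2 : ℝ := 1 + ∑ k ∈ Finset.range (m + 1), sumSq (B ^ k) with hδ2
  have hδ1 : 1 ≤ δ2 := by
    have : 0 ≤ ∑ k ∈ Finset.range (m + 1), sumSq (B ^ k) :=
      Finset.sum_nonneg fun k _ => sumSq_nonneg _
    linarith
  have hup : ∀ {d : ℕ} (X : Rows n d), weightedNorm S X ^ 2 ≤ δ2 * frobNorm X ^ 2 := by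
    intro d X
    rw [hnorm, hδ2, add_mul, one_mul, Finset.sum_mul]
    exact (Finset.sum_le_sum fun k _ => frobNorm_act_sq_le _ _).trans
      (le_add_of_nonneg_left (sq_nonneg _))
  -- The two sums share the terms k = 1, …, m; only the end terms differ.
  have hstep : ∀ {d : ℕ} (X : Rows n d), weightedNorm S (act B X) ^ 2
      = weightedNorm S X ^ 2 - frobNorm X ^ 2 + frobNorm (act (B ^ (m + 1)) X) ^ 2 := by
    intro d X
    rw [hnorm, hnorm, Finset.sum_range_succ' (fun k => frobNorm (act (B ^ k) X) ^ 2),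
      Finset.sum_range_succ]
    simp only [← mul_act, ← pow_succ, pow_zero, one_act]
    ring
  have hρ : 0 < 1 - 3 / (4 * δ2) := by
    rw [sub_pos, div_lt_one (by linarith)]; linarith
  refine ⟨S, √(1 - 3 / (4 * δ2)), √δ2, hSu, Real.sqrt_pos.2 hρ, ?_, Real.one_le_sqrt.2 hδ1,
    ?_, ?_, ?_⟩
  · rw [Real.sqrt_lt' one_pos]
    have : 0 < 3 / (4 * δ2) := by positivity
    linarith
  · intro d X
    refine le_of_sq_le_sq ?_ (weightedNorm_nonneg _ _)
    rw [hnorm, Finset.sum_range_succ']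
    simp only [pow_zero, one_act]
    exact le_add_of_nonneg_left (Finset.sum_nonneg fun _ _ => sq_nonneg _)
  · intro d X
    refine le_of_sq_le_sq ?_ (mul_nonneg (Real.sqrt_nonneg _) (frobNorm_nonneg _))
    rw [mul_pow, Real.sq_sqrt (by linarith)]
    exact hup X
  · intro d X
    refine le_of_sq_le_sq ?_ (mul_nonneg (Real.sqrt_nonneg _) (weightedNorm_nonneg _ _))
    rw [mul_pow, Real.sq_sqrt hρ.le, ← hQQ, hstep]
    set W := X - act Q X
    have h1 : frobNorm (act (B ^ (m + 1)) W) ^ 2 ≤ 1 / 4 * frobNorm W ^ 2 :=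
      (frobNorm_act_sq_le _ _).trans (by gcongr)
    have h2 : 3 / (4 * δ2) * weightedNorm S W ^ 2 ≤ 3 / 4 * frobNorm W ^ 2 := by
      calc 3 / (4 * δ2) * weightedNorm S W ^ 2 ≤ 3 / (4 * δ2) * (δ2 * frobNorm W ^ 2) := by
            gcongr; exact hup W
        _ = 3 / 4 * frobNorm W ^ 2 := by field_simp
    linarith

lemma projC_eq_transpose (π : Fin n → ℝ) : projC π = (projR π)ᵀ := by
  ext i j; simp [projC, projR, Matrix.vecMulVec_apply]

lemma mul_projR (hA : A ∈ Matrix.rowStochastic ℝ (Fin n)) (π : Fin n → ℝ) :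
    A * projR π = projR π := by
  rw [projR, Matrix.mul_vecMulVec, Matrix.one_vecMul_of_mem_rowStochastic hA]

lemma IsStationary.projR_mul {π : Fin n → ℝ} (h : IsStationary Aᵀ π) :
    projR π * A = projR π := by
  rw [projR, Matrix.vecMulVec_mul, h.vecMul]

lemma projR_mul_projR {π : Fin n → ℝ} (h : ∑ i, π i = 1) : projR π * projR π = projR π := by
  rw [projR, Matrix.vecMulVec_mul_vecMulVec]
  simp [dotProduct, h]

lemma exists_isMixingNorm_rowStochastic {N : ℕ} {r : Fin n} (hN0 : 0 < N)
    (hA : A ∈ Matrix.rowStochastic ℝ (Fin n)) (hN : ∀ i, 0 < (A ^ N) i r) {π : Fin n → ℝ}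
    (h : IsStationary Aᵀ π) : ∃ S ρ δ, IsMixingNorm A (projR π) S ρ δ :=
  exists_isMixingNorm (mul_projR hA π) h.projR_mul (projR_mul_projR h.sum_eq_one)
    fun _ hτ => exists_pow_sub_projR_le hN0 hA hN h hτ

lemma exists_isMixingNorm_colStochastic {N : ℕ} {r : Fin n} (hN0 : 0 < N)
    (hA : Aᵀ ∈ Matrix.rowStochastic ℝ (Fin n)) (hN : ∀ i, 0 < (Aᵀ ^ N) i r) {π : Fin n → ℝ}
    (h : IsStationary A π) : ∃ S ρ δ, IsMixingNorm A (projC π) S ρ δ := by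
  have h' : IsStationary Aᵀᵀ π := by rwa [Matrix.transpose_transpose]
  have tr : ∀ M M' : Matrix (Fin n) (Fin n) ℝ, Mᵀ * M'ᵀ = (M' * M)ᵀ := fun M M' =>
    (Matrix.transpose_mul M' M).symm
  refine exists_isMixingNorm ?_ ?_ ?_ fun τ hτ => ?_
  · rw [projC_eq_transpose, ← Matrix.transpose_transpose A, tr, h'.projR_mul]
  · rw [projC_eq_transpose, ← Matrix.transpose_transpose A, tr, mul_projR hA]
  · rw [projC_eq_transpose, tr, projR_mul_projR h.sum_eq_one]
  · obtain ⟨m, hm⟩ := exists_pow_sub_projR_le hN0 hA hN h' hτ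
    refine ⟨m, fun i j => ?_⟩
    have := hm j i
    rwa [← Matrix.transpose_pow, projC_eq_transpose,
      ← Matrix.transpose_transpose (projR π), ← Matrix.transpose_sub] at *

/-- An edge u → v of the tree makes entry (v, u) of R positive; for Cᵀ the same holds with the tree
of the reversed graph, so both matrices get the same positive column. -/
lemma IsPushPullNetwork.exists_root {GR GC : Digraph (Fin n)} {R C : Matrix (Fin n) (Fin n) ℝ}
    (h : IsPushPullNetwork GR GC R C) : ∃ (r : Fin n) (N N' : ℕ), 0 < N ∧ 0 < N' ∧
      (∀ i, 0 < (R ^ N) i r) ∧ ∀ i, 0 < (Cᵀ ^ N') i r := by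
  obtain ⟨r, TR, TC, hTR, hTC⟩ := h.common_root
  obtain ⟨N, hN0, hN⟩ := exists_pow_column_pos h.row_stochastic h.R_diag_pos
    (fun u v huv => (h.R_pos_iff v u).2 (Or.inl (hTR.le huv))) hTR.reach
  obtain ⟨N', hN0', hN'⟩ := exists_pow_column_pos
    (Matrix.transpose_mem_rowStochastic_iff_mem_colStochastic.2 h.col_stochastic)
    (A := Cᵀ) h.C_diag_pos (fun u v huv => (h.C_pos_iff u v).2 (Or.inl (hTC.le huv))) hTC.reach
  exact ⟨r, N, N', hN0, hN0', hN, hN'⟩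

end Mixing

/-- Spectral properties of a push-pull network. -/
theorem IsPushPullNetwork.stationary_and_mixing {n : ℕ} {GR GC : Digraph (Fin n)}
    {R C : Matrix (Fin n) (Fin n) ℝ} (h : IsPushPullNetwork GR GC R C) :
    (∃! πR : Fin n → ℝ, IsStationary Rᵀ πR) ∧ (∃! πC : Fin n → ℝ, IsStationary C πC) ∧
    ∀ πR πC : Fin n → ℝ, IsStationary Rᵀ πR → IsStationary C πC →
      0 < cPi πR πC ∧ (∃ SR ρR δR, IsMixingNorm R (projR πR) SR ρR δR) ∧
      ∃ SC ρC δC, IsMixingNorm C (projC πC) SC ρC δC := by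
  obtain ⟨r, N, N', hN0, hN0', hN, hN'⟩ := h.exists_root
  have : Nonempty (Fin n) := ⟨r⟩
  have hR := h.row_stochastic
  have hC : Cᵀ ∈ Matrix.rowStochastic ℝ (Fin n) :=
    Matrix.transpose_mem_rowStochastic_iff_mem_colStochastic.2 h.col_stochastic
  have hCC : ∀ π, IsStationary C π → IsStationary Cᵀᵀ π := fun π hπ => by
    rwa [Matrix.transpose_transpose]
  obtain ⟨π, hπ⟩ := exists_isStationary hR
  obtain ⟨π', hπ'⟩ := exists_isStationary hC
  refine ⟨⟨π, hπ, fun y hy => IsStationary.unique hR hN hy hπ⟩,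
    ⟨π', by rwa [Matrix.transpose_transpose] at hπ',
      fun y hy => IsStationary.unique hC hN' (hCC y hy) hπ'⟩, fun πR πC hπR hπC => ⟨?_, ?_, ?_⟩⟩
  -- Both stationary vectors are positive at the common root.
  · have hpos : 0 < πR ⬝ᵥ πC := Finset.sum_pos'
      (fun i _ => mul_nonneg (hπR.nonneg i) (hπC.nonneg i))
      ⟨r, Finset.mem_univ r, mul_pos (hπR.apply_root_pos hR hN)
        ((hCC _ hπC).apply_root_pos hC hN')⟩
    exact mul_pos (Nat.cast_pos.2 r.pos) hpos
  · exact exists_isMixingNorm_rowStochastic hN0 hR hN hπR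
  · exact exists_isMixingNorm_colStochastic hN0' hC hN' hπC

/-! ### Smooth functions -/

section Smooth

variable {d : ℕ} {f : EuclideanSpace ℝ (Fin d) → ℝ} {L : ℝ}

/-- The descent lemma for functions with Lipschitz gradient. -/
lemma le_add_inner_gradient_add_sq (hf : Differentiable ℝ f)
    (hL : ∀ x y, ‖gradient f x - gradient f y‖ ≤ L * ‖x - y‖) (x y : EuclideanSpace ℝ (Fin d)) :
    f y ≤ f x + inner ℝ (gradient f x) (y - x) + L / 2 * ‖y - x‖ ^ 2 := by
  -- The gap between f and its quadratic upper model along the segment from x to y; its derivative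
  -- is nonpositive by the Lipschitz bound.
  set φ : ℝ → ℝ := fun t => f (x + t • (y - x)) - t * inner ℝ (gradient f x) (y - x)
    - L / 2 * t ^ 2 * ‖y - x‖ ^ 2 with hφ
  have hd : ∀ t, HasDerivAt φ (inner ℝ (gradient f (x + t • (y - x)) - gradient f x) (y - x)
      - L * t * ‖y - x‖ ^ 2) t := by
    intro t
    have h1 : HasDerivAt (fun t : ℝ => x + t • (y - x)) (y - x) t := by
      simpa using ((hasDerivAt_id t).smul_const (y - x)).const_add x
    have h2 := (hf (x + t • (y - x))).hasFDerivAt.comp_hasDerivAt t h1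
    rw [← inner_gradient_left] at h2
    have h3 := (hasDerivAt_id t).mul_const (inner ℝ (gradient f x) (y - x))
    have h4 := (((hasDerivAt_id t).pow 2).const_mul (L / 2)).mul_const (‖y - x‖ ^ 2)
    refine ((h2.sub h3).sub h4).congr_deriv ?_
    simp only [inner_sub_left, id, Nat.cast_ofNat, Nat.add_one_sub_one, pow_one]
    ring
  have hanti : AntitoneOn φ (Set.Icc 0 1) := by
    refine antitoneOn_of_deriv_nonpos (convex_Icc 0 1)
      (fun t _ => (hd t).continuousAt.continuousWithinAt)
      (fun t _ => (hd t).differentiableAt.differentiableWithinAt) fun t ht => ?_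
    rw [interior_Icc] at ht
    rw [(hd t).deriv, sub_nonpos]
    calc inner ℝ (gradient f (x + t • (y - x)) - gradient f x) (y - x)
        ≤ ‖gradient f (x + t • (y - x)) - gradient f x‖ * ‖y - x‖ := real_inner_le_norm _ _
      _ ≤ L * ‖x + t • (y - x) - x‖ * ‖y - x‖ := by gcongr; exact hL _ _
      _ = L * t * ‖y - x‖ ^ 2 := by
        rw [add_sub_cancel_left, norm_smul, Real.norm_of_nonneg ht.1.le]; ring
  have := hanti (Set.left_mem_Icc.2 zero_le_one) (Set.right_mem_Icc.2 zero_le_one) zero_le_one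
  simp only [hφ, one_smul, zero_smul, add_sub_cancel, add_zero] at this
  linarith

/-- A function with Lipschitz gradient grows at most quadratically. -/
lemma abs_le_of_lipschitz_gradient (hf : Differentiable ℝ f) (hL0 : 0 ≤ L)
    (hL : ∀ x y, ‖gradient f x - gradient f y‖ ≤ L * ‖x - y‖) (x : EuclideanSpace ℝ (Fin d)) :
    |f x| ≤ |f 0| + ‖gradient f 0‖ ^ 2 + (1 + 2 * L + L ^ 2) * ‖x‖ ^ 2 := by
  -- The descent lemma from 0 to x bounds f x above; the one from x to 0 bounds it below.
  have h1 := le_add_inner_gradient_add_sq hf hL 0 x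
  have h2 := le_add_inner_gradient_add_sq hf hL x 0
  have h3 := abs_le.1 (abs_real_inner_le_norm (gradient f 0) (x - 0))
  have h4 := abs_le.1 (abs_real_inner_le_norm (gradient f x) (0 - x))
  have h5 := hL x 0
  have h6 : ‖gradient f x‖ ≤ ‖gradient f 0‖ + ‖gradient f x - gradient f 0‖ := by
    simpa using norm_add_le (gradient f 0) (gradient f x - gradient f 0)
  simp only [sub_zero, zero_sub, norm_neg] at *
  have hx := norm_nonneg x
  have hg := norm_nonneg (gradient f 0)
  have h7 : ‖gradient f x‖ * ‖x‖ ≤ (‖gradient f 0‖ + L * ‖x‖) * ‖x‖ := by gcongr; linarith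
  have h8 := neg_abs_le (f 0)
  have h9 := le_abs_self (f 0)
  rw [abs_le]
  constructor <;> nlinarith [sq_nonneg (‖gradient f 0‖ - ‖x‖), sq_nonneg (L * ‖x‖),
    mul_nonneg hL0 (sq_nonneg ‖x‖)]

variable {n : ℕ} {f : Fin n → EuclideanSpace ℝ (Fin d) → ℝ}

lemma differentiable_globalLoss (hf : ∀ i, Differentiable ℝ (f i)) :
    Differentiable ℝ (globalLoss f) := by
  unfold globalLoss
  fun_prop

lemma gradient_globalLoss (hf : ∀ i, Differentiable ℝ (f i)) (x : EuclideanSpace ℝ (Fin d)) :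
    gradient (globalLoss f) x = (1 / (n : ℝ)) • ∑ i, gradient (f i) x := by
  refine ext_inner_right ℝ fun y => ?_
  have h : HasFDerivAt (globalLoss f) ((1 / (n : ℝ)) • ∑ i, fderiv ℝ (f i) x) x :=
    (HasFDerivAt.fun_sum fun i _ => (hf i x).hasFDerivAt).const_mul _
  rw [inner_gradient_left, h.fderiv, real_inner_smul_left, sum_inner]
  simp [inner_gradient_left]

lemma norm_avg_sq_le (u : Fin n → EuclideanSpace ℝ (Fin d)) :
    ‖(1 / (n : ℝ)) • ∑ i, u i‖ ^ 2 ≤ (1 / (n : ℝ)) * ∑ i, ‖u i‖ ^ 2 := by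
  rcases Nat.eq_zero_or_pos n with rfl | hn
  · simp
  have hn' : (0 : ℝ) < n := Nat.cast_pos.2 hn
  rw [Finset.smul_sum]
  refine (norm_sum_smul_sq_le _ _ _).trans_eq ?_
  simp only [Finset.sum_const, Finset.card_univ, Fintype.card_fin, nsmul_eq_mul]
  field_simp

lemma lipschitz_gradient_globalLoss (hn : 0 < n) (hf : ∀ i, Differentiable ℝ (f i))
    (hL : ∀ i x y, ‖gradient (f i) x - gradient (f i) y‖ ≤ L * ‖x - y‖)
    (x y : EuclideanSpace ℝ (Fin d)) :
    ‖gradient (globalLoss f) x - gradient (globalLoss f) y‖ ≤ L * ‖x - y‖ := by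
  have hn' : (0 : ℝ) < n := Nat.cast_pos.2 hn
  rw [gradient_globalLoss hf, gradient_globalLoss hf, ← smul_sub, ← Finset.sum_sub_distrib,
    norm_smul, Real.norm_of_nonneg (by positivity)]
  calc 1 / (n : ℝ) * ‖∑ i, (gradient (f i) x - gradient (f i) y)‖
      ≤ 1 / (n : ℝ) * ∑ _i : Fin n, L * ‖x - y‖ := by
        gcongr
        exact (norm_sum_le _ _).trans (Finset.sum_le_sum fun i _ => hL i x y)
    _ = L * ‖x - y‖ := by
        simp only [Finset.sum_const, Finset.card_univ, Fintype.card_fin, nsmul_eq_mul]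
        field_simp

lemma continuous_of_lipschitz_norm {E F : Type*} [NormedAddCommGroup E] [NormedAddCommGroup F]
    {G : E → F} (hL : ∀ x y, ‖G x - G y‖ ≤ L * ‖x - y‖) : Continuous G := by
  refine (LipschitzWith.of_dist_le_mul (K := L.toNNReal) fun x y => ?_).continuous
  rw [dist_eq_norm, dist_eq_norm]
  exact (hL x y).trans (mul_le_mul_of_nonneg_right (Real.le_coe_toNNReal L) (norm_nonneg _))

end Smooth

/-! ### The Lyapunov recursion for real numbers -/

section Weights

/-- `δ_C² c_Π / (1 - ρ_C)`, the gain from momentum increments to the tracking error. -/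
def trackGain (ρC δC cP : ℝ) : ℝ := δC ^ 2 * cP / (1 - ρC)

/-- The weight of the tracking error, divided by `η`. -/
def trackWeight (ρC c : ℝ) : ℝ := 4 / (c * (1 - ρC))

/-- The weight of the momentum error, divided by `η`. -/
def momWeight (ρC δC c cP : ℝ) : ℝ := 2 * trackWeight ρC c * trackGain ρC δC cP + 1

/-- The constant of the error floor. -/
def floorConst (L ρC δC c cP : ℝ) : ℝ :=
  16 * (2 * L ^ 2 * c ^ 2 + L * c
    + (trackWeight ρC c * trackGain ρC δC cP + momWeight ρC δC c cP) / c + 1 / 2)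

/-- One step of the Lyapunov recursion, with `η = t λ`. -/
lemma lyapunov_step {L ρR ρC c b α β γ a A t lam N s F F' x x' v v' m m' q q' h D gx : ℝ}
    (hL : 0 ≤ L) (hρC : ρC < 1) (hc : 0 < c) (hb : 0 ≤ b)
    (ha : 0 ≤ a) (hA : 0 ≤ A) (ht : 0 < t) (ht1 : t ≤ 1) (hl : 0 < lam) (hl1 : lam < 1)
    (hN : 1 ≤ N) (hs : 0 ≤ s) (hα : α = 4 / (c * (1 - ρC))) (hβ : β = 2 * α * b + 1)
    (hγ : γ = L ^ 2 * (2 * α * b + β))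
    (hx : 0 ≤ x) (hv : 0 ≤ v) (hm : 0 ≤ m) (hq : 0 ≤ q) (hh : 0 ≤ h) (hD : 0 ≤ D)
    (k1 : t * (γ * A + c * L ^ 2) ≤ 1 - ρR)
    (k2 : t * (a + L + γ * A) ≤ 2 / c)
    (k3 : t * (2 * a + 2 * (γ * A) + 2 * L ^ 2 * c ^ 3 + L * c ^ 2) ≤ c / 2)
    (I1 : x' ≤ ρR * x + a * (t * lam) ^ 2 * (v + q'))
    (I2 : v' ≤ ρC * v + b * (lam ^ 2 * (N * s) + 2 * lam ^ 2 * L ^ 2 * D + 2 * lam ^ 2 * m))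
    (I3 : m' ≤ (1 - lam) * m + L ^ 2 / lam * D + lam ^ 2 * (N * s))
    (I4 : D ≤ A * (x + (t * lam) ^ 2 * v + (t * lam) ^ 2 * q'))
    (I5 : q' ≤ (1 - lam) * q + lam * h + lam ^ 2 * (s / N))
    (I6 : F' ≤ F - 3 / 16 * (t * lam * c) * gx + 2 * L ^ 2 * t ^ 3 * lam * c ^ 3 * q
      + t * lam * c * L ^ 2 * x - t * lam * c * h / 2 + (2 * (t * lam) / c + L * (t * lam) ^ 2) * v
      + L * (t * lam) ^ 2 * c ^ 2 * (h + s / N)) :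
    F' + x' + α * (t * lam) * v' + β * (t * lam) * m'
        + (a * t ^ 2 * lam + γ * A * t ^ 3 * lam + 2 * L ^ 2 * c ^ 3 * t ^ 3) * q'
      ≤ F + x + α * (t * lam) * v + β * (t * lam) * m
        + (a * t ^ 2 * lam + γ * A * t ^ 3 * lam + 2 * L ^ 2 * c ^ 3 * t ^ 3) * q
        - 3 / 16 * (t * lam * c) * gx
        + t * lam * c * (2 * L ^ 2 * c ^ 2 + L * c + (α * b + β) / c + 1 / 2)
          * (t * lam * s / N + lam ^ 2 * s * N) := by
  -- Here x, v, m, q are the consensus, tracking, momentum and mean-momentum errors, primed one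
  -- iteration later; D is the squared increment of the models, h and gx are the squared averaged
  -- local gradient and the squared ∇F(x̄), N = n and s = σ². Below, the total coefficient of each
  -- quantity is compared with the weight available for it.
  have hρ : 0 < 1 - ρC := by linarith
  have hα0 : 0 < α := by rw [hα]; positivity
  have hαc : α * (1 - ρC) = 4 / c := by rw [hα]; field_simp
  have hβ0 : 0 < β := by rw [hβ]; positivity
  have hγ0 : 0 ≤ γ := by rw [hγ]; positivity
  obtain ⟨g, hg⟩ : ∃ g, g = γ * A := ⟨_, rfl⟩
  have hg0 : 0 ≤ g := by rw [hg]; positivity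
  have hN0 : 0 < N := by linarith
  have hl2 : lam ^ 2 ≤ 1 := pow_le_one₀ hl.le hl1.le
  have hl3 : lam ^ 3 ≤ 1 := pow_le_one₀ hl.le hl1.le
  rw [← hg] at k1 k2 k3 ⊢
  -- the increments of the model
  have e1 : (α * (t * lam) * (b * (2 * lam ^ 2 * L ^ 2)) + β * (t * lam) * (L ^ 2 / lam)) * D
      ≤ t * g * (x + (t * lam) ^ 2 * v + (t * lam) ^ 2 * q') := by
    have h1 : α * (t * lam) * (b * (2 * lam ^ 2 * L ^ 2)) + β * (t * lam) * (L ^ 2 / lam)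
        = t * L ^ 2 * (2 * α * b * lam ^ 3 + β) := by field_simp
    have h2 : t * L ^ 2 * (2 * α * b * lam ^ 3 + β) ≤ t * γ := by
      rw [hγ, mul_assoc]
      have : 2 * α * b * lam ^ 3 ≤ 2 * α * b := mul_le_of_le_one_right (by positivity) hl3
      gcongr
    calc _ ≤ t * γ * D := by rw [h1]; exact mul_le_mul_of_nonneg_right h2 hD
      _ ≤ t * γ * (A * (x + (t * lam) ^ 2 * v + (t * lam) ^ 2 * q')) := by gcongr
      _ = _ := by rw [hg]; ring
  -- W collects all of q': its own weight p₄, its share in the consensus error and its share in the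
  -- model increments. It must be nonnegative before I5 can be inserted.
  obtain ⟨W, hW⟩ : ∃ W, W = (a * t ^ 2 * lam + g * t ^ 3 * lam + 2 * L ^ 2 * c ^ 3 * t ^ 3)
      + a * (t * lam) ^ 2 + t * g * (t * lam) ^ 2 := ⟨_, rfl⟩
  have hW0 : 0 ≤ W := by rw [hW]; positivity
  have hWq : W * q' ≤ W * ((1 - lam) * q + lam * h + lam ^ 2 * (s / N)) := by gcongr
  have c1 : (ρR + t * g + t * lam * c * L ^ 2) * x ≤ x := by
    have : t * (c * L ^ 2) * lam ≤ t * (c * L ^ 2) :=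
      mul_le_of_le_one_right (by positivity) hl1.le
    have : ρR + t * g + t * lam * c * L ^ 2 ≤ 1 := by linarith
    exact mul_le_of_le_one_left hx this
  -- The choice of α makes the slack of the contraction equal to 4η/c. Half pays for the 2η/c of the
  -- descent inequality, the other half for the small terms in k2.
  have c2 : (a * (t * lam) ^ 2 + α * (t * lam) * ρC + t * g * (t * lam) ^ 2 + 2 * (t * lam) / c
      + L * (t * lam) ^ 2) * v ≤ α * (t * lam) * v := by
    refine mul_le_mul_of_nonneg_right ?_ hv
    have h1 : α * (t * lam) - α * (t * lam) * ρC = (t * lam) * (4 / c) := by rw [← hαc]; ring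
    have h2 : a * (t * lam) ^ 2 + t * g * (t * lam) ^ 2 + L * (t * lam) ^ 2
        ≤ (t * lam) * (t * (a + L + g)) := by
      have h3 : (t * lam) * (t * (a + L + g)) - (a * (t * lam) ^ 2 + t * g * (t * lam) ^ 2
        + L * (t * lam) ^ 2) = t ^ 2 * lam * ((a + L) * (1 - lam) + g * (1 - t * lam)) := by ring
      have h4 : 0 ≤ t ^ 2 * lam * ((a + L) * (1 - lam) + g * (1 - t * lam)) := by
        have : t * lam ≤ 1 := mul_le_one₀ ht1 hl.le hl1.le
        have : 0 ≤ 1 - t * lam := by linarith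
        have : 0 ≤ 1 - lam := by linarith
        positivity
      linarith
    have h5 : (t * lam) * (t * (a + L + g)) ≤ (t * lam) * (2 / c) := by gcongr
    have h6 : (t * lam) * (4 / c) = (t * lam) * (2 / c) + 2 * (t * lam) / c := by ring
    linarith
  -- The summand 2αb of β pays for the momentum error inside the tracking recursion.
  have c3 : (α * (t * lam) * (b * (2 * lam ^ 2)) + β * (t * lam) * (1 - lam)) * m
      ≤ β * (t * lam) * m := by
    refine mul_le_mul_of_nonneg_right ?_ hm
    have h1 : β * (t * lam) - (α * (t * lam) * (b * (2 * lam ^ 2)) + β * (t * lam) * (1 - lam))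
        = t * lam ^ 2 * (2 * α * b * (1 - lam) + 1) := by rw [hβ]; ring
    have h2 : 0 ≤ t * lam ^ 2 * (2 * α * b * (1 - lam) + 1) := by
      have : 0 ≤ 1 - lam := by linarith
      positivity
    linarith
  -- Each summand of p₄ is 1/λ times one cost of the mean momentum: aη², t g η² and 2ηcL²(tc)². As q
  -- contracts by 1 - λ, the slack λp₄ recovers these costs.
  have c4 : (W * (1 - lam) + 2 * L ^ 2 * t ^ 3 * lam * c ^ 3) * q
      ≤ (a * t ^ 2 * lam + g * t ^ 3 * lam + 2 * L ^ 2 * c ^ 3 * t ^ 3) * q := by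
    refine mul_le_mul_of_nonneg_right ?_ hq
    have h1 : (a * t ^ 2 * lam + g * t ^ 3 * lam + 2 * L ^ 2 * c ^ 3 * t ^ 3)
        - (W * (1 - lam) + 2 * L ^ 2 * t ^ 3 * lam * c ^ 3)
        = a * t ^ 2 * lam ^ 3 + g * t ^ 3 * lam ^ 3 := by rw [hW]; ring
    have h2 : 0 ≤ a * t ^ 2 * lam ^ 3 + g * t ^ 3 * lam ^ 3 := by positivity
    linarith
  have hWt : W ≤ t * (t * (2 * a + 2 * g + 2 * L ^ 2 * c ^ 3)) := by
    have h1 : t * (t * (2 * a + 2 * g + 2 * L ^ 2 * c ^ 3)) - W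
        = t ^ 2 * (a * ((1 - lam) + (1 - lam ^ 2)) + g * ((1 - t * lam) + (1 - t * lam ^ 2))
          + 2 * L ^ 2 * c ^ 3 * (1 - t)) := by rw [hW]; ring
    have h3 : 0 ≤ 1 - t * lam := by linarith [mul_le_one₀ ht1 hl.le hl1.le]
    have h4 : 0 ≤ 1 - t * lam ^ 2 := by linarith [mul_le_one₀ ht1 (sq_nonneg lam) hl2]
    have h5 : 0 ≤ 1 - lam := by linarith
    have h6 : 0 ≤ 1 - lam ^ 2 := by linarith
    have h7 : 0 ≤ 1 - t := by linarith
    have h2 : 0 ≤ t ^ 2 * (a * ((1 - lam) + (1 - lam ^ 2))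
        + g * ((1 - t * lam) + (1 - t * lam ^ 2)) + 2 * L ^ 2 * c ^ 3 * (1 - t)) := by positivity
    linarith
  -- The averaged gradient h that feeds the momentum is paid by the term -ηc h/2 of the descent
  -- inequality.
  have c5 : (W * lam + L * (t * lam) ^ 2 * c ^ 2) * h ≤ t * lam * c / 2 * h := by
    refine mul_le_mul_of_nonneg_right ?_ hh
    have h1 : W * lam ≤ t * (t * (2 * a + 2 * g + 2 * L ^ 2 * c ^ 3)) * lam := by gcongr
    have h2 : t * lam * (t * (L * c ^ 2)) * lam ≤ t * lam * (t * (L * c ^ 2)) :=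
      mul_le_of_le_one_right (by positivity) hl1.le
    have h3 := mul_le_mul_of_nonneg_left k3 (mul_nonneg ht.le hl.le)
    linarith
  -- The noise: 2L²c² comes from the third summand of p₄, Lc from the smoothness term, (αb + β)/c
  -- from the tracking and momentum errors, and 1/2 from the rest of W, bounded through k3 and s/N ≤
  -- sN.
  have c6 : α * (t * lam) * (b * (lam ^ 2 * (N * s))) + β * (t * lam) * (lam ^ 2 * (N * s))
      + W * (lam ^ 2 * (s / N)) + L * (t * lam) ^ 2 * c ^ 2 * (s / N)
      ≤ t * lam * c * (2 * L ^ 2 * c ^ 2 + L * c + (α * b + β) / c + 1 / 2)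
          * (t * lam * s / N + lam ^ 2 * s * N) := by
    obtain ⟨u, hu⟩ : ∃ u, u = s / N := ⟨_, rfl⟩
    have hu0 : 0 ≤ u := by rw [hu]; positivity
    have huN : u ≤ s * N := by
      rw [hu]
      exact (div_le_self hs hN).trans (le_mul_of_one_le_right hs hN)
    have h1 : W * lam ^ 2 ≤ lam ^ 3 * t * (c / 2) + 2 * L ^ 2 * c ^ 3 * (t * lam) ^ 2 := by
      have h2 : W * lam ^ 2 = lam ^ 3 * t * (t * (a * (1 + lam) + g * (t * (1 + lam))))
          + 2 * L ^ 2 * c ^ 3 * (t * lam) ^ 2 * t := by rw [hW]; ring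
      have h3 : t * (a * (1 + lam) + g * (t * (1 + lam))) ≤ c / 2 := by
        refine le_trans (mul_le_mul_of_nonneg_left ?_ ht.le) k3
        have h4 : a * (1 + lam) ≤ a * 2 := by gcongr; linarith
        have h5 : t * (1 + lam) ≤ 1 * 2 := by gcongr; linarith
        have h6 : g * (t * (1 + lam)) ≤ g * (1 * 2) := by gcongr
        have h7 : 0 ≤ 2 * L ^ 2 * c ^ 3 + L * c ^ 2 := by positivity
        linarith
      have h8 : 2 * L ^ 2 * c ^ 3 * (t * lam) ^ 2 * t ≤ 2 * L ^ 2 * c ^ 3 * (t * lam) ^ 2 :=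
        mul_le_of_le_one_right (by positivity) ht1
      rw [h2]
      gcongr
    have h2 := mul_le_mul_of_nonneg_right h1 hu0
    have h3 : lam ^ 3 * t * (c / 2) * u ≤ lam ^ 3 * t * (c / 2) * (s * N) := by gcongr
    have hsN : t * lam * s / N = t * lam * u := by rw [hu]; ring
    rw [← hu, hsN]
    obtain ⟨κ, hκ⟩ : ∃ κ, κ = (α * b + β) / c := ⟨_, rfl⟩
    have hκ0 : 0 ≤ κ := by rw [hκ]; positivity
    have hκc : α * b + β = κ * c := by rw [hκ]; field_simp
    rw [← hκ]
    have h4 : α * (t * lam) * (b * (lam ^ 2 * (N * s))) + β * (t * lam) * (lam ^ 2 * (N * s))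
        = κ * c * (t * lam) * (lam ^ 2 * (N * s)) := by rw [← hκc]; ring
    have h5 : 0 ≤ t * lam * c * (κ + 1 / 2) * (t * lam * u)
        + t * lam * c * (2 * L ^ 2 * c ^ 2 + L * c) * (lam ^ 2 * s * N) := by positivity
    linarith
  have hp2 : α * (t * lam) * v' ≤ α * (t * lam) * (ρC * v + b * (lam ^ 2 * (N * s)
      + 2 * lam ^ 2 * L ^ 2 * D + 2 * lam ^ 2 * m)) := by gcongr
  have hp3 : β * (t * lam) * m' ≤ β * (t * lam) * ((1 - lam) * m + L ^ 2 / lam * D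
      + lam ^ 2 * (N * s)) := by gcongr
  rw [hW] at hWq c4 c5 c6
  linarith

end Weights

/-- The space `ℝ^d`. -/
abbrev Vec (d : ℕ) : Type := EuclideanSpace ℝ (Fin d)

/-! ### Square-integrable vectors and unbiased noise -/

section Noise

variable {Ω : Type*} {mΩ : MeasurableSpace Ω} {P : Measure Ω} {d : ℕ}

lemma integrable_norm_sq {U : Ω → Vec d} (hU : MemLp U 2 P) : Integrable (fun ω => ‖U ω‖ ^ 2) P :=
  (memLp_two_iff_integrable_sq_norm hU.1).1 hU

lemma integrable_inner_of_memLp {U W : Ω → Vec d} (hU : MemLp U 2 P) (hW : MemLp W 2 P) :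
    Integrable (fun ω => inner ℝ (U ω) (W ω)) P := by
  refine Integrable.mono' ((integrable_norm_sq hU).add (integrable_norm_sq hW))
    (hU.1.inner hW.1) (Filter.Eventually.of_forall fun ω => ?_)
  rw [Real.norm_eq_abs]
  refine (abs_real_inner_le_norm _ _).trans ?_
  simp only [Pi.add_apply]
  nlinarith [sq_nonneg (‖U ω‖ - ‖W ω‖), sq_nonneg (‖U ω‖), sq_nonneg (‖W ω‖)]

/-- If `U` and `W` are orthogonal in `L²`, then `E‖U + c W‖² = E‖U‖² + c² E‖W‖²`. -/
lemma integral_norm_add_smul_sq {U W : Ω → Vec d} (hU : MemLp U 2 P) (hW : MemLp W 2 P)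
    (h0 : ∫ ω, inner ℝ (U ω) (W ω) ∂P = 0) (c : ℝ) :
    ∫ ω, ‖U ω + c • W ω‖ ^ 2 ∂P = ∫ ω, ‖U ω‖ ^ 2 ∂P + c ^ 2 * ∫ ω, ‖W ω‖ ^ 2 ∂P := by
  have hrw : ∀ ω, ‖U ω + c • W ω‖ ^ 2
      = ‖U ω‖ ^ 2 + 2 * c * inner ℝ (U ω) (W ω) + c ^ 2 * ‖W ω‖ ^ 2 := by
    intro ω
    rw [norm_add_sq_real, real_inner_smul_right, norm_smul, mul_pow, Real.norm_eq_abs, sq_abs]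
    ring
  have h1 := integrable_norm_sq hU
  have h2 := (integrable_inner_of_memLp hU hW).const_mul (2 * c)
  have h12 : Integrable (fun ω => ‖U ω‖ ^ 2 + 2 * c * inner ℝ (U ω) (W ω)) P := h1.add h2
  have h3 := (integrable_norm_sq hW).const_mul (c ^ 2)
  simp only [hrw]
  rw [integral_add h12 h3, integral_add h1 h2, integral_const_mul, integral_const_mul, h0]
  ring

variable {Ξ : Type*} [MeasurableSpace Ξ] {D : Measure Ξ} {σ L : ℝ}
  {f : Vec d → ℝ} {g : Vec d → Ξ → Vec d}

lemma IsSmoothLoss.continuous_gradient (hf : IsSmoothLoss L f) : Continuous (gradient f) :=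
  continuous_of_lipschitz_norm hf.lipschitz_gradient

lemma IsGradientOracle.measurable_noise (hg : IsGradientOracle D σ f g) (hf : IsSmoothLoss L f) :
    Measurable fun z : Vec d × Ξ => g z.1 z.2 - gradient f z.1 :=
  hg.measurable.sub (hf.continuous_gradient.measurable.comp measurable_fst)

/-- Independence makes the joint law of the point and the sample a product, so the variance bound
may be applied at a frozen point. Working with the Lebesgue integral first yields integrability
along with the bound. -/
lemma IsGradientOracle.memLp_noise_and_variance_le [IsProbabilityMeasure P]
    (hg : IsGradientOracle D σ f g) (hf : IsSmoothLoss L f) {X : Ω → Vec d} {s : Ω → Ξ}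
    (hX : Measurable X) (hs : Measurable s) (hlaw : P.map s = D) (hind : IndepFun X s P) :
    MemLp (fun ω => g (X ω) (s ω) - gradient f (X ω)) 2 P ∧
      ∫ ω, ‖g (X ω) (s ω) - gradient f (X ω)‖ ^ 2 ∂P ≤ σ ^ 2 := by
  have : IsProbabilityMeasure D := hlaw ▸ Measure.isProbabilityMeasure_map hs.aemeasurable
  have : IsProbabilityMeasure (P.map X) := Measure.isProbabilityMeasure_map hX.aemeasurable
  have hmeas := hg.measurable_noise hf
  have hXs : Measurable fun ω => (X ω, s ω) := hX.prodMk hs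
  have hN : Measurable fun ω => g (X ω) (s ω) - gradient f (X ω) := hmeas.comp hXs
  have hmap : P.map (fun ω => (X ω, s ω)) = (P.map X).prod D := by
    rw [← hlaw]
    exact (indepFun_iff_map_prod_eq_prod_map_map hX.aemeasurable hs.aemeasurable).1 hind
  have hsq : Measurable fun z : Vec d × Ξ => ENNReal.ofReal (‖g z.1 z.2 - gradient f z.1‖ ^ 2) :=
    (hmeas.norm.pow_const 2).ennreal_ofReal
  have hbound : ∫⁻ ω, ENNReal.ofReal (‖g (X ω) (s ω) - gradient f (X ω)‖ ^ 2) ∂P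
      ≤ ENNReal.ofReal (σ ^ 2) := by
    calc ∫⁻ ω, ENNReal.ofReal (‖g (X ω) (s ω) - gradient f (X ω)‖ ^ 2) ∂P
        = ∫⁻ z, ENNReal.ofReal (‖g z.1 z.2 - gradient f z.1‖ ^ 2)
            ∂P.map (fun ω => (X ω, s ω)) := (lintegral_map hsq hXs).symm
      _ = ∫⁻ x, ∫⁻ t, ENNReal.ofReal (‖g x t - gradient f x‖ ^ 2) ∂D ∂P.map X := by
          rw [hmap, lintegral_prod _ hsq.aemeasurable]
      _ ≤ ∫⁻ _x, ENNReal.ofReal (σ ^ 2) ∂P.map X := by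
          refine lintegral_mono fun x => ?_
          have hi : MemLp (fun t => g x t - gradient f x) 2 D := (hg.memLp x).sub (memLp_const _)
          rw [← ofReal_integral_eq_lintegral_ofReal (integrable_norm_sq hi)
            (Filter.Eventually.of_forall fun _ => sq_nonneg _)]
          exact ENNReal.ofReal_le_ofReal (hg.variance_le x)
      _ = ENNReal.ofReal (σ ^ 2) := by simp
  have hint : Integrable (fun ω => ‖g (X ω) (s ω) - gradient f (X ω)‖ ^ 2) P := by
    refine ⟨(hN.norm.pow_const 2).aestronglyMeasurable, ?_⟩
    rw [hasFiniteIntegral_iff_ofReal (Filter.Eventually.of_forall fun _ => sq_nonneg _)]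
    exact hbound.trans_lt ENNReal.ofReal_lt_top
  refine ⟨(memLp_two_iff_integrable_sq_norm hN.aestronglyMeasurable).2 hint, ?_⟩
  rw [← ofReal_integral_eq_lintegral_ofReal hint
    (Filter.Eventually.of_forall fun _ => sq_nonneg _)] at hbound
  exact (ENNReal.ofReal_le_ofReal_iff (sq_nonneg σ)).1 hbound

/-- With (U, X) frozen by Fubini, unbiasedness annihilates the inner integral. This takes the place
of a conditional expectation. -/
lemma IsGradientOracle.integral_inner_noise [IsProbabilityMeasure P]
    (hg : IsGradientOracle D σ f g) (hf : IsSmoothLoss L f) {U X : Ω → Vec d} {s : Ω → Ξ}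
    (hUm : Measurable U) (hX : Measurable X) (hs : Measurable s) (hlaw : P.map s = D)
    (hind : IndepFun (fun ω => (U ω, X ω)) s P) (hU : MemLp U 2 P) :
    ∫ ω, inner ℝ (U ω) (g (X ω) (s ω) - gradient f (X ω)) ∂P = 0 := by
  have : IsProbabilityMeasure D := hlaw ▸ Measure.isProbabilityMeasure_map hs.aemeasurable
  have hUX : Measurable fun ω => (U ω, X ω) := hUm.prodMk hX
  have : IsProbabilityMeasure (P.map fun ω => (U ω, X ω)) :=
    Measure.isProbabilityMeasure_map hUX.aemeasurable
  have hindX : IndepFun X s P := hind.comp measurable_snd measurable_id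
  have hN := (hg.memLp_noise_and_variance_le hf hX hs hlaw hindX).1
  have hUXs : Measurable fun ω => ((U ω, X ω), s ω) := hUX.prodMk hs
  have hmap : P.map (fun ω => ((U ω, X ω), s ω)) = (P.map fun ω => (U ω, X ω)).prod D := by
    rw [← hlaw]
    exact (indepFun_iff_map_prod_eq_prod_map_map hUX.aemeasurable hs.aemeasurable).1 hind
  set Φ : (Vec d × Vec d) × Ξ → ℝ := fun z => inner ℝ z.1.1 (g z.1.2 z.2 - gradient f z.1.2) with hΦ
  have hΦm : Measurable Φ := by
    have h1 : Measurable fun z : (Vec d × Vec d) × Ξ => g z.1.2 z.2 - gradient f z.1.2 :=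
      (hg.measurable_noise hf).comp
        ((measurable_snd.comp measurable_fst).prodMk measurable_snd)
    exact (measurable_fst.comp measurable_fst).inner h1
  have hint : Integrable Φ ((P.map fun ω => (U ω, X ω)).prod D) := by
    rw [← hmap, integrable_map_measure hΦm.aestronglyMeasurable hUXs.aemeasurable]
    exact integrable_inner_of_memLp hU hN
  calc ∫ ω, inner ℝ (U ω) (g (X ω) (s ω) - gradient f (X ω)) ∂P
      = ∫ z, Φ z ∂P.map (fun ω => ((U ω, X ω), s ω)) :=
        (integral_map hUXs.aemeasurable hΦm.aestronglyMeasurable).symm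
    _ = ∫ y, ∫ t, Φ (y, t) ∂D ∂P.map (fun ω => (U ω, X ω)) := by
        rw [hmap, integral_prod _ hint]
    _ = ∫ _y, 0 ∂P.map (fun ω => (U ω, X ω)) := by
        congr 1
        funext y
        have hi : Integrable (fun t => g y.2 t) D := (hg.memLp y.2).integrable (by norm_num)
        have hi' : Integrable (fun t => g y.2 t - gradient f y.2) D :=
          hi.sub (integrable_const _)
        simp only [hΦ]
        rw [integral_inner hi', integral_sub hi (integrable_const _),
          hg.unbiased]
        simp
    _ = 0 := by simp

end Noise

/-! ### The information of the samples -/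

section Information

variable {n : ℕ} {Ω : Type*} {Ξ : Fin n → Type*} [∀ i, MeasurableSpace (Ξ i)]

/-- The information of all the samples but `ξ i k`. -/
@[reducible] def others (ξ : ∀ i, ℕ → Ω → Ξ i) (i : Fin n) (k : ℕ) : MeasurableSpace Ω :=
  ⨆ q ∈ ({(i, k)}ᶜ : Set (Fin n × ℕ)), MeasurableSpace.comap (ξ q.1 q.2) inferInstance

/-- The information of the samples before iteration `k`. -/
@[reducible] def before (ξ : ∀ i, ℕ → Ω → Ξ i) (k : ℕ) : MeasurableSpace Ω :=
  ⨆ q ∈ {q : Fin n × ℕ | q.2 < k}, MeasurableSpace.comap (ξ q.1 q.2) inferInstance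

variable {ξ : ∀ i, ℕ → Ω → Ξ i}

lemma before_le_others (i : Fin n) (k : ℕ) : before ξ k ≤ others ξ i k :=
  biSup_mono fun q (hq : q.2 < k) (h : q = (i, k)) => by simp [h] at hq

lemma before_mono {k l : ℕ} (hkl : k ≤ l) : before ξ k ≤ before ξ l :=
  biSup_mono fun _ hq => lt_of_lt_of_le hq hkl

lemma measurable_others {i j : Fin n} {k t : ℕ} (h : (j, t) ≠ (i, k)) :
    Measurable[others ξ i k] (ξ j t) :=
  measurable_iff_comap_le.2 (le_iSup₂_of_le (j, t) h le_rfl)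

lemma measurable_before {j : Fin n} {k t : ℕ} (h : t < k) : Measurable[before ξ k] (ξ j t) :=
  measurable_iff_comap_le.2 (le_iSup₂_of_le (j, t) h le_rfl)

variable {mΩ : MeasurableSpace Ω} {P : Measure Ω} {D : ∀ i, Measure (Ξ i)}

lemma IsSampling.others_le (hS : IsSampling P D ξ) (i : Fin n) (k : ℕ) : others ξ i k ≤ mΩ :=
  iSup₂_le fun q _ => (hS.measurable q.1 q.2).comap_le

lemma IsSampling.before_le (hS : IsSampling P D ξ) (k : ℕ) : before ξ k ≤ mΩ :=
  iSup₂_le fun q _ => (hS.measurable q.1 q.2).comap_le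

lemma IsSampling.indepFun_of_measurable_others (hS : IsSampling P D ξ) {i : Fin n} {k : ℕ}
    {γ : Type*} [MeasurableSpace γ] {Z : Ω → γ} (hZ : Measurable[others ξ i k] Z) :
    IndepFun Z (ξ i k) P := by
  have h := indep_iSup_of_disjoint (fun q : Fin n × ℕ => (hS.measurable q.1 q.2).comap_le)
    ((iIndepFun_iff_iIndep _ _ _).1 hS.indep) (S := {(i, k)}ᶜ) (T := {(i, k)})
    disjoint_compl_left
  rw [IndepFun_iff_Indep]
  refine indep_of_indep_of_le_left (indep_of_indep_of_le_right h ?_) hZ.comap_le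
  exact le_iSup₂_of_le (i, k) rfl le_rfl

end Information

/-! ### Runs of the algorithm -/

section Act

variable {n d : ℕ} {Ω : Type*}

lemma measurable_fun_smul {m : MeasurableSpace Ω} {U : Ω → Vec d} (hU : Measurable U) (c : ℝ) :
    Measurable fun ω => c • U ω := hU.const_smul c

lemma memLp_fun_smul {m : MeasurableSpace Ω} {P : Measure Ω} {U : Ω → Vec d} (hU : MemLp U 2 P)
    (c : ℝ) : MemLp (fun ω => c • U ω) 2 P := hU.const_smul c

lemma memLp_fun_add {m : MeasurableSpace Ω} {P : Measure Ω} {U W : Ω → Vec d} (hU : MemLp U 2 P)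
    (hW : MemLp W 2 P) : MemLp (fun ω => U ω + W ω) 2 P := hU.add hW

lemma memLp_fun_sub {m : MeasurableSpace Ω} {P : Measure Ω} {U W : Ω → Vec d} (hU : MemLp U 2 P)
    (hW : MemLp W 2 P) : MemLp (fun ω => U ω - W ω) 2 P := hU.sub hW

lemma measurable_act {m : MeasurableSpace Ω} (A : Matrix (Fin n) (Fin n) ℝ) {Z : Ω → Rows n d}
    (hZ : ∀ i, Measurable fun ω => Z ω i) (i : Fin n) : Measurable fun ω => act A (Z ω) i := by
  simp only [act_apply]
  exact Finset.measurable_fun_sum _ fun j _ => measurable_fun_smul (hZ j) _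

lemma memLp_act {m : MeasurableSpace Ω} {P : Measure Ω} (A : Matrix (Fin n) (Fin n) ℝ)
    {Z : Ω → Rows n d} (hZ : ∀ i, MemLp (fun ω => Z ω i) 2 P) (i : Fin n) :
    MemLp (fun ω => act A (Z ω) i) 2 P := by
  simp only [act_apply]
  exact memLp_finsetSum _ fun j _ => memLp_fun_smul (hZ j) _

lemma integrable_frobNorm_sq {m : MeasurableSpace Ω} {P : Measure Ω} {Z : Ω → Rows n d}
    (hZ : ∀ i, MemLp (fun ω => Z ω i) 2 P) : Integrable (fun ω => frobNorm (Z ω) ^ 2) P := by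
  simp only [frobNorm_sq]
  exact integrable_finsetSum _ fun i _ => integrable_norm_sq (hZ i)

lemma IsSmoothLoss.memLp_gradient {m : MeasurableSpace Ω} {P : Measure Ω} [IsProbabilityMeasure P]
    {L : ℝ} {f : Vec d → ℝ} (hf : IsSmoothLoss L f) {U : Ω → Vec d} (hU : MemLp U 2 P) :
    MemLp (fun ω => gradient f (U ω)) 2 P := by
  have h : MemLp (fun ω => gradient f (U ω) - gradient f 0) 2 P := by
    refine hU.of_le_mul (c := L) ?_ (Filter.Eventually.of_forall fun ω => ?_)
    · exact (hf.continuous_gradient.comp_aestronglyMeasurable hU.1).sub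
        aestronglyMeasurable_const
    · simpa using hf.lipschitz_gradient (U ω) 0
  simpa using memLp_fun_add h (memLp_const (gradient f 0))

end Act

/-- `Y` is a run of the algorithm, under the assumptions on the losses, the stochastic gradients and
the samples. -/
structure IsRun {n d : ℕ} {Ω : Type*} [MeasurableSpace Ω] (P : Measure Ω) {Ξ : Fin n → Type*}
    [∀ i, MeasurableSpace (Ξ i)] (R C : Matrix (Fin n) (Fin n) ℝ) (η lam L σ : ℝ)
    (D : ∀ i, Measure (Ξ i)) (f : Fin n → Vec d → ℝ) (g : ∀ i, Vec d → Ξ i → Vec d)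
    (ξ : ∀ i, ℕ → Ω → Ξ i) (x₀ : Vec d) (Y : ℕ → Ω → State n d) : Prop where
  loss : ∀ i, IsSmoothLoss L (f i)
  oracle : ∀ i, IsGradientOracle (D i) σ (f i) (g i)
  sampling : IsSampling P D ξ
  run : ∀ k ω, Y k ω = iter R C η lam g x₀ (fun i t => ξ i t ω) k

/-- The noise `g_i(x_{i,k}; ξ_{i,k}) - ∇f_i(x_{i,k})`. -/
def noise {n d : ℕ} {Ω : Type*} {Ξ : Fin n → Type*} (f : Fin n → Vec d → ℝ)
    (g : ∀ i, Vec d → Ξ i → Vec d) (ξ : ∀ i, ℕ → Ω → Ξ i) (Y : ℕ → Ω → State n d) (i : Fin n)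
    (k : ℕ) (ω : Ω) : Vec d :=
  g i ((Y k ω).X i) (ξ i k ω) - gradient (f i) ((Y k ω).X i)

/-- The average `(1/n) ∑ ∇f_i(x_{i,k})` of the local gradients. -/
def hbar {n d : ℕ} {Ω : Type*} (f : Fin n → Vec d → ℝ) (Y : ℕ → Ω → State n d) (k : ℕ) (ω : Ω) :
    Vec d := (1 / (n : ℝ)) • ∑ i, gradient (f i) ((Y k ω).X i)

namespace IsRun

variable {n d : ℕ} {Ω : Type*} [MeasurableSpace Ω] {P : Measure Ω}
  {Ξ : Fin n → Type*} [∀ i, MeasurableSpace (Ξ i)] {R C : Matrix (Fin n) (Fin n) ℝ}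
  {η lam L σ : ℝ} {D : ∀ i, Measure (Ξ i)} {f : Fin n → Vec d → ℝ}
  {g : ∀ i, Vec d → Ξ i → Vec d} {ξ : ∀ i, ℕ → Ω → Ξ i} {x₀ : Vec d} {Y : ℕ → Ω → State n d}

lemma X_zero (h : IsRun P R C η lam L σ D f g ξ x₀ Y) (ω : Ω) : (Y 0 ω).X = fun _ => x₀ := by
  rw [h.run]; rfl

lemma V_zero (h : IsRun P R C η lam L σ D f g ξ x₀ Y) (ω : Ω) : (Y 0 ω).V = 0 := by
  rw [h.run]; rfl

lemma M_zero (h : IsRun P R C η lam L σ D f g ξ x₀ Y) (ω : Ω) : (Y 0 ω).M = 0 := by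
  rw [h.run]; rfl

lemma X_succ (h : IsRun P R C η lam L σ D f g ξ x₀ Y) (k : ℕ) (ω : Ω) :
    (Y (k + 1) ω).X = act R ((Y k ω).X - η • (Y k ω).V) := by
  rw [h.run, h.run]; rfl

lemma V_succ (h : IsRun P R C η lam L σ D f g ξ x₀ Y) (k : ℕ) (ω : Ω) :
    (Y (k + 1) ω).V = act C (Y k ω).V + ((Y (k + 1) ω).M - (Y k ω).M) := by
  rw [h.run, h.run]; rfl

lemma M_succ (h : IsRun P R C η lam L σ D f g ξ x₀ Y) (k : ℕ) (ω : Ω) (i : Fin n) :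
    (Y (k + 1) ω).M i = (1 - lam) • (Y k ω).M i
      + lam • (gradient (f i) ((Y (k + 1) ω).X i) + noise f g ξ Y i (k + 1) ω) := by
  rw [noise, add_sub_cancel, h.run, h.run]; rfl

/-- X_k is formed from X_{k-1} and V_{k-1}; the samples of iteration k enter only through M_k and
then V_k. The offset is what makes X_k and M_{k-1} known before the noise of iteration k. -/
lemma measurable_state (h : IsRun P R C η lam L σ D f g ξ x₀ Y) (k : ℕ) :
    (∀ i, Measurable[before ξ k] fun ω => (Y k ω).X i) ∧
    (∀ i, Measurable[before ξ (k + 1)] fun ω => (Y k ω).V i) ∧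
    ∀ i, Measurable[before ξ (k + 1)] fun ω => (Y k ω).M i := by
  induction k with
  | zero =>
    simp only [h.X_zero, h.V_zero, h.M_zero, Pi.zero_apply]
    exact ⟨fun _ => measurable_const, fun _ => measurable_const, fun _ => measurable_const⟩
  | succ k ih =>
    obtain ⟨ihX, ihV, ihM⟩ := ih
    have hle : before ξ (k + 1) ≤ before ξ (k + 1 + 1) := before_mono (Nat.le_succ _)
    have hX : ∀ i, Measurable[before ξ (k + 1)] fun ω => (Y (k + 1) ω).X i := by
      intro i
      simp only [h.X_succ]
      exact measurable_act R (Z := fun ω => (Y k ω).X - η • (Y k ω).V) (fun j =>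
        ((ihX j).mono (before_mono (Nat.le_succ _)) le_rfl).sub ((ihV j).const_smul η)) i
    have hM : ∀ i, Measurable[before ξ (k + 1 + 1)] fun ω => (Y (k + 1) ω).M i := by
      intro i
      have hX' := (hX i).mono hle le_rfl
      have hg := (h.oracle i).measurable.comp
        (hX'.prodMk (measurable_before (ξ := ξ) (j := i) (Nat.lt_succ_self (k + 1))))
      simp only [h.M_succ, noise, add_sub_cancel]
      exact (measurable_fun_smul ((ihM i).mono hle le_rfl) _).add (measurable_fun_smul hg _)
    refine ⟨hX, fun i => ?_, hM⟩
    simp only [h.V_succ]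
    exact (measurable_act C (Z := fun ω => (Y k ω).V)
      (fun j => (ihV j).mono hle le_rfl) i).add ((hM i).sub ((ihM i).mono hle le_rfl))

lemma measurable_X (h : IsRun P R C η lam L σ D f g ξ x₀ Y) (k : ℕ) (i : Fin n) :
    Measurable[before ξ k] fun ω => (Y k ω).X i := (h.measurable_state k).1 i

lemma measurable_M (h : IsRun P R C η lam L σ D f g ξ x₀ Y) (k : ℕ) (i : Fin n) :
    Measurable[before ξ (k + 1)] fun ω => (Y k ω).M i := (h.measurable_state k).2.2 i

lemma measurable_gradient (h : IsRun P R C η lam L σ D f g ξ x₀ Y) (k : ℕ) (i : Fin n) :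
    Measurable[before ξ k] fun ω => gradient (f i) ((Y k ω).X i) :=
  (h.loss i).continuous_gradient.measurable.comp (h.measurable_X k i)

/-- Noises of different agents in the same iteration are thus orthogonal, although `before` contains
neither of them. The factor 1/n in the variance of the average rests on this. -/
lemma measurable_noise_others (h : IsRun P R C η lam L σ D f g ξ x₀ Y) (k : ℕ) {i j : Fin n}
    (hij : j ≠ i) : Measurable[others ξ i k] (noise f g ξ Y j k) :=
  ((h.oracle j).measurable_noise (h.loss j)).comp
    (((h.measurable_X k j).mono (before_le_others i k) le_rfl).prodMk
      (measurable_others fun hq => hij (Prod.ext_iff.1 hq).1))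

section Probability

variable [IsProbabilityMeasure P]

lemma noise_memLp_and_variance_le (h : IsRun P R C η lam L σ D f g ξ x₀ Y) (i : Fin n) (k : ℕ) :
    MemLp (noise f g ξ Y i k) 2 P ∧ ∫ ω, ‖noise f g ξ Y i k ω‖ ^ 2 ∂P ≤ σ ^ 2 :=
  (h.oracle i).memLp_noise_and_variance_le (h.loss i)
    ((h.measurable_X k i).mono (h.sampling.before_le k) le_rfl) (h.sampling.measurable i k)
    (h.sampling.law i k) (h.sampling.indepFun_of_measurable_others
      ((h.measurable_X k i).mono (before_le_others i k) le_rfl))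

lemma integral_inner_noise (h : IsRun P R C η lam L σ D f g ξ x₀ Y) (i : Fin n) (k : ℕ)
    {U : Ω → Vec d} (hUm : Measurable[others ξ i k] U) (hU : MemLp U 2 P) :
    ∫ ω, inner ℝ (U ω) (noise f g ξ Y i k ω) ∂P = 0 :=
  (h.oracle i).integral_inner_noise (h.loss i) (hUm.mono (h.sampling.others_le i k) le_rfl)
    ((h.measurable_X k i).mono (h.sampling.before_le k) le_rfl) (h.sampling.measurable i k)
    (h.sampling.law i k) (h.sampling.indepFun_of_measurable_others
      (hUm.prodMk ((h.measurable_X k i).mono (before_le_others i k) le_rfl))) hU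

lemma integral_norm_add_noise_sq_le (h : IsRun P R C η lam L σ D f g ξ x₀ Y) (i : Fin n) (k : ℕ)
    {U : Ω → Vec d} (hUm : Measurable[others ξ i k] U) (hU : MemLp U 2 P) (c : ℝ) :
    ∫ ω, ‖U ω + c • noise f g ξ Y i k ω‖ ^ 2 ∂P ≤ ∫ ω, ‖U ω‖ ^ 2 ∂P + c ^ 2 * σ ^ 2 := by
  obtain ⟨hN, hvar⟩ := h.noise_memLp_and_variance_le i k
  rw [integral_norm_add_smul_sq hU hN (h.integral_inner_noise i k hUm hU)]
  gcongr

/-- The agents are added one at a time; each noise is orthogonal to the part already accumulated. -/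
lemma integral_norm_add_sum_noise_sq_le (h : IsRun P R C η lam L σ D f g ξ x₀ Y) (k : ℕ)
    {U : Ω → Vec d} (hUm : Measurable[before ξ k] U) (hU : MemLp U 2 P) (c : ℝ)
    (s : Finset (Fin n)) :
    ∫ ω, ‖U ω + c • ∑ i ∈ s, noise f g ξ Y i k ω‖ ^ 2 ∂P
      ≤ ∫ ω, ‖U ω‖ ^ 2 ∂P + s.card * (c ^ 2 * σ ^ 2) := by
  induction s using Finset.induction_on with
  | empty => simp
  | insert i s hi ih =>
    have hm : Measurable[others ξ i k] fun ω => U ω + c • ∑ j ∈ s, noise f g ξ Y j k ω :=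
      (hUm.mono (before_le_others i k) le_rfl).add ((Finset.measurable_fun_sum _ fun j hj =>
        h.measurable_noise_others k fun hji => hi (by rwa [← hji])).const_smul c)
    have hL : MemLp (fun ω => U ω + c • ∑ j ∈ s, noise f g ξ Y j k ω) 2 P :=
      hU.add ((memLp_finsetSum _ fun j _ => (h.noise_memLp_and_variance_le j k).1).const_smul c)
    have := h.integral_norm_add_noise_sq_le i k hm hL c
    rw [Finset.card_insert_of_notMem hi]
    simp only [Finset.sum_insert hi]
    push_cast
    calc ∫ ω, ‖U ω + c • (noise f g ξ Y i k ω + ∑ j ∈ s, noise f g ξ Y j k ω)‖ ^ 2 ∂P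
        = ∫ ω, ‖U ω + c • ∑ j ∈ s, noise f g ξ Y j k ω + c • noise f g ξ Y i k ω‖ ^ 2 ∂P := by
          congr 1; funext ω; congr 2; rw [smul_add]; abel
      _ ≤ _ := by linarith

/-- Adding `c` times the average noise to a vector known before iteration `k`. -/
lemma integral_norm_add_avg_noise_sq_le (h : IsRun P R C η lam L σ D f g ξ x₀ Y) (hn : 0 < n)
    (k : ℕ) {U : Ω → Vec d} (hUm : Measurable[before ξ k] U) (hU : MemLp U 2 P) (c : ℝ) :
    ∫ ω, ‖U ω + (c * (1 / (n : ℝ))) • ∑ i, noise f g ξ Y i k ω‖ ^ 2 ∂P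
      ≤ ∫ ω, ‖U ω‖ ^ 2 ∂P + c ^ 2 * (σ ^ 2 / n) := by
  have hn' : (0 : ℝ) < n := Nat.cast_pos.2 hn
  refine (h.integral_norm_add_sum_noise_sq_le k hUm hU _ _).trans_eq ?_
  simp only [Finset.card_univ, Fintype.card_fin]
  field_simp

lemma memLp_state (h : IsRun P R C η lam L σ D f g ξ x₀ Y) (k : ℕ) :
    (∀ i, MemLp (fun ω => (Y k ω).X i) 2 P) ∧ (∀ i, MemLp (fun ω => (Y k ω).V i) 2 P) ∧
    ∀ i, MemLp (fun ω => (Y k ω).M i) 2 P := by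
  induction k with
  | zero =>
    simp only [h.X_zero, h.V_zero, h.M_zero, Pi.zero_apply]
    exact ⟨fun _ => memLp_const _, fun _ => memLp_const _, fun _ => memLp_const _⟩
  | succ k ih =>
    obtain ⟨ihX, ihV, ihM⟩ := ih
    have hX : ∀ i, MemLp (fun ω => (Y (k + 1) ω).X i) 2 P := by
      intro i
      simp only [h.X_succ]
      exact memLp_act R (Z := fun ω => (Y k ω).X - η • (Y k ω).V)
        (fun j => memLp_fun_sub (ihX j) (memLp_fun_smul (ihV j) η)) i
    have hM : ∀ i, MemLp (fun ω => (Y (k + 1) ω).M i) 2 P := by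
      intro i
      simp only [h.M_succ]
      exact memLp_fun_add (memLp_fun_smul (ihM i) _) (memLp_fun_smul (memLp_fun_add
        ((h.loss i).memLp_gradient (hX i)) (h.noise_memLp_and_variance_le i (k + 1)).1) _)
    refine ⟨hX, fun i => ?_, hM⟩
    simp only [h.V_succ]
    exact memLp_fun_add (memLp_act C (Z := fun ω => (Y k ω).V) ihV i)
      (memLp_fun_sub (hM i) (ihM i))

lemma memLp_X (h : IsRun P R C η lam L σ D f g ξ x₀ Y) (k : ℕ) (i : Fin n) :
    MemLp (fun ω => (Y k ω).X i) 2 P := (h.memLp_state k).1 i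

lemma memLp_V (h : IsRun P R C η lam L σ D f g ξ x₀ Y) (k : ℕ) (i : Fin n) :
    MemLp (fun ω => (Y k ω).V i) 2 P := (h.memLp_state k).2.1 i

lemma memLp_M (h : IsRun P R C η lam L σ D f g ξ x₀ Y) (k : ℕ) (i : Fin n) :
    MemLp (fun ω => (Y k ω).M i) 2 P := (h.memLp_state k).2.2 i

lemma memLp_gradient (h : IsRun P R C η lam L σ D f g ξ x₀ Y) (k : ℕ) (i : Fin n) :
    MemLp (fun ω => gradient (f i) ((Y k ω).X i)) 2 P := (h.loss i).memLp_gradient (h.memLp_X k i)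

lemma memLp_hbar (h : IsRun P R C η lam L σ D f g ξ x₀ Y) (k : ℕ) : MemLp (hbar f Y k) 2 P :=
  memLp_fun_smul (memLp_finsetSum _ fun i _ => h.memLp_gradient k i) _

lemma memLp_xbar (h : IsRun P R C η lam L σ D f g ξ x₀ Y) (πR : Fin n → ℝ) (k : ℕ) :
    MemLp (xbar πR Y k) 2 P :=
  memLp_finsetSum _ fun i _ => memLp_fun_smul (h.memLp_X k i) _

lemma memLp_mbarPrev (h : IsRun P R C η lam L σ D f g ξ x₀ Y) (k : ℕ) :
    MemLp (mbarPrev Y k) 2 P := by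
  cases k with
  | zero => exact memLp_const (0 : Vec d)
  | succ k => exact memLp_fun_smul (memLp_finsetSum _ fun i _ => h.memLp_M k i) _

lemma memLp_ztilde (h : IsRun P R C η lam L σ D f g ξ x₀ Y) (πR πC : Fin n → ℝ) (k : ℕ) :
    MemLp (ztilde πR πC η lam Y k) 2 P :=
  memLp_fun_sub (h.memLp_xbar πR k) (memLp_fun_smul (h.memLp_mbarPrev k) _)

end Probability

lemma measurable_hbar (h : IsRun P R C η lam L σ D f g ξ x₀ Y) (k : ℕ) :
    Measurable[before ξ k] (hbar f Y k) :=
  measurable_fun_smul (Finset.measurable_fun_sum _ fun i _ => h.measurable_gradient k i) _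

lemma measurable_xbar (h : IsRun P R C η lam L σ D f g ξ x₀ Y) (πR : Fin n → ℝ) (k : ℕ) :
    Measurable[before ξ k] (xbar πR Y k) :=
  Finset.measurable_fun_sum _ fun i _ => measurable_fun_smul (h.measurable_X k i) _

lemma measurable_mbarPrev (h : IsRun P R C η lam L σ D f g ξ x₀ Y) (k : ℕ) :
    Measurable[before ξ k] (mbarPrev Y k) := by
  cases k with
  | zero => exact measurable_const (a := (0 : Vec d))
  | succ k =>
    exact measurable_fun_smul (Finset.measurable_fun_sum _ fun i _ => h.measurable_M k i) _

lemma measurable_ztilde (h : IsRun P R C η lam L σ D f g ξ x₀ Y) (πR πC : Fin n → ℝ) (k : ℕ) :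
    Measurable[before ξ k] (ztilde πR πC η lam Y k) :=
  (h.measurable_xbar πR k).sub (measurable_fun_smul (h.measurable_mbarPrev k) _)

end IsRun

/-! ### One-step bounds along a run -/

section Elementary

variable {n d : ℕ}

/-- Convexity of the square on ρu + (1 - ρ)(w/(1 - ρ)). It serves every contraction below, with ρ
equal to ρ_R, ρ_C or 1 - λ. -/
lemma sq_le_of_le_contraction_add {ρ u w y : ℝ} (hρ0 : 0 ≤ ρ) (hρ : ρ < 1) (hy : 0 ≤ y)
    (h : y ≤ ρ * u + w) : y ^ 2 ≤ ρ * u ^ 2 + w ^ 2 / (1 - ρ) := by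
  have h1 : 0 < 1 - ρ := by linarith
  have h2 : y ^ 2 ≤ (ρ * u + w) ^ 2 := by gcongr
  have h3 : ρ * u ^ 2 + w ^ 2 / (1 - ρ) - (ρ * u + w) ^ 2
      = ρ / (1 - ρ) * ((1 - ρ) * u - w) ^ 2 := by field_simp; ring
  have h4 : 0 ≤ ρ / (1 - ρ) * ((1 - ρ) * u - w) ^ 2 := by positivity
  linarith

lemma norm_add_sq_le_two (a b : Vec d) : ‖a + b‖ ^ 2 ≤ 2 * ‖a‖ ^ 2 + 2 * ‖b‖ ^ 2 := by
  have h := parallelogram_law_with_norm ℝ a b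
  nlinarith [sq_nonneg ‖a - b‖]

lemma frobNorm_add_sq_le_two (X Z : Rows n d) :
    frobNorm (X + Z) ^ 2 ≤ 2 * frobNorm X ^ 2 + 2 * frobNorm Z ^ 2 := by
  simp only [frobNorm_sq, Finset.mul_sum, ← Finset.sum_add_distrib]
  exact Finset.sum_le_sum fun i _ => norm_add_sq_le_two _ _

lemma act_projR_apply (π : Fin n → ℝ) (X : Rows n d) (i : Fin n) :
    act (projR π) X i = ∑ j, π j • X j := by
  simp [act, projR, Matrix.vecMulVec_apply]

lemma act_projC_apply (π : Fin n → ℝ) (X : Rows n d) (i : Fin n) :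
    act (projC π) X i = π i • ∑ j, X j := by
  simp [act, projC, Matrix.vecMulVec_apply, Finset.smul_sum]

lemma IsStationary.sum_sq_le_one {A : Matrix (Fin n) (Fin n) ℝ} {π : Fin n → ℝ}
    (h : IsStationary A π) : ∑ i, π i ^ 2 ≤ 1 := by
  have hle : ∀ i, π i ≤ 1 := fun i => h.sum_eq_one ▸
    Finset.single_le_sum (fun j _ => h.nonneg j) (Finset.mem_univ i)
  calc ∑ i, π i ^ 2 ≤ ∑ i, π i :=
        Finset.sum_le_sum fun i _ => by nlinarith [h.nonneg i, hle i]
    _ = 1 := h.sum_eq_one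

/-- The inequality behind the descent of the virtual sequence. -/
lemma descent_inner_bound {η c L : ℝ} (hη : 0 < η) (hc : 0 < c) (hL : 0 ≤ L)
    (a b gx w G : Vec d) :
    -(η * c) * inner ℝ a b - η * inner ℝ a w + L / 2 * ‖(η * c) • G + η • w‖ ^ 2
      ≤ -(3 / 16 * (η * c)) * ‖gx‖ ^ 2 + 2 * (η * c) * ‖a - gx‖ ^ 2 + η * c * ‖gx - b‖ ^ 2
        - η * c * ‖b‖ ^ 2 / 2 + (2 * η / c + L * η ^ 2) * ‖w‖ ^ 2
        + L * η ^ 2 * c ^ 2 * ‖G‖ ^ 2 := by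
  -- Polarization turns -⟨a, b⟩ into (‖a - b‖² - ‖a‖² - ‖b‖²)/2. Of the ½‖a‖² gained, 1/8 is spent
  -- on the bias w; the remaining 3/8 becomes 3/16 when ‖a‖² is exchanged for ‖gx‖²/2 - ‖a - gx‖².
  have h1 : ‖a - b‖ ^ 2 = ‖a‖ ^ 2 - 2 * inner ℝ a b + ‖b‖ ^ 2 := norm_sub_sq_real a b
  have h2 : ‖a - b‖ ^ 2 ≤ 2 * ‖a - gx‖ ^ 2 + 2 * ‖gx - b‖ ^ 2 := by
    simpa using norm_add_sq_le_two (a - gx) (gx - b)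
  have h3 : ‖gx‖ ^ 2 ≤ 2 * ‖a‖ ^ 2 + 2 * ‖a - gx‖ ^ 2 := by
    have := norm_add_sq_le_two a (gx - a)
    rwa [add_sub_cancel, norm_sub_rev] at this
  have h4 : -inner ℝ a w ≤ c / 8 * ‖a‖ ^ 2 + 2 / c * ‖w‖ ^ 2 := by
    have h5 := (abs_le.1 (abs_real_inner_le_norm a w)).1
    have h6 : c / 8 * ‖a‖ ^ 2 + 2 / c * ‖w‖ ^ 2 - ‖a‖ * ‖w‖
        = 2 / c * (c / 4 * ‖a‖ - ‖w‖) ^ 2 := by field_simp; ring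
    have h7 : 0 ≤ 2 / c * (c / 4 * ‖a‖ - ‖w‖) ^ 2 := by positivity
    linarith
  have h5 : ‖(η * c) • G + η • w‖ ^ 2 ≤ 2 * (η ^ 2 * c ^ 2 * ‖G‖ ^ 2) + 2 * (η ^ 2 * ‖w‖ ^ 2) := by
    refine (norm_add_sq_le_two _ _).trans_eq ?_
    simp only [norm_smul, mul_pow, Real.norm_eq_abs, sq_abs]
  have h6 : η * -inner ℝ a w ≤ η * (c / 8 * ‖a‖ ^ 2 + 2 / c * ‖w‖ ^ 2) := by gcongr
  have h7 : L / 2 * ‖(η * c) • G + η • w‖ ^ 2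
      ≤ L / 2 * (2 * (η ^ 2 * c ^ 2 * ‖G‖ ^ 2) + 2 * (η ^ 2 * ‖w‖ ^ 2)) := by gcongr
  have h8 : η * c * (-inner ℝ a b) ≤ η * c * ((2 * ‖a - gx‖ ^ 2 + 2 * ‖gx - b‖ ^ 2
      - ‖a‖ ^ 2 - ‖b‖ ^ 2) / 2) := by
    gcongr
    linarith
  have h9 : η * c * ‖gx‖ ^ 2 ≤ η * c * (2 * ‖a‖ ^ 2 + 2 * ‖a - gx‖ ^ 2) := by gcongr
  have h10 : 0 ≤ η * c * ‖a - gx‖ ^ 2 := by positivity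
  have h11 : η * (c / 8 * ‖a‖ ^ 2 + 2 / c * ‖w‖ ^ 2)
      = η * c * ‖a‖ ^ 2 / 8 + 2 * η / c * ‖w‖ ^ 2 := by ring
  linarith

end Elementary

/-- The gain from trackers and momenta to the consensus error. -/
def consensusGain {n : ℕ} (πR : Fin n → ℝ) (ρR δR : ℝ) : ℝ :=
  δR ^ 2 * sumSq (1 - projR πR) * (2 * (n : ℝ) ^ 2) / (1 - ρR) + 1

/-- The gain from the errors to the increments of the models. -/
def incrementGain {n : ℕ} (R : Matrix (Fin n) (Fin n) ℝ) : ℝ :=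
  2 * sumSq (R - 1) + 2 * sumSq R * (2 * (n : ℝ) ^ 2)

namespace IsRun

variable {n d : ℕ} {Ω : Type*} [MeasurableSpace Ω] {P : Measure Ω}
  {Ξ : Fin n → Type*} [∀ i, MeasurableSpace (Ξ i)] {R C : Matrix (Fin n) (Fin n) ℝ}
  {η lam L σ : ℝ} {D : ∀ i, Measure (Ξ i)} {f : Fin n → Vec d → ℝ}
  {g : ∀ i, Vec d → Ξ i → Vec d} {ξ : ∀ i, ℕ → Ω → Ξ i} {x₀ : Vec d} {Y : ℕ → Ω → State n d}
  {πR πC : Fin n → ℝ} {SR SC : Matrix (Fin n) (Fin n) ℝ} {ρR ρC δR δC : ℝ}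

/-- The trackers and the momenta have the same sum. -/
lemma sum_V (h : IsRun P R C η lam L σ D f g ξ x₀ Y)
    (hC : C ∈ Matrix.colStochastic ℝ (Fin n)) (k : ℕ) (ω : Ω) :
    ∑ i, (Y k ω).V i = ∑ i, (Y k ω).M i := by
  induction k with
  | zero => rw [h.V_zero, h.M_zero]
  | succ k ih =>
    have hact : ∑ i, act C (Y k ω).V i = ∑ i, (Y k ω).V i := by
      simp only [act_apply]
      rw [Finset.sum_comm]
      simp [← Finset.sum_smul, Matrix.sum_col_of_mem_colStochastic hC]
    rw [h.V_succ]
    simp only [Pi.add_apply, Pi.sub_apply, Finset.sum_add_distrib, Finset.sum_sub_distrib, hact,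
      ih]
    abel

/-- Gradient tracking: C preserves column sums, so the projected tracker is π_C times n m̄_k. With
the shifted indexing m̄_k is `mbarPrev` at k + 1. -/
lemma act_projC_V (h : IsRun P R C η lam L σ D f g ξ x₀ Y)
    (hC : C ∈ Matrix.colStochastic ℝ (Fin n)) (hn : 0 < n) (k : ℕ) (ω : Ω) (i : Fin n) :
    act (projC πC) (Y k ω).V i = (πC i * n) • mbarPrev Y (k + 1) ω := by
  have hn' : (n : ℝ) ≠ 0 := (Nat.cast_pos.2 hn).ne'
  rw [act_projC_apply, h.sum_V hC, mbarPrev, smul_smul]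
  congr 1
  field_simp

lemma frobNorm_V_sq_le (h : IsRun P R C η lam L σ D f g ξ x₀ Y)
    (hC : C ∈ Matrix.colStochastic ℝ (Fin n)) (hn : 0 < n) (hπC : IsStationary C πC)
    (hSC : IsMixingNorm C (projC πC) SC ρC δC) (k : ℕ) (ω : Ω) :
    frobNorm (Y k ω).V ^ 2
      ≤ 2 * (n : ℝ) ^ 2 * (trackingSq πC SC Y k ω + ‖mbarPrev Y (k + 1) ω‖ ^ 2) := by
  have hn1 : (1 : ℝ) ≤ n := Nat.one_le_cast.2 hn
  have hn2 : (1 : ℝ) ≤ (n : ℝ) ^ 2 := one_le_pow₀ hn1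
  have h1 := frobNorm_add_sq_le_two ((Y k ω).V - act (projC πC) (Y k ω).V)
    (act (projC πC) (Y k ω).V)
  rw [sub_add_cancel] at h1
  have h2 : frobNorm ((Y k ω).V - act (projC πC) (Y k ω).V) ^ 2 ≤ trackingSq πC SC Y k ω := by
    unfold trackingSq
    have := frobNorm_nonneg ((Y k ω).V - act (projC πC) (Y k ω).V)
    gcongr
    exact hSC.frob_le _ _
  have h3 : frobNorm (act (projC πC) (Y k ω).V) ^ 2
      ≤ (n : ℝ) ^ 2 * ‖mbarPrev Y (k + 1) ω‖ ^ 2 := by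
    rw [frobNorm_sq]
    simp only [h.act_projC_V hC hn, norm_smul, mul_pow, Real.norm_eq_abs, sq_abs]
    simp only [mul_assoc]
    rw [← Finset.sum_mul]
    exact mul_le_of_le_one_left (by positivity) hπC.sum_sq_le_one
  have h4 : trackingSq πC SC Y k ω ≤ (n : ℝ) ^ 2 * trackingSq πC SC Y k ω :=
    le_mul_of_one_le_left (sq_nonneg _) hn2
  linarith

lemma consensusSq_succ_le (h : IsRun P R C η lam L σ D f g ξ x₀ Y)
    (hC : C ∈ Matrix.colStochastic ℝ (Fin n)) (hn : 0 < n) (hπR : IsStationary Rᵀ πR)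
    (hπC : IsStationary C πC) (hSR : IsMixingNorm R (projR πR) SR ρR δR)
    (hSC : IsMixingNorm C (projC πC) SC ρC δC) (k : ℕ) (ω : Ω) :
    consensusSq πR SR Y (k + 1) ω ≤ ρR * consensusSq πR SR Y k ω
      + consensusGain πR ρR δR * η ^ 2
        * (trackingSq πC SC Y k ω + ‖mbarPrev Y (k + 1) ω‖ ^ 2) := by
  have hρ : 0 < 1 - ρR := by linarith [hSR.rho_lt_one]
  set X := (Y k ω).X
  set V := (Y k ω).V with hV
  set Q := projR πR
  -- Π_R R = Π_R, so projecting commutes past the mixing step.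
  have h1 : (Y (k + 1) ω).X - act Q (Y (k + 1) ω).X = act R (X - η • V) - act Q (X - η • V) := by
    rw [h.X_succ, ← mul_act, hπR.projR_mul]
  have h2 : X - η • V - act Q (X - η • V) = (X - act Q X) + (-η) • (V - act Q V) := by
    rw [act_sub, act_smul]; module
  have h3 : weightedNorm SR ((Y (k + 1) ω).X - act Q (Y (k + 1) ω).X)
      ≤ ρR * weightedNorm SR (X - act Q X) + |η| * weightedNorm SR (V - act Q V) := by
    rw [h1]
    refine (hSR.contract d _).trans ?_
    rw [h2]
    have h4 := weightedNorm_add_le SR (X - act Q X) ((-η) • (V - act Q V))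
    rw [weightedNorm_smul, abs_neg] at h4
    have h5 := mul_le_mul_of_nonneg_left h4 hSR.rho_pos.le
    have h6 : ρR * (|η| * weightedNorm SR (V - act Q V)) ≤ |η| * weightedNorm SR (V - act Q V) :=
      mul_le_of_le_one_left (mul_nonneg (abs_nonneg _) (weightedNorm_nonneg _ _))
        hSR.rho_lt_one.le
    linarith
  have h4 := sq_le_of_le_contraction_add hSR.rho_pos.le hSR.rho_lt_one (weightedNorm_nonneg _ _) h3
  have h5 : weightedNorm SR (V - act Q V) ^ 2 ≤ δR ^ 2 * (sumSq (1 - Q) * (2 * (n : ℝ) ^ 2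
      * (trackingSq πC SC Y k ω + ‖mbarPrev Y (k + 1) ω‖ ^ 2))) := by
    calc weightedNorm SR (V - act Q V) ^ 2 ≤ (δR * frobNorm (V - act Q V)) ^ 2 := by
          have := weightedNorm_nonneg SR (V - act Q V)
          gcongr
          exact hSR.le_frob _ _
      _ = δR ^ 2 * frobNorm (act (1 - Q) V) ^ 2 := by rw [sub_act, one_act, mul_pow]
      _ ≤ δR ^ 2 * (sumSq (1 - Q) * frobNorm V ^ 2) := by
          gcongr; exact frobNorm_act_sq_le _ _
      _ ≤ _ := by
          have := sumSq_nonneg (1 - Q)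
          gcongr
          exact h.frobNorm_V_sq_le hC hn hπC hSC k ω
  have h6 : (|η| * weightedNorm SR (V - act Q V)) ^ 2 / (1 - ρR)
      ≤ consensusGain πR ρR δR * η ^ 2
        * (trackingSq πC SC Y k ω + ‖mbarPrev Y (k + 1) ω‖ ^ 2) := by
    rw [mul_pow, sq_abs]
    have h7 : 0 ≤ trackingSq πC SC Y k ω + ‖mbarPrev Y (k + 1) ω‖ ^ 2 :=
      add_nonneg (sq_nonneg _) (sq_nonneg _)
    calc η ^ 2 * weightedNorm SR (V - act Q V) ^ 2 / (1 - ρR)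
        ≤ η ^ 2 * (δR ^ 2 * (sumSq (1 - Q) * (2 * (n : ℝ) ^ 2
          * (trackingSq πC SC Y k ω + ‖mbarPrev Y (k + 1) ω‖ ^ 2)))) / (1 - ρR) := by gcongr
      _ = (consensusGain πR ρR δR - 1) * η ^ 2
          * (trackingSq πC SC Y k ω + ‖mbarPrev Y (k + 1) ω‖ ^ 2) := by
          rw [consensusGain]; ring
      _ ≤ _ := by gcongr; linarith
  exact h4.trans (by unfold consensusSq; linarith)

lemma frobNorm_increment_sq_le (h : IsRun P R C η lam L σ D f g ξ x₀ Y)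
    (hR : R ∈ Matrix.rowStochastic ℝ (Fin n))
    (hC : C ∈ Matrix.colStochastic ℝ (Fin n)) (hn : 0 < n)
    (hπC : IsStationary C πC) (hSR : IsMixingNorm R (projR πR) SR ρR δR)
    (hSC : IsMixingNorm C (projC πC) SC ρC δC) (k : ℕ) (ω : Ω) :
    frobNorm ((Y (k + 1) ω).X - (Y k ω).X) ^ 2
      ≤ incrementGain R * (consensusSq πR SR Y k ω + η ^ 2 * trackingSq πC SC Y k ω
        + η ^ 2 * ‖mbarPrev Y (k + 1) ω‖ ^ 2) := by
  set X := (Y k ω).X with hX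
  set V := (Y k ω).V with hV
  set Q := projR πR with hQ
  -- R - 1 kills consensus matrices, so only the deviation from consensus is moved by mixing.
  have h1 : (Y (k + 1) ω).X - X = act (R - 1) (X - act Q X) + (-η) • act R V := by
    have h2 : act R (act Q X) = act Q X := by rw [← mul_act, hQ, mul_projR hR]
    rw [h.X_succ, sub_act, one_act, act_sub, act_smul, act_sub, h2]
    module
  have h2 : frobNorm (X - act Q X) ^ 2 ≤ consensusSq πR SR Y k ω := by
    unfold consensusSq
    have := frobNorm_nonneg (X - act Q X)
    gcongr
    exact hSR.frob_le _ _
  have h3 : frobNorm (act (R - 1) (X - act Q X)) ^ 2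
      ≤ sumSq (R - 1) * consensusSq πR SR Y k ω :=
    (frobNorm_act_sq_le _ _).trans (mul_le_mul_of_nonneg_left h2 (sumSq_nonneg _))
  have h4 : frobNorm ((-η) • act R V) ^ 2 ≤ η ^ 2 * (sumSq R * (2 * (n : ℝ) ^ 2
      * (trackingSq πC SC Y k ω + ‖mbarPrev Y (k + 1) ω‖ ^ 2))) := by
    rw [frobNorm_smul, mul_pow, abs_neg, sq_abs]
    have := sumSq_nonneg R
    have h5 := (frobNorm_act_sq_le R V).trans (mul_le_mul_of_nonneg_left
      (h.frobNorm_V_sq_le hC hn hπC hSC k ω) (sumSq_nonneg R))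
    gcongr
  have h5 := frobNorm_add_sq_le_two (act (R - 1) (X - act Q X)) ((-η) • act R V)
  rw [h1]
  have h6 : 0 ≤ sumSq (R - 1) * (η ^ 2 * trackingSq πC SC Y k ω
      + η ^ 2 * ‖mbarPrev Y (k + 1) ω‖ ^ 2) := by
    have : 0 ≤ trackingSq πC SC Y k ω := sq_nonneg _
    have := sumSq_nonneg (R - 1)
    positivity
  have h7 : 0 ≤ sumSq R * (n : ℝ) ^ 2 * consensusSq πR SR Y k ω := by
    have : 0 ≤ consensusSq πR SR Y k ω := sq_nonneg _
    have := sumSq_nonneg R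
    positivity
  rw [incrementGain]
  linarith

/-- Π_C C = Π_C, so the deviation contracts and is driven by the momentum increment. The spectral
norm is used here because this gain enters the error floor, whose constant sees the projection only
through c_Π; the gains bounded by `sumSq` enter only the threshold and p₄. -/
lemma trackingSq_succ_le (h : IsRun P R C η lam L σ D f g ξ x₀ Y)
    (hC : C ∈ Matrix.colStochastic ℝ (Fin n))
    (hSC : IsMixingNorm C (projC πC) SC ρC δC) (k : ℕ) (ω : Ω) :
    trackingSq πC SC Y (k + 1) ω ≤ ρC * trackingSq πC SC Y k ω
      + trackGain ρC δC (cProj πC) * frobNorm ((Y (k + 1) ω).M - (Y k ω).M) ^ 2 := by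
  have hρ : 0 < 1 - ρC := by linarith [hSC.rho_lt_one]
  set V := (Y k ω).V with hV
  set Δ := (Y (k + 1) ω).M - (Y k ω).M with hΔ
  set Q := projC πC with hQ
  have hQC : Q * C = Q := by
    rw [hQ, projC, Matrix.vecMulVec_mul, Matrix.one_vecMul_of_mem_colStochastic hC]
  have h1 : (Y (k + 1) ω).V - act Q (Y (k + 1) ω).V = (act C V - act Q V) + (Δ - act Q Δ) := by
    rw [h.V_succ, ← hV, ← hΔ, act_add, ← mul_act, hQC]
    abel
  have h2 : weightedNorm SC ((Y (k + 1) ω).V - act Q (Y (k + 1) ω).V)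
      ≤ ρC * weightedNorm SC (V - act Q V) + weightedNorm SC (Δ - act Q Δ) := by
    rw [h1]
    exact (weightedNorm_add_le _ _ _).trans (by gcongr; exact hSC.contract d V)
  have h3 := sq_le_of_le_contraction_add hSC.rho_pos.le hSC.rho_lt_one (weightedNorm_nonneg _ _) h2
  have h4 : weightedNorm SC (Δ - act Q Δ) ^ 2 ≤ δC ^ 2 * (cProj πC * frobNorm Δ ^ 2) := by
    calc weightedNorm SC (Δ - act Q Δ) ^ 2 ≤ (δC * frobNorm (Δ - act Q Δ)) ^ 2 := by
          have := weightedNorm_nonneg SC (Δ - act Q Δ)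
          gcongr
          exact hSC.le_frob _ _
      _ ≤ _ := by
          rw [mul_pow]
          gcongr
          exact frobNorm_sub_projC_sq_le _ _
  have h5 : weightedNorm SC (Δ - act Q Δ) ^ 2 / (1 - ρC)
      ≤ trackGain ρC δC (cProj πC) * frobNorm Δ ^ 2 := by
    calc _ ≤ δC ^ 2 * (cProj πC * frobNorm Δ ^ 2) / (1 - ρC) := by gcongr
      _ = _ := by rw [trackGain]; ring
  exact h3.trans (by unfold trackingSq; linarith)

lemma norm_gradient_increment_sq_le (h : IsRun P R C η lam L σ D f g ξ x₀ Y) (k : ℕ) (ω : Ω)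
    (i : Fin n) : ‖gradient (f i) ((Y (k + 1) ω).X i) - gradient (f i) ((Y k ω).X i)‖ ^ 2
      ≤ L ^ 2 * ‖((Y (k + 1) ω).X - (Y k ω).X) i‖ ^ 2 := by
  rw [← mul_pow]
  gcongr
  exact (h.loss i).lipschitz_gradient _ _

lemma mbarPrev_succ (h : IsRun P R C η lam L σ D f g ξ x₀ Y) (k : ℕ) (ω : Ω) :
    mbarPrev Y (k + 2) ω = ((1 - lam) • mbarPrev Y (k + 1) ω + lam • hbar f Y (k + 1) ω)
      + (lam * (1 / (n : ℝ))) • ∑ i, noise f g ξ Y i (k + 1) ω := by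
  simp only [mbarPrev, hbar, h.M_succ, Finset.sum_add_distrib, ← Finset.smul_sum]
  module

section Probability

variable [IsProbabilityMeasure P]

lemma integrable_increment (h : IsRun P R C η lam L σ D f g ξ x₀ Y) (k : ℕ) :
    Integrable (fun ω => frobNorm ((Y (k + 1) ω).X - (Y k ω).X) ^ 2) P :=
  integrable_frobNorm_sq fun i => memLp_fun_sub (h.memLp_X (k + 1) i) (h.memLp_X k i)

lemma integrable_consensusSq (h : IsRun P R C η lam L σ D f g ξ x₀ Y) (k : ℕ) :
    Integrable (consensusSq πR SR Y k) P :=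
  integrable_frobNorm_sq (memLp_act SR fun i =>
    memLp_fun_sub (h.memLp_X k i) (memLp_act (projR πR) (h.memLp_X k) i))

lemma integrable_trackingSq (h : IsRun P R C η lam L σ D f g ξ x₀ Y) (k : ℕ) :
    Integrable (trackingSq πC SC Y k) P :=
  integrable_frobNorm_sq (memLp_act SC fun i =>
    memLp_fun_sub (h.memLp_V k i) (memLp_act (projC πC) (h.memLp_V k) i))

lemma integrable_momentumSq (h : IsRun P R C η lam L σ D f g ξ x₀ Y) (k : ℕ) :
    Integrable (momentumSq f Y k) P :=
  integrable_frobNorm_sq fun i => memLp_fun_sub (h.memLp_M k i) (h.memLp_gradient k i)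

lemma integral_frobNorm_add_noise_sq_le (h : IsRun P R C η lam L σ D f g ξ x₀ Y) (k : ℕ)
    {U : Ω → Rows n d} (hUm : ∀ i, Measurable[before ξ k] fun ω => U ω i)
    (hU : ∀ i, MemLp (fun ω => U ω i) 2 P) (c : ℝ) :
    ∫ ω, frobNorm (fun i => U ω i + c • noise f g ξ Y i k ω) ^ 2 ∂P
      ≤ ∫ ω, frobNorm (U ω) ^ 2 ∂P + c ^ 2 * (n * σ ^ 2) := by
  simp only [frobNorm_sq]
  rw [integral_finsetSum _ fun i _ => integrable_norm_sq (memLp_fun_add (hU i)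
      (memLp_fun_smul (h.noise_memLp_and_variance_le i k).1 c)),
    integral_finsetSum _ fun i _ => integrable_norm_sq (hU i)]
  refine (Finset.sum_le_sum fun i _ => h.integral_norm_add_noise_sq_le i k
    ((hUm i).mono (before_le_others i k) le_rfl) (hU i) c).trans_eq ?_
  rw [Finset.sum_add_distrib]
  simp
  ring

/-- The increment is λ(∇F(X_{k+1}) - M_k) plus λ times fresh noise, and X_{k+1} and M_k are known
before that noise is drawn. -/
lemma integral_momentum_increment_le (h : IsRun P R C η lam L σ D f g ξ x₀ Y) (k : ℕ) :
    ∫ ω, frobNorm ((Y (k + 1) ω).M - (Y k ω).M) ^ 2 ∂P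
      ≤ lam ^ 2 * (n * σ ^ 2)
        + 2 * lam ^ 2 * L ^ 2 * ∫ ω, frobNorm ((Y (k + 1) ω).X - (Y k ω).X) ^ 2 ∂P
        + 2 * lam ^ 2 * ∫ ω, momentumSq f Y k ω ∂P := by
  set U : Ω → Rows n d := fun ω i => lam • (gradient (f i) ((Y (k + 1) ω).X i) - (Y k ω).M i)
    with hUdef
  have hUm : ∀ i, Measurable[before ξ (k + 1)] fun ω => U ω i := fun i =>
    measurable_fun_smul ((h.measurable_gradient (k + 1) i).sub (h.measurable_M k i)) lam
  have hU : ∀ i, MemLp (fun ω => U ω i) 2 P := fun i =>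
    memLp_fun_smul (memLp_fun_sub (h.memLp_gradient (k + 1) i) (h.memLp_M k i)) lam
  have h1 : ∀ ω, (Y (k + 1) ω).M - (Y k ω).M
      = fun i => U ω i + lam • noise f g ξ Y i (k + 1) ω := by
    intro ω
    funext i
    simp only [Pi.sub_apply, h.M_succ, hUdef]
    module
  have h2 := h.integral_frobNorm_add_noise_sq_le (k + 1) hUm hU lam
  have h3 : ∀ ω, frobNorm (U ω) ^ 2
      ≤ 2 * lam ^ 2 * L ^ 2 * frobNorm ((Y (k + 1) ω).X - (Y k ω).X) ^ 2
        + 2 * lam ^ 2 * momentumSq f Y k ω := by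
    intro ω
    simp only [momentumSq, frobNorm_sq, Finset.mul_sum, ← Finset.sum_add_distrib]
    refine Finset.sum_le_sum fun i _ => ?_
    have h4 := norm_add_sq_le_two (gradient (f i) ((Y (k + 1) ω).X i)
      - gradient (f i) ((Y k ω).X i)) (gradient (f i) ((Y k ω).X i) - (Y k ω).M i)
    rw [sub_add_sub_cancel, norm_sub_rev (gradient (f i) ((Y k ω).X i))] at h4
    have h5 := h.norm_gradient_increment_sq_le k ω i
    simp only [hUdef, norm_smul, mul_pow, Real.norm_eq_abs, sq_abs]
    have h6 := mul_le_mul_of_nonneg_left (h4.trans (add_le_add_left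
      (mul_le_mul_of_nonneg_left h5 zero_le_two) _)) (sq_nonneg lam)
    linarith
  have i1 := (h.integrable_increment k).const_mul (2 * lam ^ 2 * L ^ 2)
  have i2 := (h.integrable_momentumSq k).const_mul (2 * lam ^ 2)
  have h4 : ∫ ω, frobNorm (U ω) ^ 2 ∂P
      ≤ ∫ ω, (2 * lam ^ 2 * L ^ 2 * frobNorm ((Y (k + 1) ω).X - (Y k ω).X) ^ 2
        + 2 * lam ^ 2 * momentumSq f Y k ω) ∂P :=
    integral_mono (integrable_frobNorm_sq hU) (i1.add i2) h3
  rw [integral_add i1 i2, integral_const_mul, integral_const_mul] at h4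
  simp only [h1]
  simp only [h1] at *
  linarith

/-- The new error is (1 - λ)(M_k - ∇F(X_{k+1})) plus λ times fresh noise. Replacing ∇F(X_{k+1}) by
∇F(X_k) costs the drift of the gradients, amplified by 1/λ on squaring. -/
lemma integral_momentumSq_succ_le (h : IsRun P R C η lam L σ D f g ξ x₀ Y) (hl : 0 < lam)
    (hl1 : lam < 1) (k : ℕ) :
    ∫ ω, momentumSq f Y (k + 1) ω ∂P ≤ (1 - lam) * ∫ ω, momentumSq f Y k ω ∂P
      + L ^ 2 / lam * ∫ ω, frobNorm ((Y (k + 1) ω).X - (Y k ω).X) ^ 2 ∂P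
      + lam ^ 2 * (n * σ ^ 2) := by
  set U : Ω → Rows n d := fun ω i => (1 - lam) • ((Y k ω).M i - gradient (f i) ((Y (k + 1) ω).X i))
    with hUdef
  have hUm : ∀ i, Measurable[before ξ (k + 1)] fun ω => U ω i := fun i =>
    measurable_fun_smul ((h.measurable_M k i).sub (h.measurable_gradient (k + 1) i)) (1 - lam)
  have hU : ∀ i, MemLp (fun ω => U ω i) 2 P := fun i =>
    memLp_fun_smul (memLp_fun_sub (h.memLp_M k i) (h.memLp_gradient (k + 1) i)) (1 - lam)
  have h1 : ∀ ω, (fun i => (Y (k + 1) ω).M i - gradient (f i) ((Y (k + 1) ω).X i))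
      = fun i => U ω i + lam • noise f g ξ Y i (k + 1) ω := by
    intro ω
    funext i
    simp only [h.M_succ, hUdef]
    module
  have h2 := h.integral_frobNorm_add_noise_sq_le (k + 1) hUm hU lam
  have h3 : ∀ ω, frobNorm (U ω) ^ 2 ≤ (1 - lam) * momentumSq f Y k ω
      + L ^ 2 / lam * frobNorm ((Y (k + 1) ω).X - (Y k ω).X) ^ 2 := by
    intro ω
    simp only [momentumSq, frobNorm_sq, Finset.mul_sum, ← Finset.sum_add_distrib]
    refine Finset.sum_le_sum fun i _ => ?_
    set a := (Y k ω).M i - gradient (f i) ((Y k ω).X i) with ha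
    set b := gradient (f i) ((Y (k + 1) ω).X i) - gradient (f i) ((Y k ω).X i) with hb
    have h4 : ‖U ω i‖ ≤ (1 - lam) * ‖a‖ + ‖b‖ := by
      have h5 : U ω i = (1 - lam) • (a - b) := by simp only [hUdef, ha, hb]; module
      rw [h5, norm_smul, Real.norm_of_nonneg (by linarith)]
      have h6 := mul_le_mul_of_nonneg_left (norm_sub_le a b) (show 0 ≤ 1 - lam by linarith)
      have h7 : 0 ≤ lam * ‖b‖ := by positivity
      linarith
    have h5 := sq_le_of_le_contraction_add (by linarith) (by linarith) (norm_nonneg _) h4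
    rw [sub_sub_cancel] at h5
    have h6 : ‖b‖ ^ 2 / lam ≤ L ^ 2 * ‖((Y (k + 1) ω).X - (Y k ω).X) i‖ ^ 2 / lam := by
      gcongr
      exact h.norm_gradient_increment_sq_le k ω i
    refine h5.trans ((add_le_add_right h6 _).trans_eq ?_)
    ring
  have i1 := (h.integrable_momentumSq k).const_mul (1 - lam)
  have i2 := (h.integrable_increment k).const_mul (L ^ 2 / lam)
  have h4 : ∫ ω, frobNorm (U ω) ^ 2 ∂P ≤ ∫ ω, ((1 - lam) * momentumSq f Y k ω
      + L ^ 2 / lam * frobNorm ((Y (k + 1) ω).X - (Y k ω).X) ^ 2) ∂P :=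
    integral_mono (integrable_frobNorm_sq hU) (i1.add i2) h3
  rw [integral_add i1 i2, integral_const_mul, integral_const_mul] at h4
  have h5 : ∫ ω, momentumSq f Y (k + 1) ω ∂P
      = ∫ ω, frobNorm (fun i => U ω i + lam • noise f g ξ Y i (k + 1) ω) ^ 2 ∂P := by
    simp only [momentumSq, h1]
  linarith

/-- A convex combination of m̄_k and the averaged gradient, plus the average noise. The bound starts
at m̄_1, since m̄_0 = 0 is an initial value and not produced by the recursion. -/
lemma integral_mbarPrev_sq_le (h : IsRun P R C η lam L σ D f g ξ x₀ Y) (hn : 0 < n)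
    (hl : 0 < lam) (hl1 : lam < 1) (k : ℕ) :
    ∫ ω, ‖mbarPrev Y (k + 2) ω‖ ^ 2 ∂P ≤ (1 - lam) * ∫ ω, ‖mbarPrev Y (k + 1) ω‖ ^ 2 ∂P
      + lam * ∫ ω, ‖hbar f Y (k + 1) ω‖ ^ 2 ∂P + lam ^ 2 * (σ ^ 2 / n) := by
  have hUm : Measurable[before ξ (k + 1)] fun ω => (1 - lam) • mbarPrev Y (k + 1) ω
      + lam • hbar f Y (k + 1) ω :=
    (measurable_fun_smul (h.measurable_mbarPrev (k + 1)) _).add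
      (measurable_fun_smul (h.measurable_hbar (k + 1)) _)
  have hU : MemLp (fun ω => (1 - lam) • mbarPrev Y (k + 1) ω + lam • hbar f Y (k + 1) ω) 2 P :=
    memLp_fun_add (memLp_fun_smul (h.memLp_mbarPrev (k + 1)) _)
      (memLp_fun_smul (h.memLp_hbar (k + 1)) _)
  have h1 := h.integral_norm_add_avg_noise_sq_le hn (k + 1) hUm hU lam
  simp only [← h.mbarPrev_succ] at h1
  have h2 : ∀ ω, ‖(1 - lam) • mbarPrev Y (k + 1) ω + lam • hbar f Y (k + 1) ω‖ ^ 2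
      ≤ (1 - lam) * ‖mbarPrev Y (k + 1) ω‖ ^ 2 + lam * ‖hbar f Y (k + 1) ω‖ ^ 2 := by
    intro ω
    have h3 : ‖(1 - lam) • mbarPrev Y (k + 1) ω + lam • hbar f Y (k + 1) ω‖
        ≤ (1 - lam) * ‖mbarPrev Y (k + 1) ω‖ + lam * ‖hbar f Y (k + 1) ω‖ := by
      refine (norm_add_le _ _).trans_eq ?_
      rw [norm_smul, norm_smul, Real.norm_of_nonneg hl.le, Real.norm_of_nonneg (by linarith)]
    have h4 := sq_le_of_le_contraction_add (by linarith) (by linarith) (norm_nonneg _) h3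
    refine h4.trans_eq ?_
    rw [sub_sub_cancel]
    field_simp
  have i1 := (integrable_norm_sq (h.memLp_mbarPrev (k + 1))).const_mul (1 - lam)
  have i2 := (integrable_norm_sq (h.memLp_hbar (k + 1))).const_mul lam
  have h3 : ∫ ω, ‖(1 - lam) • mbarPrev Y (k + 1) ω + lam • hbar f Y (k + 1) ω‖ ^ 2 ∂P
      ≤ ∫ ω, ((1 - lam) * ‖mbarPrev Y (k + 1) ω‖ ^ 2 + lam * ‖hbar f Y (k + 1) ω‖ ^ 2) ∂P :=
    integral_mono (integrable_norm_sq hU) (i1.add i2) h2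
  rw [integral_add i1 i2, integral_const_mul, integral_const_mul] at h3
  linarith

end Probability

end IsRun

/-! ### Descent along the virtual sequence -/

/-- `π_Rᵀ (V_k - Π_C V_k)`. -/
def trackBias {n d : ℕ} {Ω : Type*} (πR πC : Fin n → ℝ) (Y : ℕ → Ω → State n d) (k : ℕ) (ω : Ω) :
    Vec d := ∑ i, πR i • ((Y k ω).V - act (projC πC) (Y k ω).V) i

lemma norm_trackBias_sq_le {n d : ℕ} {Ω : Type*} {R C SC : Matrix (Fin n) (Fin n) ℝ}
    {πR πC : Fin n → ℝ} {ρC δC : ℝ} (hπR : IsStationary Rᵀ πR)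
    (hSC : IsMixingNorm C (projC πC) SC ρC δC) (Y : ℕ → Ω → State n d) (k : ℕ) (ω : Ω) :
    ‖trackBias πR πC Y k ω‖ ^ 2 ≤ trackingSq πC SC Y k ω := by
  set W := (Y k ω).V - act (projC πC) (Y k ω).V with hW
  calc ‖trackBias πR πC Y k ω‖ ^ 2 ≤ (∑ i, πR i ^ 2) * ∑ i, ‖W i‖ ^ 2 :=
        norm_sum_smul_sq_le _ _ _
    _ ≤ 1 * frobNorm W ^ 2 := by
        rw [frobNorm_sq]
        exact mul_le_mul_of_nonneg_right hπR.sum_sq_le_one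
          (Finset.sum_nonneg fun _ _ => sq_nonneg _)
    _ ≤ trackingSq πC SC Y k ω := by
        rw [one_mul]
        unfold trackingSq
        have := frobNorm_nonneg W
        gcongr
        exact hSC.frob_le _ _

namespace IsRun

variable {n d : ℕ} {Ω : Type*} [MeasurableSpace Ω] {P : Measure Ω}
  {Ξ : Fin n → Type*} [∀ i, MeasurableSpace (Ξ i)] {R C : Matrix (Fin n) (Fin n) ℝ}
  {η lam L σ : ℝ} {D : ∀ i, Measure (Ξ i)} {f : Fin n → Vec d → ℝ}
  {g : ∀ i, Vec d → Ξ i → Vec d} {ξ : ∀ i, ℕ → Ω → Ξ i} {x₀ : Vec d} {Y : ℕ → Ω → State n d}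
  {πR πC : Fin n → ℝ} {SR SC : Matrix (Fin n) (Fin n) ℝ} {ρR ρC δR δC : ℝ}

lemma xbar_succ (h : IsRun P R C η lam L σ D f g ξ x₀ Y)
    (hC : C ∈ Matrix.colStochastic ℝ (Fin n)) (hn : 0 < n) (hπR : IsStationary Rᵀ πR)
    (k : ℕ) (ω : Ω) :
    xbar πR Y (k + 1) ω = xbar πR Y k ω
      - η • (trackBias πR πC Y k ω + cPi πR πC • mbarPrev Y (k + 1) ω) := by
  have h1 : ∀ Z : Rows n d, ∑ i, πR i • act R Z i = ∑ i, πR i • Z i := by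
    intro Z
    have h2 : ∀ i, act (projR πR * R) Z i = act (projR πR) Z i := fun i => by rw [hπR.projR_mul]
    -- All rows of Π_R Z equal π_Rᵀ Z, so any row will do.
    have h3 := h2 ⟨0, hn⟩
    rwa [mul_act, act_projR_apply, act_projR_apply] at h3
  have h2 : cPi πR πC • mbarPrev Y (k + 1) ω = ∑ i, πR i • act (projC πC) (Y k ω).V i := by
    simp only [h.act_projC_V hC hn, smul_smul, ← Finset.sum_smul]
    congr 1
    rw [cPi, dotProduct, Finset.mul_sum]
    exact Finset.sum_congr rfl fun i _ => by ring
  rw [h2, trackBias, ← Finset.sum_add_distrib]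
  simp only [← smul_add, Pi.sub_apply, sub_add_cancel]
  rw [xbar, h.X_succ, h1, xbar, Finset.smul_sum, ← Finset.sum_sub_distrib]
  refine Finset.sum_congr rfl fun i _ => ?_
  simp only [Pi.sub_apply, Pi.smul_apply]
  module

/-- The momentum enters as (ηc_π/λ)(m̄_{k+1} - (1 - λ)m̄_k), and this difference is λ times the
fresh averaged stochastic gradient. -/
lemma ztilde_succ (h : IsRun P R C η lam L σ D f g ξ x₀ Y)
    (hC : C ∈ Matrix.colStochastic ℝ (Fin n)) (hn : 0 < n) (hπR : IsStationary Rᵀ πR)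
    (hl : 0 < lam) (k : ℕ) (ω : Ω) :
    ztilde πR πC η lam Y (k + 2) ω - ztilde πR πC η lam Y (k + 1) ω
      = -((η * cPi πR πC) • (hbar f Y (k + 1) ω
          + (1 * (1 / (n : ℝ))) • ∑ i, noise f g ξ Y i (k + 1) ω)
        + η • trackBias πR πC Y (k + 1) ω) := by
  rw [ztilde, ztilde, h.xbar_succ hC hn hπR (k + 1) ω, h.mbarPrev_succ k ω]
  set c := cPi πR πC
  set N := ∑ i, noise f g ξ Y i (k + 1) ω
  match_scalars
  all_goals first | ring1 | (field_simp; ring)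

/-- The models do not move in the first iteration. -/
lemma X_one (h : IsRun P R C η lam L σ D f g ξ x₀ Y)
    (hR : R ∈ Matrix.rowStochastic ℝ (Fin n)) (ω : Ω) : (Y 1 ω).X = (Y 0 ω).X := by
  rw [h.X_succ, h.V_zero, h.X_zero]
  funext i
  simp [act_apply, ← Finset.sum_smul, Matrix.sum_row_of_mem_rowStochastic hR]

lemma norm_gradient_sub_hbar_sq_le (h : IsRun P R C η lam L σ D f g ξ x₀ Y) (hn : 0 < n)
    (hSR : IsMixingNorm R (projR πR) SR ρR δR) (k : ℕ) (ω : Ω) :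
    ‖gradient (globalLoss f) (xbar πR Y k ω) - hbar f Y k ω‖ ^ 2
      ≤ L ^ 2 * consensusSq πR SR Y k ω := by
  have hn1 : (1 : ℝ) ≤ n := Nat.one_le_cast.2 hn
  set W := (Y k ω).X - act (projR πR) (Y k ω).X with hW
  rw [gradient_globalLoss fun i => (h.loss i).differentiable, hbar, ← smul_sub,
    ← Finset.sum_sub_distrib]
  refine (norm_avg_sq_le _).trans ?_
  calc 1 / (n : ℝ) * ∑ i, ‖gradient (f i) (xbar πR Y k ω) - gradient (f i) ((Y k ω).X i)‖ ^ 2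
      ≤ 1 * ∑ i, L ^ 2 * ‖W i‖ ^ 2 := by
        gcongr with i
        · exact div_le_one_of_le₀ hn1 (by linarith)
        · rw [← mul_pow]
          gcongr
          refine ((h.loss i).lipschitz_gradient _ _).trans_eq ?_
          rw [norm_sub_rev, hW, Pi.sub_apply, act_projR_apply, xbar]
    _ = L ^ 2 * frobNorm W ^ 2 := by rw [one_mul, frobNorm_sq, Finset.mul_sum]
    _ ≤ _ := by
        unfold consensusSq
        have := frobNorm_nonneg W
        gcongr
        exact hSR.frob_le _ _

lemma lipschitz_gradient_globalLoss (h : IsRun P R C η lam L σ D f g ξ x₀ Y) (hn : 0 < n)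
    (x y : Vec d) : ‖gradient (globalLoss f) x - gradient (globalLoss f) y‖ ≤ L * ‖x - y‖ :=
  SMTPP.lipschitz_gradient_globalLoss hn (fun i => (h.loss i).differentiable)
    (fun i => (h.loss i).lipschitz_gradient) x y

lemma norm_gradient_ztilde_sub_sq_le (h : IsRun P R C η lam L σ D f g ξ x₀ Y) (hn : 0 < n)
    (hl : 0 < lam) (hl1 : lam < 1) (k : ℕ) (ω : Ω) :
    ‖gradient (globalLoss f) (ztilde πR πC η lam Y k ω)
        - gradient (globalLoss f) (xbar πR Y k ω)‖ ^ 2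
      ≤ L ^ 2 * ((η * cPi πR πC / lam) ^ 2 * ‖mbarPrev Y k ω‖ ^ 2) := by
  calc _ ≤ (L * ‖ztilde πR πC η lam Y k ω - xbar πR Y k ω‖) ^ 2 := by
        gcongr; exact h.lipschitz_gradient_globalLoss hn _ _
    _ = L ^ 2 * ((η * cPi πR πC / lam) ^ 2 * (1 - lam) ^ 2 * ‖mbarPrev Y k ω‖ ^ 2) := by
        rw [ztilde, sub_sub_cancel_left, norm_neg, norm_smul, mul_pow, mul_pow, Real.norm_eq_abs,
          sq_abs]
        ring
    _ ≤ _ := by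
        gcongr
        refine mul_le_of_le_one_right (by positivity) (pow_le_one₀ ?_ ?_) <;> linarith

section Probability

variable [IsProbabilityMeasure P]

lemma integrable_globalLoss_comp (h : IsRun P R C η lam L σ D f g ξ x₀ Y) (hn : 0 < n)
    (hL : 0 ≤ L) {U : Ω → Vec d} (hU : MemLp U 2 P) :
    Integrable (fun ω => globalLoss f (U ω)) P := by
  have hd := differentiable_globalLoss fun i => (h.loss i).differentiable
  refine Integrable.mono' (g := fun ω => (|globalLoss f 0| + ‖gradient (globalLoss f) 0‖ ^ 2)
    + (1 + 2 * L + L ^ 2) * ‖U ω‖ ^ 2)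
    ((integrable_const _).add ((integrable_norm_sq hU).const_mul _))
    (hd.continuous.comp_aestronglyMeasurable hU.1) (Filter.Eventually.of_forall fun ω => ?_)
  exact abs_le_of_lipschitz_gradient hd hL (h.lipschitz_gradient_globalLoss hn) (U ω)

lemma memLp_gradient_globalLoss_comp (h : IsRun P R C η lam L σ D f g ξ x₀ Y)
    {U : Ω → Vec d} (hU : MemLp U 2 P) :
    MemLp (fun ω => gradient (globalLoss f) (U ω)) 2 P := by
  simp only [gradient_globalLoss fun i => (h.loss i).differentiable]
  exact memLp_fun_smul (memLp_finsetSum _ fun i _ => (h.loss i).memLp_gradient hU) _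

lemma integral_inner_avg_noise (h : IsRun P R C η lam L σ D f g ξ x₀ Y) (k : ℕ)
    {U : Ω → Vec d} (hUm : Measurable[before ξ k] U) (hU : MemLp U 2 P) (c : ℝ) :
    ∫ ω, inner ℝ (U ω) (c • ∑ i, noise f g ξ Y i k ω) ∂P = 0 := by
  simp only [real_inner_smul_right, inner_sum]
  rw [integral_const_mul, integral_finsetSum _ fun i _ =>
    integrable_inner_of_memLp hU (h.noise_memLp_and_variance_le i k).1]
  simp [h.integral_inner_noise _ k (hUm.mono (before_le_others _ k) le_rfl) hU]

lemma integral_globalLoss_succ_le (h : IsRun P R C η lam L σ D f g ξ x₀ Y)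
    (hC : C ∈ Matrix.colStochastic ℝ (Fin n)) (hn : 0 < n) (hπR : IsStationary Rᵀ πR)
    (hc : 0 < cPi πR πC) (hSR : IsMixingNorm R (projR πR) SR ρR δR)
    (hSC : IsMixingNorm C (projC πC) SC ρC δC) (hL : 0 ≤ L)
    (hl : 0 < lam) (hl1 : lam < 1) (hη : 0 < η) (k : ℕ) :
    ∫ ω, globalLoss f (ztilde πR πC η lam Y (k + 2) ω) ∂P
      ≤ ∫ ω, globalLoss f (ztilde πR πC η lam Y (k + 1) ω) ∂P
        - 3 / 16 * (η * cPi πR πC)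
          * ∫ ω, ‖gradient (globalLoss f) (xbar πR Y (k + 1) ω)‖ ^ 2 ∂P
        + 2 * (η * cPi πR πC) * (L ^ 2 * (η * cPi πR πC / lam) ^ 2)
          * ∫ ω, ‖mbarPrev Y (k + 1) ω‖ ^ 2 ∂P
        + η * cPi πR πC * L ^ 2 * ∫ ω, consensusSq πR SR Y (k + 1) ω ∂P
        - η * cPi πR πC / 2 * ∫ ω, ‖hbar f Y (k + 1) ω‖ ^ 2 ∂P
        + (2 * η / cPi πR πC + L * η ^ 2) * ∫ ω, trackingSq πC SC Y (k + 1) ω ∂P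
        + L * η ^ 2 * cPi πR πC ^ 2 * (∫ ω, ‖hbar f Y (k + 1) ω‖ ^ 2 ∂P + σ ^ 2 / n) := by
  set c := cPi πR πC with hcdef
  set z : ℕ → Ω → Vec d := ztilde πR πC η lam Y with hz
  set N : Ω → Vec d := fun ω => (1 * (1 / (n : ℝ))) • ∑ i, noise f g ξ Y i (k + 1) ω with hN
  set a : Ω → Vec d := fun ω => gradient (globalLoss f) (z (k + 1) ω) with ha
  have hd := differentiable_globalLoss fun i => (h.loss i).differentiable
  have hzL : MemLp (z (k + 1)) 2 P := h.memLp_ztilde πR πC (k + 1)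
  have haL : MemLp a 2 P := h.memLp_gradient_globalLoss_comp hzL
  have ham : Measurable[before ξ (k + 1)] a :=
    (continuous_of_lipschitz_norm (h.lipschitz_gradient_globalLoss hn)).measurable.comp
      (h.measurable_ztilde πR πC (k + 1))
  have hNL : MemLp N 2 P :=
    memLp_fun_smul (memLp_finsetSum _ fun i _ => (h.noise_memLp_and_variance_le i (k + 1)).1) _
  -- The inner product with the noise is kept as a separate term, since it vanishes only in
  -- expectation; its square stays within ‖h̄ + N‖².
  have hpt : ∀ ω, globalLoss f (z (k + 2) ω) ≤ globalLoss f (z (k + 1) ω)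
      + -(η * c) * inner ℝ (a ω) (N ω)
      + -(3 / 16 * (η * c)) * ‖gradient (globalLoss f) (xbar πR Y (k + 1) ω)‖ ^ 2
      + 2 * (η * c) * (L ^ 2 * (η * c / lam) ^ 2) * ‖mbarPrev Y (k + 1) ω‖ ^ 2
      + η * c * L ^ 2 * consensusSq πR SR Y (k + 1) ω
      + -(η * c / 2) * ‖hbar f Y (k + 1) ω‖ ^ 2
      + (2 * η / c + L * η ^ 2) * trackingSq πC SC Y (k + 1) ω
      + L * η ^ 2 * c ^ 2 * ‖hbar f Y (k + 1) ω + N ω‖ ^ 2 := by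
    intro ω
    have h1 := le_add_inner_gradient_add_sq hd (h.lipschitz_gradient_globalLoss hn)
      (z (k + 1) ω) (z (k + 2) ω)
    rw [hz, h.ztilde_succ hC hn hπR hl k ω, norm_neg, inner_neg_right, inner_add_right,
      real_inner_smul_right, real_inner_smul_right, inner_add_right] at h1
    have h2 := descent_inner_bound hη hc hL (a ω) (hbar f Y (k + 1) ω)
      (gradient (globalLoss f) (xbar πR Y (k + 1) ω)) (trackBias πR πC Y (k + 1) ω)
      (hbar f Y (k + 1) ω + N ω)
    have h3 := mul_le_mul_of_nonneg_left
      (h.norm_gradient_ztilde_sub_sq_le (πR := πR) (πC := πC) hn hl hl1 (k + 1) ω)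
      (show 0 ≤ 2 * (η * c) by positivity)
    have h4 := mul_le_mul_of_nonneg_left (h.norm_gradient_sub_hbar_sq_le hn hSR (k + 1) ω)
      (show 0 ≤ η * c by positivity)
    have h5 := mul_le_mul_of_nonneg_left (norm_trackBias_sq_le hπR hSC Y (k + 1) ω)
      (show 0 ≤ 2 * η / c + L * η ^ 2 by positivity)
    simp only [ha, hN, hz] at h2 ⊢
    linarith
  have j0 := h.integrable_globalLoss_comp hn hL hzL
  have j1 := (integrable_inner_of_memLp haL hNL).const_mul (-(η * c))
  have j2 := (integrable_norm_sq (h.memLp_gradient_globalLoss_comp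
    (h.memLp_xbar πR (k + 1)))).const_mul (-(3 / 16 * (η * c)))
  have j3 := (integrable_norm_sq (h.memLp_mbarPrev (k + 1))).const_mul
    (2 * (η * c) * (L ^ 2 * (η * c / lam) ^ 2))
  have j4 := (h.integrable_consensusSq (πR := πR) (SR := SR) (k + 1)).const_mul (η * c * L ^ 2)
  have j5 := (integrable_norm_sq (h.memLp_hbar (k + 1))).const_mul (-(η * c / 2))
  have j6 := (h.integrable_trackingSq (πC := πC) (SC := SC) (k + 1)).const_mul
    (2 * η / c + L * η ^ 2)
  have j7 := (integrable_norm_sq (memLp_fun_add (h.memLp_hbar (k + 1)) hNL)).const_mul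
    (L * η ^ 2 * c ^ 2)
  have hint := integral_mono (h.integrable_globalLoss_comp hn hL (h.memLp_ztilde πR πC (k + 2)))
    (((((((j0.add j1).add j2).add j3).add j4).add j5).add j6).add j7) hpt
  simp only [Pi.add_apply] at hint
  rw [integral_add (by exact ((((((j0.add j1).add j2).add j3).add j4).add j5).add j6)) j7,
    integral_add (by exact (((((j0.add j1).add j2).add j3).add j4).add j5)) j6,
    integral_add (by exact ((((j0.add j1).add j2).add j3).add j4)) j5,
    integral_add (by exact (((j0.add j1).add j2).add j3)) j4,
    integral_add (by exact ((j0.add j1).add j2)) j3,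
    integral_add (by exact (j0.add j1)) j2, integral_add j0 j1] at hint
  simp only [integral_const_mul] at hint
  rw [h.integral_inner_avg_noise (k + 1) ham haL] at hint
  have hG := h.integral_norm_add_avg_noise_sq_le hn (k + 1) (h.measurable_hbar (k + 1))
    (h.memLp_hbar (k + 1)) 1
  have hG' := mul_le_mul_of_nonneg_left hG (show 0 ≤ L * η ^ 2 * c ^ 2 by positivity)
  simp only [one_pow] at hG'
  linarith

end Probability

end IsRun

/-! ### The Lyapunov function along a run -/

section Constants

variable {n : ℕ} (R : Matrix (Fin n) (Fin n) ℝ) (πR πC : Fin n → ℝ) (L ρR ρC δR δC t lam : ℝ)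

/-- The combined gain from the errors to the increments of the models and on to the tracking and
momentum errors. -/
def feedbackGain : ℝ :=
  L ^ 2 * (2 * trackWeight ρC (cPi πR πC) * trackGain ρC δC (cProj πC)
    + momWeight ρC δC (cPi πR πC) (cProj πC)) * incrementGain R

/-- The Lyapunov weights for the step size `η = t λ`. -/
def weights : Fin 4 → ℝ :=
  ![1, trackWeight ρC (cPi πR πC) * (t * lam),
    momWeight ρC δC (cPi πR πC) (cProj πC) * (t * lam),
    consensusGain πR ρR δR * t ^ 2 * lam + feedbackGain R πR πC L ρC δC * t ^ 3 * lam
      + 2 * L ^ 2 * cPi πR πC ^ 3 * t ^ 3]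

/-- The conditions on the ratio `t = η / λ` under which the Lyapunov function descends. -/
structure IsSmallRatio : Prop where
  le_one : t ≤ 1
  consensus : t * (feedbackGain R πR πC L ρC δC + cPi πR πC * L ^ 2) ≤ 1 - ρR
  tracking : t * (consensusGain πR ρR δR + L + feedbackGain R πR πC L ρC δC) ≤ 2 / cPi πR πC
  average : t * (2 * consensusGain πR ρR δR + 2 * feedbackGain R πR πC L ρC δC
    + 2 * L ^ 2 * cPi πR πC ^ 3 + L * cPi πR πC ^ 2) ≤ cPi πR πC / 2

variable {R πR πC L ρR ρC δR δC t lam}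

lemma exists_threshold {B G : ℝ} (hB : 0 < B) (hG : 0 ≤ G) :
    ∃ c₀, 0 < c₀ ∧ ∀ t, 0 ≤ t → t ≤ c₀ → t * G ≤ B := by
  refine ⟨B / (G + 1), by positivity, fun t ht htc => ?_⟩
  rw [le_div_iff₀ (by positivity)] at htc
  linarith

lemma incrementGain_nonneg (R : Matrix (Fin n) (Fin n) ℝ) : 0 ≤ incrementGain R := by
  have := sumSq_nonneg R
  have := sumSq_nonneg (R - 1)
  unfold incrementGain
  positivity

lemma cProj_nonneg (πC : Fin n → ℝ) : 0 ≤ cProj πC := sq_nonneg _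

lemma trackGain_nonneg (hρ : ρC < 1) : 0 ≤ trackGain ρC δC (cProj πC) :=
  div_nonneg (mul_nonneg (sq_nonneg _) (cProj_nonneg _)) (by linarith)

lemma trackWeight_pos (hρ : ρC < 1) {c : ℝ} (hc : 0 < c) : 0 < trackWeight ρC c :=
  div_pos four_pos (mul_pos hc (by linarith))

lemma momWeight_pos (hρ : ρC < 1) {c : ℝ} (hc : 0 < c) :
    0 < momWeight ρC δC c (cProj πC) := by
  have := trackGain_nonneg (δC := δC) (πC := πC) hρ
  have := trackWeight_pos hρ hc
  unfold momWeight
  positivity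

/-- The summand 1 in the gain keeps p₄ strictly positive also in the degenerate cases such as L = 0
and n = 1. -/
lemma one_le_consensusGain (hρ : ρR < 1) : 1 ≤ consensusGain πR ρR δR := by
  have := sumSq_nonneg (1 - projR πR)
  have : 0 < 1 - ρR := by linarith
  unfold consensusGain
  have : 0 ≤ δR ^ 2 * sumSq (1 - projR πR) * (2 * (n : ℝ) ^ 2) / (1 - ρR) := by positivity
  linarith

lemma feedbackGain_nonneg (hρ : ρC < 1) (hc : 0 < cPi πR πC) :
    0 ≤ feedbackGain R πR πC L ρC δC := by
  have := trackGain_nonneg (δC := δC) (πC := πC) hρ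
  have := trackWeight_pos hρ hc
  have := momWeight_pos (δC := δC) (πC := πC) hρ hc
  have := incrementGain_nonneg R
  unfold feedbackGain
  positivity

lemma exists_isSmallRatio (hρR : ρR < 1) (hρC : ρC < 1) (hc : 0 < cPi πR πC) (hL : 0 ≤ L) :
    ∃ c₀, 0 < c₀ ∧ ∀ t, 0 ≤ t → t ≤ c₀ → IsSmallRatio R πR πC L ρR ρC δR δC t := by
  have hg := feedbackGain_nonneg (R := R) (L := L) (δC := δC) hρC hc
  have ha : 0 ≤ consensusGain πR ρR δR := zero_le_one.trans (one_le_consensusGain hρR)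
  obtain ⟨c₁, h₁, H₁⟩ := exists_threshold (sub_pos.2 hρR)
    (show 0 ≤ feedbackGain R πR πC L ρC δC + cPi πR πC * L ^ 2 by positivity)
  obtain ⟨c₂, h₂, H₂⟩ := exists_threshold (div_pos two_pos hc)
    (show 0 ≤ consensusGain πR ρR δR + L + feedbackGain R πR πC L ρC δC by positivity)
  obtain ⟨c₃, h₃, H₃⟩ := exists_threshold (half_pos hc)
    (show 0 ≤ 2 * consensusGain πR ρR δR + 2 * feedbackGain R πR πC L ρC δC
      + 2 * L ^ 2 * cPi πR πC ^ 3 + L * cPi πR πC ^ 2 by positivity)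
  refine ⟨min 1 (min c₁ (min c₂ c₃)), by positivity, fun t ht htc => ?_⟩
  simp only [le_min_iff] at htc
  exact ⟨htc.1, H₁ t ht htc.2.1, H₂ t ht htc.2.2.1, H₃ t ht htc.2.2.2⟩

lemma weights_pos (hρR : ρR < 1) (hρC : ρC < 1) (hc : 0 < cPi πR πC) (ht : 0 < t)
    (hl : 0 < lam) (l : Fin 4) : 0 < weights R πR πC L ρR ρC δR δC t lam l := by
  have hg := feedbackGain_nonneg (R := R) (L := L) (δC := δC) hρC hc
  have ha : 0 < consensusGain πR ρR δR := zero_lt_one.trans_le (one_le_consensusGain hρR)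
  have hα := trackWeight_pos hρC hc
  have hβ := momWeight_pos (δC := δC) (πC := πC) hρC hc
  fin_cases l
  · exact one_pos
  · exact mul_pos hα (mul_pos ht hl)
  · exact mul_pos hβ (mul_pos ht hl)
  · show 0 < consensusGain πR ρR δR * t ^ 2 * lam + feedbackGain R πR πC L ρC δC * t ^ 3 * lam
      + 2 * L ^ 2 * cPi πR πC ^ 3 * t ^ 3
    positivity

lemma exists_weights_bound (hρR : ρR < 1) (hρC : ρC < 1) (hc : 0 < cPi πR πC) :
    ∃ B, ∀ t lam, 0 < t → 0 < lam → lam < 1 →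
      weights R πR πC L ρR ρC δR δC t lam 1 ≤ B * (t * lam) ∧
      weights R πR πC L ρR ρC δR δC t lam 2 ≤ B * (t * lam) ∧
      weights R πR πC L ρR ρC δR δC t lam 3
        ≤ B * ((t * lam) ^ 2 / lam + (t * lam) ^ 3 / lam ^ 3) := by
  have hg := feedbackGain_nonneg (R := R) (L := L) (δC := δC) hρC hc
  have ha : 0 ≤ consensusGain πR ρR δR := zero_le_one.trans (one_le_consensusGain hρR)
  have hα := trackWeight_pos hρC hc
  have hβ := momWeight_pos (δC := δC) (πC := πC) hρC hc
  have he : 0 ≤ 2 * L ^ 2 * cPi πR πC ^ 3 := by positivity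
  refine ⟨trackWeight ρC (cPi πR πC) + momWeight ρC δC (cPi πR πC) (cProj πC)
    + consensusGain πR ρR δR + feedbackGain R πR πC L ρC δC + 2 * L ^ 2 * cPi πR πC ^ 3,
    fun t lam ht hl hl1 => ⟨?_, ?_, ?_⟩⟩
  · show trackWeight ρC (cPi πR πC) * (t * lam) ≤ _
    gcongr
    linarith
  · show momWeight ρC δC (cPi πR πC) (cProj πC) * (t * lam) ≤ _
    gcongr
    linarith
  · show consensusGain πR ρR δR * t ^ 2 * lam + feedbackGain R πR πC L ρC δC * t ^ 3 * lam
      + 2 * L ^ 2 * cPi πR πC ^ 3 * t ^ 3 ≤ _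
    have h1 : (t * lam) ^ 2 / lam + (t * lam) ^ 3 / lam ^ 3 = t ^ 2 * lam + t ^ 3 := by
      field_simp
    rw [h1]
    have h2 : feedbackGain R πR πC L ρC δC * t ^ 3 * lam
        ≤ feedbackGain R πR πC L ρC δC * t ^ 3 :=
      mul_le_of_le_one_right (by positivity) hl1.le
    have h3 : 0 ≤ (trackWeight ρC (cPi πR πC) + momWeight ρC δC (cPi πR πC) (cProj πC))
        * (t ^ 2 * lam + t ^ 3) := by positivity
    have h4 : 0 ≤ consensusGain πR ρR δR * t ^ 3 := by positivity
    have h5 : 0 ≤ (feedbackGain R πR πC L ρC δC + 2 * L ^ 2 * cPi πR πC ^ 3)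
        * (t ^ 2 * lam) := by positivity
    linarith

end Constants

namespace IsRun

variable {n d : ℕ} {Ω : Type*} [MeasurableSpace Ω] {P : Measure Ω} [IsProbabilityMeasure P]
  {Ξ : Fin n → Type*} [∀ i, MeasurableSpace (Ξ i)] {R C : Matrix (Fin n) (Fin n) ℝ}
  {η lam L σ : ℝ} {D : ∀ i, Measure (Ξ i)} {f : Fin n → Vec d → ℝ}
  {g : ∀ i, Vec d → Ξ i → Vec d} {ξ : ∀ i, ℕ → Ω → Ξ i} {x₀ : Vec d} {Y : ℕ → Ω → State n d}
  {πR πC : Fin n → ℝ} {SR SC : Matrix (Fin n) (Fin n) ℝ} {ρR ρC δR δC t : ℝ}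

lemma lyapunov_weights_eq (h : IsRun P R C η lam L σ D f g ξ x₀ Y) (hn : 0 < n) (hL : 0 ≤ L)
    (k : ℕ) :
    lyapunov P πR πC SR SC η lam (weights R πR πC L ρR ρC δR δC t lam) f Y k
      = ∫ ω, globalLoss f (ztilde πR πC η lam Y k ω) ∂P - (⨅ x, globalLoss f x)
        + ∫ ω, consensusSq πR SR Y k ω ∂P
        + trackWeight ρC (cPi πR πC) * (t * lam) * ∫ ω, trackingSq πC SC Y k ω ∂P
        + momWeight ρC δC (cPi πR πC) (cProj πC) * (t * lam) * ∫ ω, momentumSq f Y k ω ∂P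
        + (consensusGain πR ρR δR * t ^ 2 * lam + feedbackGain R πR πC L ρC δC * t ^ 3 * lam
          + 2 * L ^ 2 * cPi πR πC ^ 3 * t ^ 3) * ∫ ω, ‖mbarPrev Y k ω‖ ^ 2 ∂P := by
  rw [lyapunov, integral_sub (h.integrable_globalLoss_comp hn hL (h.memLp_ztilde πR πC k))
    (integrable_const _), integral_const]
  simp [weights]

/-- The Lyapunov recursion, given a bound on the change of the loss at the virtual sequence. -/
lemma lyapunov_succ_le (h : IsRun P R C η lam L σ D f g ξ x₀ Y)
    (hR : R ∈ Matrix.rowStochastic ℝ (Fin n)) (hC : C ∈ Matrix.colStochastic ℝ (Fin n))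
    (hn : 0 < n) (hπR : IsStationary Rᵀ πR) (hπC : IsStationary C πC)
    (hc : 0 < cPi πR πC) (hSR : IsMixingNorm R (projR πR) SR ρR δR)
    (hSC : IsMixingNorm C (projC πC) SC ρC δC) (hL : 0 ≤ L)
    (hl : 0 < lam) (hl1 : lam < 1) (ht : 0 < t) (hη : η = t * lam)
    (hsmall : IsSmallRatio R πR πC L ρR ρC δR δC t) (k : ℕ) {q q' G H : ℝ} (hH : 0 ≤ H)
    (hq : q = ∫ ω, ‖mbarPrev Y k ω‖ ^ 2 ∂P)
    (hq' : q' = ∫ ω, ‖mbarPrev Y (k + 1) ω‖ ^ 2 ∂P)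
    (hmom : q' ≤ (1 - lam) * q + lam * H + lam ^ 2 * (σ ^ 2 / n))
    (hloss : ∫ ω, globalLoss f (ztilde πR πC η lam Y (k + 1) ω) ∂P
      ≤ ∫ ω, globalLoss f (ztilde πR πC η lam Y k ω) ∂P - 3 / 16 * (η * cPi πR πC) * G
        + 2 * (η * cPi πR πC) * (L ^ 2 * (η * cPi πR πC / lam) ^ 2) * q
        + η * cPi πR πC * L ^ 2 * ∫ ω, consensusSq πR SR Y k ω ∂P
        - η * cPi πR πC / 2 * H
        + (2 * η / cPi πR πC + L * η ^ 2) * ∫ ω, trackingSq πC SC Y k ω ∂P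
        + L * η ^ 2 * cPi πR πC ^ 2 * (H + σ ^ 2 / n)) :
    lyapunov P πR πC SR SC η lam (weights R πR πC L ρR ρC δR δC t lam) f Y (k + 1)
      ≤ lyapunov P πR πC SR SC η lam (weights R πR πC L ρR ρC δR δC t lam) f Y k
        - 3 / 16 * (η * cPi πR πC) * G
        + η * cPi πR πC * (floorConst L ρC δC (cPi πR πC) (cProj πC) / 16)
          * (η * σ ^ 2 / n + lam ^ 2 * σ ^ 2 * n) := by
  -- The quantities q, q', G, H are left abstract so that the first iteration can be treated with
  -- all four equal to 0.
  rw [h.lyapunov_weights_eq hn hL, h.lyapunov_weights_eq hn hL, ← hq, ← hq']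
  have hη0 : 0 ≤ η := by rw [hη]; positivity
  have hb := trackGain_nonneg (δC := δC) (πC := πC) hSC.rho_lt_one
  have I1 : ∫ ω, consensusSq πR SR Y (k + 1) ω ∂P ≤ ρR * ∫ ω, consensusSq πR SR Y k ω ∂P
      + consensusGain πR ρR δR * η ^ 2 * (∫ ω, trackingSq πC SC Y k ω ∂P + q') := by
    have i1 := (h.integrable_consensusSq (πR := πR) (SR := SR) k).const_mul ρR
    have i2 : Integrable (fun ω => trackingSq πC SC Y k ω + ‖mbarPrev Y (k + 1) ω‖ ^ 2) P :=
      (h.integrable_trackingSq k).add (integrable_norm_sq (h.memLp_mbarPrev (k + 1)))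
    have i3 := i2.const_mul (consensusGain πR ρR δR * η ^ 2)
    have := integral_mono (h.integrable_consensusSq (k + 1)) (i1.add i3)
      (h.consensusSq_succ_le hC hn hπR hπC hSR hSC k)
    simp only [Pi.add_apply] at this
    rwa [integral_add i1 i3, integral_const_mul, integral_const_mul,
      integral_add (h.integrable_trackingSq k) (integrable_norm_sq (h.memLp_mbarPrev (k + 1))),
      ← hq'] at this
  have I2 : ∫ ω, trackingSq πC SC Y (k + 1) ω ∂P ≤ ρC * ∫ ω, trackingSq πC SC Y k ω ∂P
      + trackGain ρC δC (cProj πC) * (lam ^ 2 * (n * σ ^ 2)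
        + 2 * lam ^ 2 * L ^ 2 * ∫ ω, frobNorm ((Y (k + 1) ω).X - (Y k ω).X) ^ 2 ∂P
        + 2 * lam ^ 2 * ∫ ω, momentumSq f Y k ω ∂P) := by
    have i1 := (h.integrable_trackingSq (πC := πC) (SC := SC) k).const_mul ρC
    have i2 : Integrable (fun ω => trackGain ρC δC (cProj πC)
        * frobNorm ((Y (k + 1) ω).M - (Y k ω).M) ^ 2) P :=
      (integrable_frobNorm_sq fun i =>
        memLp_fun_sub (h.memLp_M (k + 1) i) (h.memLp_M k i)).const_mul _
    have := integral_mono (h.integrable_trackingSq (k + 1)) (i1.add i2)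
      (h.trackingSq_succ_le hC hSC k)
    simp only [Pi.add_apply] at this
    rw [integral_add i1 i2, integral_const_mul, integral_const_mul] at this
    have h2 := mul_le_mul_of_nonneg_left (h.integral_momentum_increment_le k) hb
    linarith
  have I4 : ∫ ω, frobNorm ((Y (k + 1) ω).X - (Y k ω).X) ^ 2 ∂P
      ≤ incrementGain R * (∫ ω, consensusSq πR SR Y k ω ∂P
        + η ^ 2 * ∫ ω, trackingSq πC SC Y k ω ∂P + η ^ 2 * q') := by
    have i1 := h.integrable_consensusSq (πR := πR) (SR := SR) k
    have i2 := (h.integrable_trackingSq (πC := πC) (SC := SC) k).const_mul (η ^ 2)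
    have i3 := (integrable_norm_sq (h.memLp_mbarPrev (k + 1))).const_mul (η ^ 2)
    have i12 : Integrable (fun ω => consensusSq πR SR Y k ω + η ^ 2 * trackingSq πC SC Y k ω) P :=
      i1.add i2
    have := integral_mono (h.integrable_increment k)
      ((i12.add i3).const_mul (incrementGain R))
      (h.frobNorm_increment_sq_le hR hC hn hπC hSR hSC k)
    simp only [Pi.add_apply] at this
    rwa [integral_const_mul, integral_add i12 i3, integral_add i1 i2, integral_const_mul,
      integral_const_mul, ← hq'] at this
  have I3 := h.integral_momentumSq_succ_le hl hl1 k
  subst hη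
  have hr : t * lam * cPi πR πC / lam = t * cPi πR πC := by field_simp
  rw [hr] at hloss
  have hx0 : 0 ≤ ∫ ω, consensusSq πR SR Y k ω ∂P := integral_nonneg fun ω => sq_nonneg _
  have hv0 : 0 ≤ ∫ ω, trackingSq πC SC Y k ω ∂P := integral_nonneg fun ω => sq_nonneg _
  have hm0 : 0 ≤ ∫ ω, momentumSq f Y k ω ∂P := integral_nonneg fun ω => sq_nonneg _
  have hq0 : 0 ≤ q := by rw [hq]; exact integral_nonneg fun ω => sq_nonneg _
  have hD0 : 0 ≤ ∫ ω, frobNorm ((Y (k + 1) ω).X - (Y k ω).X) ^ 2 ∂P :=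
    integral_nonneg fun ω => sq_nonneg _
  -- `feedbackGain` unfolds to γ A, so the fields of `IsSmallRatio` are the conditions k1, k2, k3.
  have key := lyapunov_step (N := n) (s := σ ^ 2) hL hSC.rho_lt_one hc hb
    (zero_le_one.trans (one_le_consensusGain hSR.rho_lt_one)) (incrementGain_nonneg R) ht
    hsmall.le_one hl hl1 (Nat.one_le_cast.2 hn) (sq_nonneg σ)
    (α := trackWeight ρC (cPi πR πC)) rfl
    (β := momWeight ρC δC (cPi πR πC) (cProj πC)) rfl rfl
    hx0 hv0 hm0 hq0 hH hD0
    hsmall.consensus hsmall.tracking hsmall.average I1 I2 I3 I4 hmom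
    (F' := ∫ ω, globalLoss f (ztilde πR πC (t * lam) lam Y (k + 1) ω) ∂P)
    (F := ∫ ω, globalLoss f (ztilde πR πC (t * lam) lam Y k ω) ∂P) (gx := G)
    (by linarith)
  have hK : floorConst L ρC δC (cPi πR πC) (cProj πC) / 16 = 2 * L ^ 2 * cPi πR πC ^ 2
      + L * cPi πR πC + (trackWeight ρC (cPi πR πC) * trackGain ρC δC (cProj πC)
        + momWeight ρC δC (cPi πR πC) (cProj πC)) / cPi πR πC + 1 / 2 := by
    rw [floorConst]; ring
  rw [hK]
  unfold feedbackGain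
  linarith

/-- The convergence rate of a run. -/
theorem avg_norm_gradient_sq_le (h : IsRun P R C η lam L σ D f g ξ x₀ Y)
    (hR : R ∈ Matrix.rowStochastic ℝ (Fin n)) (hC : C ∈ Matrix.colStochastic ℝ (Fin n))
    (hn : 0 < n) (hπR : IsStationary Rᵀ πR) (hπC : IsStationary C πC)
    (hc : 0 < cPi πR πC) (hSR : IsMixingNorm R (projR πR) SR ρR δR)
    (hSC : IsMixingNorm C (projC πC) SC ρC δC) (hL : 0 ≤ L)
    (hl : 0 < lam) (hl1 : lam < 1) (ht : 0 < t) (hη : η = t * lam)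
    (hsmall : IsSmallRatio R πR πC L ρR ρC δR δC t) {T : ℕ} (hT : 2 ≤ T) :
    (1 / (T : ℝ)) * ∑ k ∈ Finset.range T,
        ∫ ω, ‖gradient (globalLoss f) (xbar πR Y k ω)‖ ^ 2 ∂P
      ≤ 16 * (lyapunov P πR πC SR SC η lam (weights R πR πC L ρR ρC δR δC t lam) f Y 0
          - lyapunov P πR πC SR SC η lam (weights R πR πC L ρR ρC δR δC t lam) f Y T)
          / (η * cPi πR πC * T)
        + floorConst L ρC δC (cPi πR πC) (cProj πC)
          * (η * σ ^ 2 / n + lam ^ 2 * σ ^ 2 * n) := by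
  have hη0 : 0 < η := by rw [hη]; positivity
  set V : ℕ → ℝ :=
    lyapunov P πR πC SR SC η lam (weights R πR πC L ρR ρC δR δC t lam) f Y with hV
  set G : ℕ → ℝ := fun k => ∫ ω, ‖gradient (globalLoss f) (xbar πR Y k ω)‖ ^ 2 ∂P with hG
  set K := floorConst L ρC δC (cPi πR πC) (cProj πC) with hK
  set ε : ℝ := η * σ ^ 2 / n + lam ^ 2 * σ ^ 2 * n with hε
  set e : ℝ := η * cPi πR πC with he
  have he0 : 0 < e := mul_pos hη0 hc
  have hG0 : ∀ k, 0 ≤ G k := fun k => integral_nonneg fun ω => sq_nonneg _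
  have hstep : ∀ k, V (k + 2) ≤ V (k + 1) - 3 / 16 * e * G (k + 1) + e * (K / 16) * ε :=
    fun k => h.lyapunov_succ_le hR hC hn hπR hπC hc hSR hSC hL hl hl1 ht hη hsmall (k + 1)
      (integral_nonneg fun ω => sq_nonneg ‖hbar f Y (k + 1) ω‖) rfl rfl
      (h.integral_mbarPrev_sq_le hn hl hl1 k)
      (h.integral_globalLoss_succ_le hC hn hπR hc hSR hSC hL hl hl1 hη0 k)
  have hm0 : ∀ ω, mbarPrev Y 0 ω = 0 := fun ω => rfl
  have hm1 : ∀ ω, mbarPrev Y (0 + 1) ω = 0 := fun ω => by simp [mbarPrev, h.M_zero]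
  have hxb : ∀ ω, xbar πR Y (0 + 1) ω = xbar πR Y 0 ω := fun ω => by
    simp only [xbar, zero_add, h.X_one hR]
  have hz1 : ∀ ω, ztilde πR πC η lam Y (0 + 1) ω = ztilde πR πC η lam Y 0 ω := fun ω => by
    simp only [ztilde, hxb, hm0, hm1]
  -- Since V_0 = 0 and M_0 = 0, neither the models nor z̃ move, so the loss is unchanged and the
  -- required inequalities hold with G = H = 0.
  have hfirst : V 1 ≤ V 0 + e * (K / 16) * ε := by
    have h1 := h.lyapunov_succ_le hR hC hn hπR hπC hc hSR hSC hL hl hl1 ht hη hsmall 0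
      (q := 0) (q' := 0) (G := 0) (H := 0) le_rfl (by simp [hm0]) (by simp [hm1])
      (by simp only [mul_zero, add_zero, zero_add]; positivity)
      (by
        simp only [hz1]
        have hx0 : 0 ≤ ∫ ω, consensusSq πR SR Y 0 ω ∂P := integral_nonneg fun ω => sq_nonneg _
        have hv0 : 0 ≤ ∫ ω, trackingSq πC SC Y 0 ω ∂P := integral_nonneg fun ω => sq_nonneg _
        have h2 : 0 ≤ e * L ^ 2 * ∫ ω, consensusSq πR SR Y 0 ω ∂P := by positivity
        have h3 : 0 ≤ (2 * η / cPi πR πC + L * η ^ 2) * ∫ ω, trackingSq πC SC Y 0 ω ∂P := by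
          positivity
        have h4 : 0 ≤ L * η ^ 2 * cPi πR πC ^ 2 * (0 + σ ^ 2 / n) := by positivity
        linarith)
    simpa using h1
  have hG01 : G 0 = G 1 := by
    simp only [hG]
    congr 1
    funext ω
    rw [← hxb ω]
  have hsum : ∀ T, 2 ≤ T → e / 16 * ∑ k ∈ Finset.range T, G k
      ≤ V 0 - V T + T * (e * (K / 16) * ε) := by
    intro T hT
    induction T, hT using Nat.le_induction with
    -- The second iteration pays for two gradient terms: G 0 = G 1 and 3/16 ≥ 2/16.
    | base =>
      have h1 := hstep 0
      have h2 := mul_nonneg he0.le (hG0 1)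
      rw [Finset.sum_range_succ, Finset.sum_range_one, hG01]
      simp only [zero_add] at h1
      push_cast
      linarith
    | succ T hT ih =>
      obtain ⟨k, rfl⟩ : ∃ k, T = k + 1 := ⟨T - 1, by omega⟩
      have h1 := hstep k
      have h2 := mul_nonneg he0.le (hG0 (k + 1))
      rw [Finset.sum_range_succ]
      push_cast at ih ⊢
      have h3 : V (k + 1 + 1) = V (k + 2) := rfl
      linarith
  have hT0 : (0 : ℝ) < T := Nat.cast_pos.2 (by omega)
  have h1 := hsum T hT
  have h2 : 1 / (T : ℝ) * ∑ k ∈ Finset.range T, G k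
      = 16 / (e * T) * (e / 16 * ∑ k ∈ Finset.range T, G k) := by field_simp
  rw [h2]
  refine (mul_le_mul_of_nonneg_left h1 (by positivity)).trans_eq ?_
  field_simp

end IsRun

end SMTPP

end

/-! ### The theorem: choice of the constants -/

open SMTPP in
theorem theorem1 :
    -- the constant of the error floor: a function of `L, ρ_R, ρ_C, δ_R, δ_C, c_π, c_Π` only
    ∃ K : ℝ → ℝ → ℝ → ℝ → ℝ → ℝ → ℝ → ℝ,
    ∀ (n : ℕ) (GR GC : Digraph (Fin n)) (R C : Matrix (Fin n) (Fin n) ℝ),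
    IsPushPullNetwork GR GC R C →
    (∃! πR : Fin n → ℝ, IsStationary Rᵀ πR) ∧
    (∃! πC : Fin n → ℝ, IsStationary C πC) ∧
    ∀ πR πC : Fin n → ℝ, IsStationary Rᵀ πR → IsStationary C πC →
    0 < cPi πR πC ∧
    (∃ SR ρR δR, IsMixingNorm R (projR πR) SR ρR δR) ∧
    (∃ SC ρC δC, IsMixingNorm C (projC πC) SC ρC δC) ∧
    ∀ (SR SC : Matrix (Fin n) (Fin n) ℝ) (ρR ρC δR δC : ℝ),
    IsMixingNorm R (projR πR) SR ρR δR → IsMixingNorm C (projC πC) SC ρC δC →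
    ∀ L : ℝ, 0 ≤ L →
    -- the step size threshold and the constant in the size of the weights: network and `L` only
    ∃ c₀ : ℝ, 0 < c₀ ∧ ∃ B : ℝ,
    ∀ lam η : ℝ, 0 < lam → lam < 1 → 0 < η → η ≤ c₀ * lam →
    -- the Lyapunov weights: network, `L`, `λ` and `η` only
    ∃ p : Fin 4 → ℝ,
      (∀ l, 0 < p l) ∧ p 0 = 1 ∧ p 1 ≤ B * η ∧ p 2 ≤ B * η ∧
        p 3 ≤ B * (η ^ 2 / lam + η ^ 3 / lam ^ 3) ∧
      ∀ (d : ℕ) (f : Fin n → EuclideanSpace ℝ (Fin d) → ℝ) (σ : ℝ)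
        (Ω : Type*) [MeasurableSpace Ω] (P : Measure Ω) [IsProbabilityMeasure P]
        (Ξ : Fin n → Type*) [∀ i, MeasurableSpace (Ξ i)] (D : ∀ i, Measure (Ξ i))
        (g : ∀ i, EuclideanSpace ℝ (Fin d) → Ξ i → EuclideanSpace ℝ (Fin d))
        (ξ : ∀ i, ℕ → Ω → Ξ i) (x₀ : EuclideanSpace ℝ (Fin d)) (Y : ℕ → Ω → State n d),
        (∀ i, IsSmoothLoss L (f i)) →
        (∀ i, IsGradientOracle (D i) σ (f i) (g i)) →
        IsSampling P D ξ →
        (∀ k ω, Y k ω = iter R C η lam g x₀ (fun i t => ξ i t ω) k) →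
        -- all the expectations below exist
        (∀ k, Integrable (fun ω => ‖gradient (globalLoss f) (xbar πR Y k ω)‖ ^ 2) P ∧
          Integrable (fun ω => globalLoss f (ztilde πR πC η lam Y k ω)) P ∧
          Integrable (consensusSq πR SR Y k) P ∧
          Integrable (trackingSq πC SC Y k) P ∧
          Integrable (momentumSq f Y k) P ∧
          Integrable (fun ω => ‖mbarPrev Y k ω‖ ^ 2) P) ∧
        ∀ T : ℕ, 2 ≤ T →
          (1 / (T : ℝ)) * ∑ k ∈ Finset.range T,
              ∫ ω, ‖gradient (globalLoss f) (xbar πR Y k ω)‖ ^ 2 ∂P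
            ≤ 16 * (lyapunov P πR πC SR SC η lam p f Y 0 - lyapunov P πR πC SR SC η lam p f Y T)
                / (η * cPi πR πC * T)
              + K L ρR ρC δR δC (cPi πR πC) (cProj πC)
                * (η * σ ^ 2 / n + lam ^ 2 * σ ^ 2 * n) := by
  refine ⟨fun L _ ρC _ δC c cP => floorConst L ρC δC c cP, fun n GR GC R C hnet => ?_⟩
  obtain ⟨hR, hC, hmix⟩ := hnet.stationary_and_mixing
  refine ⟨hR, hC, fun πR πC hπR hπC => ?_⟩
  obtain ⟨hc, hSR, hSC⟩ := hmix πR πC hπR hπC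
  refine ⟨hc, hSR, hSC, fun SR SC ρR ρC δR δC hSR hSC L hL => ?_⟩
  have hn : 0 < n := by
    obtain ⟨r, -⟩ := hnet.common_root
    exact r.pos
  have hρR := hSR.rho_lt_one
  have hρC := hSC.rho_lt_one
  obtain ⟨c₀, hc₀, hsmall⟩ := exists_isSmallRatio (R := R) (δR := δR) (δC := δC) hρR hρC hc hL
  obtain ⟨B, hB⟩ := exists_weights_bound (R := R) (L := L) (δR := δR) (δC := δC) hρR hρC hc
  refine ⟨c₀, hc₀, B, fun lam η hl hl1 hη hηc => ?_⟩
  -- The threshold concerns only the ratio t = η/λ: η ≤ c₀ λ is t ≤ c₀.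
  have ht : 0 < η / lam := div_pos hη hl
  have htη : η = η / lam * lam := (div_mul_cancel₀ η hl.ne').symm
  have hts := hsmall (η / lam) ht.le ((div_le_iff₀ hl).2 hηc)
  obtain ⟨hB1, hB2, hB3⟩ := hB (η / lam) lam ht hl hl1
  rw [← htη] at hB1 hB2 hB3
  refine ⟨weights R πR πC L ρR ρC δR δC (η / lam) lam, weights_pos hρR hρC hc ht hl, rfl, hB1, hB2,
    hB3, ?_⟩
  intro d f σ Ω _ P _ Ξ _ D g ξ x₀ Y hf hg hS hY
  have h : IsRun P R C η lam L σ D f g ξ x₀ Y := ⟨hf, hg, hS, hY⟩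
  exact ⟨fun k => ⟨integrable_norm_sq (h.memLp_gradient_globalLoss_comp (h.memLp_xbar πR k)),
      h.integrable_globalLoss_comp hn hL (h.memLp_ztilde πR πC k), h.integrable_consensusSq k,
      h.integrable_trackingSq k, h.integrable_momentumSq k,
      integrable_norm_sq (h.memLp_mbarPrev k)⟩,
    fun T hT => h.avg_norm_gradient_sq_le hnet.row_stochastic hnet.col_stochastic hn hπR hπC hc
      hSR hSC hL hl hl1 ht htη hts hT⟩
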